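/- **Setting.** Let $G$ and $H$ be finite undirected simple graphs with $n$, $n'$ vertices and $m$, $m'$ edges, whose vertices and edges carry categorical labels ($\mu$ on vertices, $\nu$ on edges), and let $\Delta$ be the larger of their maximum degrees. Let non-negative real costs be given for relabeling, deleting and inserting vertices and edges (depending only on the labels), and level weights $\lambda_0,\lambda_1,\dots\ge 0$. *Neighborhood trees.* The unfolding tree $F_h^v$ of height $h$ of a vertex $v$ has as nodes the walks of length at most $h$ starting at $v$; the parent of a walk is the walk without its last step, and a node $x$ represents the end vertex $\phi(x)$ of the walk. The $k$-redundant neighborhood tree $T_{h,k}^v$ is the subtree of the nodes $x$ with $\operatorname{depth}(x)\le \operatorname{depth}(y)+k$ for all nodes $y$ of $F_h^v$ with $\phi(y)=\phi(x)$. The compressed neighborhood tree (cNT) $C_{h,k}^v$ arises from $T_{h,k}^v$ by merging all nodes of equal depth that represent the same vertex. It is a layered directed acyclic graph, in which a node may have several parents, and it stands for the rooted tree of its directed paths starting at the root. *Distance.* For finite rooted trees $T$, $T'$, a set $M\subseteq V(T)\times V(T')$ is structure and depth preserving if it is a partial injection, contains the pair of roots, and contains with every pair of non-root nodes also the pair of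 their parents. The cost of $M$ is the sum of the relabeling costs of the pairs in $M$ and of the deletion and insertion costs of the nodes of $T$ and $T'$ not covered by $M$; here the cost of a non-root node includes that of the edge to its parent, and the cost of a node at depth $i$ is multiplied by $\lambda_i$. $\mathrm{SDTED}(T,T')$ is the minimum cost of such an $M$, and the SDTED of two cNTs is that of the rooted trees they stand for. *Cost matrix.* The bipartite graph matching (BGM) cost matrix consists of the $n\times n'$ entries $c_{v,v'}=\mathrm{SDTED}(C_{h,k}^v,C_{h,k}^{v'})$ for $v\in V(G)$, $v'\in V(H)$, of the entries $c_{v,\epsilon}$ (cost of deleting $v$ and its incident edges) and $c_{\epsilon,v'}$ (cost of inserting $v'$ and its incident edges); the repeated identical placeholder columns and rows are represented by a single one. *Machine.* A unit-cost random access machine whose programs are finite, with integer and real registers and two-dimensional arrays of integers and of reals; it has addition, truncated subtraction and comparison of integers, addition, subtraction, multiplication and comparison of reals. The input is given by the numbers $n,n',h,k$ and the number of labels, arrays with the vertex degrees, adjacency lists (in arbitrary order) and labels, the tables of edit costs, and $\lambda_0,\dots,\lambda_h$. **Theorem.** There is a single program that, for all $k\ge 0$, all such $G$, $H$, all costs and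 weights and every height bound $h\ge 0$, halts with the BGM cost matrix as output, such that 1. for every fixed $k$ its running time is $O(n\,n'\,m\,m'\,\Delta)$, with a constant that depends only on $k$; 2. for every fixed $k$ and every fixed bound $D$ on the degrees its running time on graphs with $\Delta\le D$ is $O((n\,n')^2)$, with a constant that depends only on $k$ and $D$. In both bounds a factor among $n,n',m,m',\Delta$ that is zero is to be read as $1$. -/

import Mathlib

noncomputable section

namespace CNTCost

/-! ## A unit-cost random access machine with integer and real memory

Programs are finite terms of a structured imperative language.  The memory consists of scalar
registers and two-dimensional arrays, holding natural numbers or real numbers.  Integer arithmetic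
is addition and truncated subtraction only (no multiplication), real arithmetic is `+`, `-`, `*`
with the constants `0` and `1`, and there is no conversion between integers and reals; the only way
to inspect a real number is to compare it.  Every operation, memory access and comparison costs one
unit of time. -/

/-- A memory configuration. `narr a i j` is the cell `(i, j)` of the integer array with name `a`. -/
structure State where
  nvar : ℕ → ℕ
  narr : ℕ → ℕ → ℕ → ℕ
  rvar : ℕ → ℝ
  rarr : ℕ → ℕ → ℕ → ℝ

/-- Overwriting a single cell of an array. -/
def upd {α : Type} (f : ℕ → ℕ → ℕ → α) (a i j : ℕ) (x : α) : ℕ → ℕ → ℕ → α :=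
  fun a' i' j' => if a' = a ∧ i' = i ∧ j' = j then x else f a' i' j'

/-- Integer expressions. -/
inductive NExp where
  | const (c : ℕ)
  | var (x : ℕ)
  | arr (a : ℕ) (i j : NExp)
  | add (e f : NExp)
  | sub (e f : NExp)

/-- Value of an integer expression. -/
def NExp.eval (s : State) : NExp → ℕ
  | .const c => c
  | .var x => s.nvar x
  | .arr a i j => s.narr a (i.eval s) (j.eval s)
  | .add e f => e.eval s + f.eval s
  | .sub e f => e.eval s - f.eval s

/-- Time for evaluating an integer expression: one unit per constant, access or operation. -/
def NExp.cost : NExp → ℕ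
  | .const _ => 1
  | .var _ => 1
  | .arr _ i j => 1 + i.cost + j.cost
  | .add e f => 1 + e.cost + f.cost
  | .sub e f => 1 + e.cost + f.cost

/-- Real expressions. -/
inductive RExp where
  | zero
  | one
  | var (x : ℕ)
  | arr (a : ℕ) (i j : NExp)
  | add (e f : RExp)
  | sub (e f : RExp)
  | mul (e f : RExp)

/-- Value of a real expression. -/
def RExp.eval (s : State) : RExp → ℝ
  | .zero => 0
  | .one => 1
  | .var x => s.rvar x
  | .arr a i j => s.rarr a (i.eval s) (j.eval s)
  | .add e f => e.eval s + f.eval s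
  | .sub e f => e.eval s - f.eval s
  | .mul e f => e.eval s * f.eval s

/-- Time for evaluating a real expression. -/
def RExp.cost : RExp → ℕ
  | .zero => 1
  | .one => 1
  | .var _ => 1
  | .arr _ i j => 1 + i.cost + j.cost
  | .add e f => 1 + e.cost + f.cost
  | .sub e f => 1 + e.cost + f.cost
  | .mul e f => 1 + e.cost + f.cost

/-- Tests. -/
inductive BExp where
  | neq (e f : NExp)
  | nlt (e f : NExp)
  | rlt (e f : RExp)
  | not (b : BExp)
  | and (b c : BExp)

/-- Truth of a test: `neq e f` tests whether the integers `e` and `f` are equal, `nlt` and `rlt`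
test for strict inequality of integers and of reals. -/
def BExp.holds (s : State) : BExp → Prop
  | .neq e f => e.eval s = f.eval s
  | .nlt e f => e.eval s < f.eval s
  | .rlt e f => e.eval s < f.eval s
  | .not b => ¬ b.holds s
  | .and b c => b.holds s ∧ c.holds s

/-- Time for evaluating a test. -/
def BExp.cost : BExp → ℕ
  | .neq e f => 1 + e.cost + f.cost
  | .nlt e f => 1 + e.cost + f.cost
  | .rlt e f => 1 + e.cost + f.cost
  | .not b => 1 + b.cost
  | .and b c => 1 + b.cost + c.cost

/-- Programs. -/
inductive Prog where
  | skip
  | nset (x : ℕ) (e : NExp)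
  | nstore (a : ℕ) (i j e : NExp)
  | rset (x : ℕ) (e : RExp)
  | rstore (a : ℕ) (i j : NExp) (e : RExp)
  | seq (P Q : Prog)
  | ite (b : BExp) (P Q : Prog)
  | while (b : BExp) (P : Prog)

/-- `Exec P s t s'`: started in memory `s`, the program `P` halts after exactly `t` units of time
with memory `s'`. -/
inductive Exec : Prog → State → ℕ → State → Prop where
  | skip (s : State) : Exec .skip s 1 s
  | nset (s : State) (x : ℕ) (e : NExp) :
      Exec (.nset x e) s (1 + e.cost) { s with nvar := Function.update s.nvar x (e.eval s) }
  | nstore (s : State) (a : ℕ) (i j e : NExp) :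
      Exec (.nstore a i j e) s (1 + i.cost + j.cost + e.cost)
        { s with narr := upd s.narr a (i.eval s) (j.eval s) (e.eval s) }
  | rset (s : State) (x : ℕ) (e : RExp) :
      Exec (.rset x e) s (1 + e.cost) { s with rvar := Function.update s.rvar x (e.eval s) }
  | rstore (s : State) (a : ℕ) (i j : NExp) (e : RExp) :
      Exec (.rstore a i j e) s (1 + i.cost + j.cost + e.cost)
        { s with rarr := upd s.rarr a (i.eval s) (j.eval s) (e.eval s) }
  | seq {P Q : Prog} {s s' s'' : State} {t t' : ℕ} :
      Exec P s t s' → Exec Q s' t' s'' → Exec (.seq P Q) s (t + t') s''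
  | ite_true {b : BExp} {P Q : Prog} {s s' : State} {t : ℕ} :
      b.holds s → Exec P s t s' → Exec (.ite b P Q) s (1 + b.cost + t) s'
  | ite_false {b : BExp} {P Q : Prog} {s s' : State} {t : ℕ} :
      ¬ b.holds s → Exec Q s t s' → Exec (.ite b P Q) s (1 + b.cost + t) s'
  | while_false {b : BExp} {P : Prog} {s : State} :
      ¬ b.holds s → Exec (.while b P) s (1 + b.cost) s
  | while_true {b : BExp} {P : Prog} {s s' s'' : State} {t t' : ℕ} :
      b.holds s → Exec P s t s' → Exec (.while b P) s' t' s'' →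
        Exec (.while b P) s (1 + b.cost + t + t') s''

/-! ## Labeled graphs and edit costs -/

/-- A finite undirected graph on the vertices `0, …, n - 1` with vertex and edge labels from a set
of `L` categorical labels. Only the values of `elabel` on edges of the graph are ever used. -/
structure LabeledGraph (n L : ℕ) where
  graph : SimpleGraph (Fin n)
  decAdj : DecidableRel graph.Adj
  vlabel : Fin n → Fin L
  elabel : Sym2 (Fin n) → Fin L

attribute [instance] LabeledGraph.decAdj

/-- Number of edges. -/
def LabeledGraph.numEdges {n L : ℕ} (G : LabeledGraph n L) : ℕ := G.graph.edgeFinset.card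

/-- Adjacency lists: the neighbors of every vertex are listed once each, in an arbitrary order. -/
abbrev LabeledGraph.AdjLists {n L : ℕ} (G : LabeledGraph n L) : Type :=
  (v : Fin n) → Fin (G.graph.degree v) ≃ G.graph.neighborSet v

/-- Non-negative costs for relabeling, deleting and inserting vertices and edges. -/
structure EditCosts (L : ℕ) where
  vsub : Fin L → Fin L → ℝ
  vdel : Fin L → ℝ
  vins : Fin L → ℝ
  esub : Fin L → Fin L → ℝ
  edel : Fin L → ℝ
  eins : Fin L → ℝ
  vsub_nonneg : ∀ a b, 0 ≤ vsub a b
  vdel_nonneg : ∀ a, 0 ≤ vdel a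
  vins_nonneg : ∀ a, 0 ≤ vins a
  esub_nonneg : ∀ a b, 0 ≤ esub a b
  edel_nonneg : ∀ a, 0 ≤ edel a
  eins_nonneg : ∀ a, 0 ≤ eins a

/-! ## Rooted trees and the structure and depth preserving tree edit distance -/

/-- A finite rooted tree with labels on its nodes and edges, given by the parent function (with the
convention that the root is its own parent). `elabel u` is the label of the edge from `parent u`
to `u`, and is meaningless for the root. -/
structure RootedTree (Λ : Type) where
  Node : Type
  finite : Finite Node
  root : Node
  parent : Node → Node
  parent_root : parent root = root
  reach : ∀ u, ∃ d : ℕ, parent^[d] u = root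
  vlabel : Node → Λ
  elabel : Node → Λ

instance {Λ : Type} (T : RootedTree Λ) : Fintype T.Node :=
  haveI := T.finite
  Fintype.ofFinite _

open scoped Classical in
/-- Length of the path from a node to the root. -/
def RootedTree.depth {Λ : Type} (T : RootedTree Λ) (u : T.Node) : ℕ := Nat.find (T.reach u)

/-- Structure and depth preserving mappings. -/
structure IsSDM {Λ : Type} (T T' : RootedTree Λ) (M : Finset (T.Node × T'.Node)) : Prop where
  inj : ∀ p ∈ M, ∀ q ∈ M, p.1 = q.1 ↔ p.2 = q.2
  root_mem : (T.root, T'.root) ∈ M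
  parent_mem : ∀ p ∈ M, (T.parent p.1, T'.parent p.2) ∈ M

section Costs

variable {L : ℕ} (c : EditCosts L) (T T' : RootedTree (Fin L))

open scoped Classical in
/-- Cost of relabeling `u` into `u'`, together with the edges leading to their parents. -/
def relabelCost (u : T.Node) (u' : T'.Node) : ℝ :=
  c.vsub (T.vlabel u) (T'.vlabel u') +
    if u = T.root then 0 else c.esub (T.elabel u) (T'.elabel u')

open scoped Classical in
/-- Cost of deleting `u` together with the edge leading to its parent. -/
def nodeDelCost (u : T.Node) : ℝ :=
  c.vdel (T.vlabel u) + if u = T.root then 0 else c.edel (T.elabel u)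

open scoped Classical in
/-- Cost of inserting `u` together with the edge leading to its parent. -/
def nodeInsCost (u : T.Node) : ℝ :=
  c.vins (T.vlabel u) + if u = T.root then 0 else c.eins (T.elabel u)

open scoped Classical in
/-- Cost of a mapping; the edit costs of nodes at depth `i` are multiplied by `lam i`. -/
def mappingCost (lam : ℕ → ℝ) (M : Finset (T.Node × T'.Node)) : ℝ :=
  (∑ p ∈ M, lam (T.depth p.1) * relabelCost c T T' p.1 p.2) +
  (∑ u with ∀ u', (u, u') ∉ M, lam (T.depth u) * nodeDelCost c T u) +
  (∑ u' with ∀ u, (u, u') ∉ M, lam (T'.depth u') * nodeInsCost c T' u')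

/-- The structure and depth preserving tree edit distance. -/
def sdted (lam : ℕ → ℝ) : ℝ :=
  sInf {x : ℝ | ∃ M : Finset (T.Node × T'.Node), IsSDM T T' M ∧ x = mappingCost c T T' lam M}

/-- The infimum in the definition of `sdted` is a minimum. -/
theorem sdted_isLeast (lam : ℕ → ℝ) :
    IsLeast {x : ℝ | ∃ M : Finset (T.Node × T'.Node),
      IsSDM T T' M ∧ x = mappingCost c T T' lam M} (sdted c T T' lam) := by
  have hfin : {x : ℝ | ∃ M : Finset (T.Node × T'.Node),
      IsSDM T T' M ∧ x = mappingCost c T T' lam M}.Finite := by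
    refine (Set.finite_range (fun M : Finset (T.Node × T'.Node) =>
      mappingCost c T T' lam M)).subset ?_
    rintro x ⟨M, -, rfl⟩
    exact ⟨M, rfl⟩
  refine ⟨Set.Nonempty.csInf_mem ⟨_, {(T.root, T'.root)}, ⟨?_, ?_, ?_⟩, rfl⟩ hfin,
    fun x hx => csInf_le hfin.bddBelow hx⟩
  · intro p hp q hq
    rw [Finset.mem_singleton] at hp hq
    simp [hp, hq]
  · simp
  · intro p hp
    rw [Finset.mem_singleton] at hp
    simp [hp, T.parent_root, T'.parent_root]

end Costs

/-! ## Compressed trees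

A compressed tree is a layered directed acyclic graph. A node may have several parents and then
stands for several isomorphic copies of the subtree rooted at it: the compressed tree represents
the rooted tree whose nodes are the directed paths starting at its root. -/

/-- A rooted layered directed acyclic graph with labels on nodes and edges. -/
structure CompressedTree (Λ : Type) where
  Node : Type
  finite : Finite Node
  root : Node
  Child : Node → Node → Prop
  depth : Node → ℕ
  height : ℕ
  depth_root : depth root = 0
  depth_child : ∀ u w, Child u w → depth w = depth u + 1
  depth_le : ∀ u, depth u ≤ height
  vlabel : Node → Λ
  elabel : Node → Node → Λ

/-- Directed paths `root = u₀ → u₁ → ⋯ → u_d`, written in reverse order as `[u_d, …, u₁, u₀]`. -/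
def CompressedTree.paths {Λ : Type} (C : CompressedTree Λ) : Set (List C.Node) :=
  {l | l.IsChain (fun w u => C.Child u w) ∧ l.getLast? = some C.root}

theorem CompressedTree.length_of_mem_paths {Λ : Type} (C : CompressedTree Λ) (l : List C.Node) :
    ∀ u, u :: l ∈ C.paths → l.length = C.depth u := by
  induction l with
  | nil =>
    rintro u ⟨-, h⟩
    have h' : u = C.root := by simpa using h
    simp [h', C.depth_root]
  | cons w l ih =>
    rintro u ⟨h, h'⟩
    rw [List.isChain_cons_cons] at h
    rw [List.getLast?_cons_cons] at h'
    simp [C.depth_child _ _ h.1, ih w ⟨h.2, h'⟩]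

theorem CompressedTree.paths_finite {Λ : Type} (C : CompressedTree Λ) : C.paths.Finite := by
  have := C.finite
  refine (List.finite_length_le C.Node (C.height + 1)).subset ?_
  intro l hl
  cases l with
  | nil => simp
  | cons u l =>
    have h := C.length_of_mem_paths l u hl
    have h' := C.depth_le u
    rw [Set.mem_ofPred_eq, List.length_cons]
    omega

theorem CompressedTree.nil_notMem_paths {Λ : Type} (C : CompressedTree Λ) : [] ∉ C.paths := by
  rintro ⟨-, h⟩
  simp at h

theorem CompressedTree.tail_mem_paths {Λ : Type} (C : CompressedTree Λ) {l : List C.Node}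
    (hl : l ∈ C.paths) (h : l.tail ≠ []) : l.tail ∈ C.paths := by
  match l, hl, h with
  | [], _, h => simp at h
  | [_], _, h => simp at h
  | _ :: _ :: _, hl, _ =>
    exact ⟨(List.isChain_cons_cons.1 hl.1).2, by simpa [List.getLast?_cons_cons] using hl.2⟩

/-- The first node in the list of a path, which is its end point. -/
def CompressedTree.endpoint {Λ : Type} (C : CompressedTree Λ) (l : C.paths) : C.Node :=
  l.1.head (fun h => C.nil_notMem_paths (h ▸ l.2))

open scoped Classical in
/-- The rooted tree represented by a compressed tree: its nodes are the directed paths starting at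
the root, and the parent of a path is obtained by removing its last step. -/
def CompressedTree.unfold {Λ : Type} (C : CompressedTree Λ) : RootedTree Λ where
  Node := C.paths
  finite := C.paths_finite
  root := ⟨[C.root], by simp [CompressedTree.paths]⟩
  parent := fun l => if h : l.1.tail = [] then l else ⟨l.1.tail, C.tail_mem_paths l.2 h⟩
  parent_root := by simp
  reach := by
    rintro ⟨l, hl⟩
    induction l with
    | nil => exact absurd hl C.nil_notMem_paths
    | cons u l ih =>
      by_cases h : l = []
      · subst h
        refine ⟨0, ?_⟩
        have h' : u = C.root := by simpa [CompressedTree.paths] using hl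
        simp [h']
      · obtain ⟨d, hd⟩ := ih (C.tail_mem_paths hl h)
        refine ⟨d + 1, ?_⟩
        rw [Function.iterate_succ_apply]
        simpa [h] using hd
  vlabel := fun l => C.vlabel (C.endpoint l)
  elabel := fun l => if h : l.1.tail = [] then C.vlabel C.root
    else C.elabel (C.endpoint ⟨l.1.tail, C.tail_mem_paths l.2 h⟩) (C.endpoint l)

/-! ## Unfolding trees, `k`-redundant neighborhood trees and their compression -/

section NeighborhoodTrees

variable {n L : ℕ} (G : LabeledGraph n L) (v : Fin n)

/-- The nodes of the unfolding tree of height `i` of the vertex `v`: walks of length at most `i`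
starting at `v`, written in reverse order. The node `u :: l` represents the vertex `u`, has depth
`l.length`, and (unless `l` is empty) its parent is `l`. -/
def unfoldingNodes (i : ℕ) : Set (List (Fin n)) :=
  {l | l.IsChain G.graph.Adj ∧ l.getLast? = some v ∧ l.length ≤ i + 1}

/-- The nodes of the `k`-redundant neighborhood tree of height `i` of the vertex `v`: the nodes of
the unfolding tree whose depth exceeds the depth of no node representing the same vertex by more
than `k`. -/
def ntNodes (i k : ℕ) : Set (List (Fin n)) :=
  {l | l ∈ unfoldingNodes G v i ∧ ∀ l' ∈ unfoldingNodes G v i,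
    l.head? = l'.head? → l.length - 1 ≤ l'.length - 1 + k}

/-- The compressed `k`-redundant neighborhood tree of height at most `i`: nodes of the
`k`-redundant neighborhood tree with the same depth which represent the same vertex are merged.
The node `(u, d)` is the result of merging all nodes of depth `d` representing `u`. -/
def cNT (i k : ℕ) : CompressedTree (Fin L) where
  Node := {p : Fin n × Fin (i + 1) // ∃ l, p.1 :: l ∈ ntNodes G v i k ∧ l.length = p.2}
  finite := inferInstance
  root := ⟨(v, 0), [], by
    refine ⟨⟨by simp, by simp, by simp⟩, fun l' _ _ => by simp⟩, by simp⟩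
  Child := fun p q => ∃ l, q.1.1 :: p.1.1 :: l ∈ ntNodes G v i k ∧
    l.length = p.1.2 ∧ l.length + 1 = q.1.2
  depth := fun p => p.1.2
  height := i
  depth_root := by simp
  depth_child := by
    rintro p q ⟨l, -, h, h'⟩
    omega
  depth_le := fun p => Nat.lt_succ_iff.1 p.1.2.2
  vlabel := fun p => G.vlabel p.1.1
  elabel := fun p q => G.elabel s(p.1.1, q.1.1)

end NeighborhoodTrees

/-! ## Cost matrix, input and output -/

section Matrix

variable {n n' L : ℕ} (G : LabeledGraph n L) (H : LabeledGraph n' L)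
  (c : EditCosts L) (lam : ℕ → ℝ) (h k : ℕ)

/-- The entry for replacing the vertex `i` of `G` by the vertex `j` of `H`: the distance between
their compressed neighborhood trees. -/
def substEntry (i : Fin n) (j : Fin n') : ℝ :=
  sdted c (cNT G i h k).unfold (cNT H j h k).unfold lam

/-- The entry for deleting the vertex `i` of `G` and its incident edges. -/
def delEntry (i : Fin n) : ℝ :=
  c.vdel (G.vlabel i) + ∑ u ∈ G.graph.neighborFinset i, c.edel (G.elabel s(i, u))

/-- The entry for inserting the vertex `j` of `H` and its incident edges. -/
def insEntry (j : Fin n') : ℝ :=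
  c.vins (H.vlabel j) + ∑ u ∈ H.graph.neighborFinset j, c.eins (H.elabel s(j, u))

/-- A finite one-dimensional table as an array (zero outside of its range). -/
def table {α : Type} [Zero α] {a : ℕ} (f : Fin a → α) : ℕ → ℕ → α :=
  fun i j => if hi : i < a ∧ j = 0 then f ⟨i, hi.1⟩ else 0

/-- A finite two-dimensional table with rows of varying lengths as an array (zero outside of its
range). -/
def table₂ {α : Type} [Zero α] {a : ℕ} {b : Fin a → ℕ} (f : (i : Fin a) → Fin (b i) → α) :
    ℕ → ℕ → α :=
  fun i j => if hi : i < a then (if hj : j < b ⟨i, hi⟩ then f ⟨i, hi⟩ ⟨j, hj⟩ else 0) else 0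

/-- The arrays describing a graph: vertex degrees, adjacency lists, the labels of the edges in the
adjacency lists, and vertex labels. -/
def LabeledGraph.encode (G : LabeledGraph n L) (adj : G.AdjLists) : Fin 4 → ℕ → ℕ → ℕ :=
  ![table (fun v => G.graph.degree v),
    table₂ (fun v j => ((adj v j : Fin n) : ℕ)),
    table₂ (fun v j => (G.elabel s(v, (adj v j : Fin n)) : ℕ)),
    table (fun v => (G.vlabel v : ℕ))]

/-- The initial memory. The integer registers `0, 1, 2, 3, 4` hold `n`, `n'`, the number of labels,
the height `h` and the redundancy `k`. The integer arrays `0, …, 3` describe `G` and `4, …, 7`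
describe `H`. The real arrays `0, …, 5` hold the edit costs, and the real array `6` holds the
weights of the levels `0, …, h`. All other cells are zero. -/
def initState (adjG : G.AdjLists) (adjH : H.AdjLists) : State where
  nvar := fun x => [n, n', L, h, k].getD x 0
  narr := fun a =>
    if ha : a < 4 then G.encode adjG ⟨a, ha⟩
    else if ha : a - 4 < 4 then H.encode adjH ⟨a - 4, ha⟩
    else fun _ _ => 0
  rvar := fun _ => 0
  rarr := fun a =>
    match a with
    | 0 => table₂ c.vsub
    | 1 => table c.vdel
    | 2 => table c.vins
    | 3 => table₂ c.esub
    | 4 => table c.edel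
    | 5 => table c.eins
    | 6 => table (fun i : Fin (h + 1) => lam i)
    | _ => fun _ _ => 0

/-- The memory `s` holds the cost matrix: the `n × n'` block of replacement costs is stored in the
real array `7`, and the column of deletion costs and the row of insertion costs are stored in the
real arrays `8` and `9`. -/
def HoldsCostMatrix (s : State) : Prop :=
  (∀ (i : Fin n) (j : Fin n'), s.rarr 7 i j = substEntry G H c lam h k i j) ∧
  (∀ i : Fin n, s.rarr 8 i 0 = delEntry G c i) ∧
  (∀ j : Fin n', s.rarr 9 j 0 = insEntry H c j)

/-- Started on the input, the program `P` halts within `B` units of time and has then computed the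
cost matrix. -/
def ComputesWithin (P : Prog) (adjG : G.AdjLists) (adjH : H.AdjLists) (B : ℕ) : Prop :=
  ∃ (t : ℕ) (s : State), Exec P (initState G H c lam h k adjG adjH) t s ∧ t ≤ B ∧
    HoldsCostMatrix G H c lam h k s

end Matrix

end CNTCost

end

noncomputable section

namespace CNTCost

/-! ## Reasoning about programs -/

-- Size of the trees. A node of a compressed tree is a pair of a vertex and a depth. A vertex at
-- distance `e` from the start can occur only at the depths `e, …, e + k`, so every reachable vertex
-- contributes at most `k + 1` nodes, whatever the height. Apart from the start, a reachable vertex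
-- has positive degree. Hence the sum of degree plus one over all nodes is at most `5 * (k + 1) *
-- max 1 m`, independently of `n` and `h` (`AdjData.sum_nodes_le`, `Encodes.sum_nodes_le`).
--
-- Recurrence. Let `F p q` be the distance of the subtrees below two nodes, without the edges above
-- them. A mapping that matches `p` and `q` induces a partial matching of their children. Give a
-- pair of children the change in cost, relative to deleting one subtree and inserting the other,
-- that is caused by matching them. Then `F p q` is the relabeling cost of `p` and `q`, plus the
-- costs of deleting and inserting all proper descendants, plus the minimum weight of a partial
-- matching of the children. To prove this without manipulating subtrees, `IsSDM.mappingCost_eq`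
-- writes the cost of any mapping `M` as `F 0 0` plus the sum, over the pairs of `M`, of the excess
-- of the induced matching over the minimum. Every excess is nonnegative, and all of them vanish for
-- the mapping assembled from optimal matchings from the roots downwards (`sdted_eq`). The copies of
-- a node in the unfolded tree share their matchings, so `F` is indexed by nodes of the compressed
-- trees, although the unfolded trees may be exponentially larger; `Encodes.exists_presents`
-- supplies the link.
--
-- Matchings. The minima are found by a Hungarian method with nonpositive dual variables, which
-- suits partial matchings with weights of any sign. It takes time `O(a b²)` for `a` rows and `b`
-- columns, up to replacing `a` and `b` by `a + 1` and `b + 1` (`hung_runs`).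
--
-- Time. The numbers `a p`, `b q` of children are bounded by the degrees, so the sum of `(a p + 1)
-- (b q + 1)²` over all pairs of nodes is at most `O(Δ)` times the product of the sums of `a p + 1`
-- and of `b q + 1`, which is `O(m m' Δ)` for fixed `k`. There are `n n'` pairs of trees. For
-- bounded degrees `m` and `m'` are `O(n)` and `O(n')`, which turns the first bound into the second.
--
-- Two points of the implementation matter for this. Breadth first search numbers children after
-- their parents, so the recurrences are evaluated by descending indices. Clearing the tables
-- indexed by vertices would cost order `n` per pair, which `m m' Δ` need not dominate when there
-- are isolated vertices; instead every pair uses a fresh row of the zero-initialized memory.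
--
-- Correctness and time are proved together through `Runs`, with `Frame` recording which cells are
-- untouched.

notation:60 P:61 " ;; " Q:60 => Prog.seq P Q

/-- Started in `s`, the program `P` halts within `B` units of time in a memory satisfying `Q`. -/
def Runs (P : Prog) (s : State) (B : ℕ) (Q : State → Prop) : Prop :=
  ∃ t s', Exec P s t s' ∧ t ≤ B ∧ Q s'

namespace Prog

/-- Integer registers written by a program. -/
def wn : Prog → List ℕ
  | .nset x _ => [x]
  | .seq P Q => P.wn ++ Q.wn
  | .ite _ P Q => P.wn ++ Q.wn
  | .while _ P => P.wn
  | _ => []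

/-- Integer arrays written by a program. -/
def wna : Prog → List ℕ
  | .nstore a _ _ _ => [a]
  | .seq P Q => P.wna ++ Q.wna
  | .ite _ P Q => P.wna ++ Q.wna
  | .while _ P => P.wna
  | _ => []

/-- Real registers written by a program. -/
def wr : Prog → List ℕ
  | .rset x _ => [x]
  | .seq P Q => P.wr ++ Q.wr
  | .ite _ P Q => P.wr ++ Q.wr
  | .while _ P => P.wr
  | _ => []

/-- Real arrays written by a program. -/
def wra : Prog → List ℕ
  | .rstore a _ _ _ => [a]
  | .seq P Q => P.wra ++ Q.wra
  | .ite _ P Q => P.wra ++ Q.wra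
  | .while _ P => P.wra
  | _ => []

open scoped Classical in
/-- The effect of a program without loops. -/
def den : Prog → State → State
  | .skip, s => s
  | .nset x e, s => { s with nvar := Function.update s.nvar x (e.eval s) }
  | .nstore a i j e, s => { s with narr := upd s.narr a (i.eval s) (j.eval s) (e.eval s) }
  | .rset x e, s => { s with rvar := Function.update s.rvar x (e.eval s) }
  | .rstore a i j e, s => { s with rarr := upd s.rarr a (i.eval s) (j.eval s) (e.eval s) }
  | .seq P Q, s => Q.den (P.den s)
  | .ite b P Q, s => if b.holds s then P.den s else Q.den s
  | .while _ _, s => s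

/-- A program without loops. -/
def loopFree : Prog → Bool
  | .seq P Q => P.loopFree && Q.loopFree
  | .ite _ P Q => P.loopFree && Q.loopFree
  | .while _ _ => false
  | _ => true

/-- Time bound for a program without loops. -/
def time : Prog → ℕ
  | .skip => 1
  | .nset _ e => 1 + e.cost
  | .nstore _ i j e => 1 + i.cost + j.cost + e.cost
  | .rset _ e => 1 + e.cost
  | .rstore _ i j e => 1 + i.cost + j.cost + e.cost
  | .seq P Q => P.time + Q.time
  | .ite b P Q => 1 + b.cost + (P.time + Q.time)
  | .while _ _ => 0

end Prog

/-- The memory cells not written by `P` agree in `s` and `s'`. -/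
structure Frame (P : Prog) (s s' : State) : Prop where
  nv : ∀ x, x ∉ P.wn → s'.nvar x = s.nvar x
  na : ∀ a, a ∉ P.wna → s'.narr a = s.narr a
  rv : ∀ x, x ∉ P.wr → s'.rvar x = s.rvar x
  ra : ∀ a, a ∉ P.wra → s'.rarr a = s.rarr a

theorem Frame.refl (P : Prog) (s : State) : Frame P s s :=
  ⟨fun _ _ => rfl, fun _ _ => rfl, fun _ _ => rfl, fun _ _ => rfl⟩

theorem Frame.trans {P : Prog} {s s' s'' : State} (h : Frame P s s') (h' : Frame P s' s'') :
    Frame P s s'' :=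
  ⟨fun x hx => (h'.nv x hx).trans (h.nv x hx), fun x hx => (h'.na x hx).trans (h.na x hx),
    fun x hx => (h'.rv x hx).trans (h.rv x hx), fun x hx => (h'.ra x hx).trans (h.ra x hx)⟩

theorem Frame.mono {P Q : Prog} {s s' : State} (h : Frame P s s')
    (h1 : P.wn ⊆ Q.wn) (h2 : P.wna ⊆ Q.wna) (h3 : P.wr ⊆ Q.wr) (h4 : P.wra ⊆ Q.wra) :
    Frame Q s s' :=
  ⟨fun x hx => h.nv x fun h => hx (h1 h), fun x hx => h.na x fun h => hx (h2 h),
    fun x hx => h.rv x fun h => hx (h3 h), fun x hx => h.ra x fun h => hx (h4 h)⟩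

theorem Frame.seq_left {P Q : Prog} {s s' : State} (h : Frame P s s') : Frame (P ;; Q) s s' := by
  apply h.mono <;> intro x hx <;> simp [Prog.wn, Prog.wna, Prog.wr, Prog.wra, hx]

theorem Frame.seq_right {P Q : Prog} {s s' : State} (h : Frame Q s s') : Frame (P ;; Q) s s' := by
  apply h.mono <;> intro x hx <;> simp [Prog.wn, Prog.wna, Prog.wr, Prog.wra, hx]

theorem Frame.ite_left {b : BExp} {P Q : Prog} {s s' : State} (h : Frame P s s') :
    Frame (.ite b P Q) s s' := by
  apply h.mono <;> intro x hx <;> simp [Prog.wn, Prog.wna, Prog.wr, Prog.wra, hx]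

theorem Frame.ite_right {b : BExp} {P Q : Prog} {s s' : State} (h : Frame Q s s') :
    Frame (.ite b P Q) s s' := by
  apply h.mono <;> intro x hx <;> simp [Prog.wn, Prog.wna, Prog.wr, Prog.wra, hx]

theorem Frame.loop {b : BExp} {P : Prog} {s s' : State} (h : Frame P s s') :
    Frame (.while b P) s s' := by
  apply h.mono <;> intro x hx <;> simpa [Prog.wn, Prog.wna, Prog.wr, Prog.wra] using hx

/-! ### Array updates and syntactic frames. -/

theorem upd_of_ne {α : Type} (f : ℕ → ℕ → ℕ → α) {a a' : ℕ} (i j : ℕ) (x : α) (h : a' ≠ a) :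
    upd f a i j x a' = f a' := by
  funext i' j'
  simp [upd, h]

/-- Overwriting a single cell of a two-dimensional array. -/
def upd2 {α : Type} (f : ℕ → ℕ → α) (i j : ℕ) (x : α) : ℕ → ℕ → α :=
  Function.update f i (Function.update (f i) j x)

theorem upd_self {α : Type} (f : ℕ → ℕ → ℕ → α) (a i j : ℕ) (x : α) :
    upd f a i j x a = upd2 (f a) i j x := by
  funext i' j'
  by_cases h : i' = i
  · subst h
    by_cases h' : j' = j
    · subst h'
      simp [upd, upd2]
    · simp [upd, upd2, h']
  · simp [upd, upd2, h]

theorem upd2_self {α : Type} (f : ℕ → ℕ → α) (i j : ℕ) (x : α) :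
    upd2 f i j x i = Function.update (f i) j x := by
  simp [upd2]

theorem upd2_of_ne {α : Type} (f : ℕ → ℕ → α) {i i' : ℕ} (j : ℕ) (x : α) (h : i' ≠ i) :
    upd2 f i j x i' = f i' := by
  simp [upd2, h]

/-- The cells a program may write are read off its text, so for concrete names a frame condition is
a decidable question of list membership. -/
theorem Exec.frame {P : Prog} {s s' : State} {t : ℕ} (h : Exec P s t s') : Frame P s s' := by
  induction h with
  | skip s => exact Frame.refl _ _
  | nset s x e =>
    refine ⟨fun y hy => ?_, fun _ _ => rfl, fun _ _ => rfl, fun _ _ => rfl⟩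
    simp only [Prog.wn, List.mem_singleton] at hy
    simp [hy]
  | nstore s a i j e =>
    refine ⟨fun _ _ => rfl, fun y hy => ?_, fun _ _ => rfl, fun _ _ => rfl⟩
    simp only [Prog.wna, List.mem_singleton] at hy
    exact upd_of_ne _ _ _ _ hy
  | rset s x e =>
    refine ⟨fun _ _ => rfl, fun _ _ => rfl, fun y hy => ?_, fun _ _ => rfl⟩
    simp only [Prog.wr, List.mem_singleton] at hy
    simp [hy]
  | rstore s a i j e =>
    refine ⟨fun _ _ => rfl, fun _ _ => rfl, fun _ _ => rfl, fun y hy => ?_⟩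
    simp only [Prog.wra, List.mem_singleton] at hy
    exact upd_of_ne _ _ _ _ hy
  | seq _ _ ih ih' => exact ih.seq_left.trans ih'.seq_right
  | ite_true _ _ ih => exact ih.ite_left
  | ite_false _ _ ih => exact ih.ite_right
  | while_false _ => exact Frame.refl _ _
  | while_true _ _ _ ih ih' => exact ih.loop.trans ih'

/-- A branch is charged in `time` for both alternatives, which keeps the bound independent of the
memory. -/
theorem Prog.exec_den (P : Prog) (hP : P.loopFree = true) (s : State) :
    ∃ t, Exec P s t (P.den s) ∧ t ≤ P.time := by
  induction P generalizing s with
  | skip => exact ⟨_, .skip s, le_rfl⟩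
  | nset x e => exact ⟨_, .nset s x e, le_rfl⟩
  | nstore a i j e => exact ⟨_, .nstore s a i j e, le_rfl⟩
  | rset x e => exact ⟨_, .rset s x e, le_rfl⟩
  | rstore a i j e => exact ⟨_, .rstore s a i j e, le_rfl⟩
  | seq P Q ih ih' =>
    simp only [Prog.loopFree, Bool.and_eq_true] at hP
    obtain ⟨t, h, ht⟩ := ih hP.1 s
    obtain ⟨t', h', ht'⟩ := ih' hP.2 (P.den s)
    exact ⟨_, .seq h h', by simp only [Prog.time]; omega⟩
  | ite b P Q ih ih' =>
    simp only [Prog.loopFree, Bool.and_eq_true] at hP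
    obtain ⟨t, h, ht⟩ := ih hP.1 s
    obtain ⟨t', h', ht'⟩ := ih' hP.2 s
    by_cases hb : b.holds s
    · refine ⟨1 + b.cost + t, ?_, by simp only [Prog.time]; omega⟩
      simp only [Prog.den, hb, if_true]
      exact .ite_true hb h
    · refine ⟨1 + b.cost + t', ?_, by simp only [Prog.time]; omega⟩
      simp only [Prog.den, hb, if_false]
      exact .ite_false hb h'
  | _ => simp [Prog.loopFree] at hP

/-! ### Rules for consequence, sequencing, branching and loops. -/

namespace Runs

variable {P P' : Prog} {s : State} {B B' : ℕ} {Q Q' : State → Prop}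

theorem mono (h : Runs P s B Q) (hB : B ≤ B') (hQ : ∀ s', Frame P s s' → Q s' → Q' s') :
    Runs P s B' Q' := by
  obtain ⟨t, s', h, ht, hq⟩ := h
  exact ⟨t, s', h, ht.trans hB, hQ s' h.frame hq⟩

theorem of_den (hP : P.loopFree = true) (hB : P.time ≤ B) (hQ : Frame P s (P.den s) → Q (P.den s)) :
    Runs P s B Q := by
  obtain ⟨t, h, ht⟩ := P.exec_den hP s
  exact ⟨t, _, h, ht.trans hB, hQ h.frame⟩

theorem seq (B₁ B₂ : ℕ) (h : Runs P s B₁ Q') (h' : ∀ s', Frame P s s' → Q' s' → Runs P' s' B₂ Q)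
    (hB : B₁ + B₂ ≤ B) : Runs (P ;; P') s B Q := by
  obtain ⟨t, s', h, ht, hq⟩ := h
  obtain ⟨t', s'', h', ht', hq'⟩ := h' s' h.frame hq
  exact ⟨_, _, .seq h h', by omega, hq'⟩

/-- A loop-free program followed by another program. -/
theorem den_seq (B₂ : ℕ) (hP : P.loopFree = true)
    (h' : Frame P s (P.den s) → Runs P' (P.den s) B₂ Q)
    (hB : P.time + B₂ ≤ B) : Runs (P ;; P') s B Q := by
  refine Runs.seq (Q' := fun s' => s' = P.den s) P.time B₂ (of_den hP le_rfl fun _ => rfl) ?_ hB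
  rintro s' hs rfl
  exact h' hs

theorem ite {b : BExp} (B' : ℕ) (h : b.holds s → Runs P s B' Q) (h' : ¬ b.holds s → Runs P' s B' Q)
    (hB : 1 + b.cost + B' ≤ B) : Runs (.ite b P P') s B Q := by
  by_cases hb : b.holds s
  · obtain ⟨t, s', h, ht, hq⟩ := h hb
    exact ⟨_, _, .ite_true hb h, by omega, hq⟩
  · obtain ⟨t, s', h, ht, hq⟩ := h' hb
    exact ⟨_, _, .ite_false hb h, by omega, hq⟩

/-- Loops with an invariant that keeps track of the time spent. -/
theorem while_of_bounded {b : BExp} (I : ℕ → State → Prop) (h0 : I 0 s)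
    (hI : ∀ τ s, I τ s → τ ≤ B)
    (step : ∀ τ s', Frame (.while b P) s s' → I τ s' → b.holds s' →
      ∃ T, Runs P s' T (fun s'' => I (τ + (T + b.cost + 1)) s''))
    (hB : B + b.cost + 1 ≤ B') :
    Runs (.while b P) s B' (fun s' => (∃ τ, I τ s') ∧ ¬ b.holds s') := by
  -- Induction on a bound for the remaining budget `B - τ`. Every iteration raises `τ` by at least
  -- one, because the test is charged, so termination and the time bound come out together.
  have key : ∀ m τ s', Frame (.while b P) s s' → I τ s' → B - τ < m →
      ∃ t s'', Exec (.while b P) s' t s'' ∧ τ + t ≤ B + b.cost + 1 ∧ (∃ τ, I τ s'') ∧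
        ¬ b.holds s'' := by
    intro m
    induction m with
    | zero => intro τ s' _ _ h; omega
    | succ m ih =>
      intro τ s' hf hI' hm
      have hτ := hI _ _ hI'
      by_cases hb : b.holds s'
      · obtain ⟨T, t, s'', hex, ht, hI''⟩ := step τ s' hf hI' hb
        have hτ' := hI _ _ hI''
        obtain ⟨t', s₃, hex', ht', hI₃, hb₃⟩ := ih _ s'' (hf.trans hex.frame.loop) hI'' (by omega)
        exact ⟨_, _, .while_true hb hex hex', by omega, hI₃, hb₃⟩
      · exact ⟨_, _, .while_false hb, by omega, ⟨τ, hI'⟩, hb⟩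
  obtain ⟨t, s'', hex, ht, h⟩ := key _ 0 s (Frame.refl _ _) h0 (Nat.lt_succ_self _)
  exact ⟨t, s'', hex, by omega, h⟩

end Runs

/-- Overwriting an integer register. -/
def State.setN (s : State) (x v : ℕ) : State := { s with nvar := Function.update s.nvar x v }

theorem State.setN_nvar_of_ne (s : State) {x y : ℕ} (v : ℕ) (h : y ≠ x) :
    (s.setN x v).nvar y = s.nvar y := by
  simp [State.setN, h]

theorem State.setN_narr (s : State) (x v : ℕ) : (s.setN x v).narr = s.narr := rfl
theorem State.setN_rarr (s : State) (x v : ℕ) : (s.setN x v).rarr = s.rarr := rfl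
theorem State.setN_rvar (s : State) (x v : ℕ) : (s.setN x v).rvar = s.rvar := rfl

/-- The loop `for x = 0, …, N - 1 do body`. -/
def forTo (x N : ℕ) (body : Prog) : Prog :=
  .nset x (.const 0) ;; .while (.nlt (.var x) (.var N)) (body ;; .nset x (.add (.var x) (.const 1)))

/-- The invariant is required with the counter already advanced, hence `setN`. Of the overhead 8 per
iteration, 4 pays for the test and 4 for the increment; the final 6 pays for the initialization and
the failing last test. -/
theorem Runs.forTo {x N : ℕ} {body : Prog} {s : State} {B : ℕ} (I : ℕ → State → Prop) (m : ℕ)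
    (T : ℕ → ℕ) (hm : s.nvar N = m) (hxN : N ≠ x) (hx : x ∉ body.wn) (hN : N ∉ body.wn)
    (h0 : I 0 (s.setN x 0))
    (step : ∀ i < m, ∀ s', Frame (forTo x N body) s s' → s'.nvar x = i → I i s' →
      Runs body s' (T i) (fun s'' => I (i + 1) (s''.setN x (i + 1))))
    (hB : ∑ i ∈ Finset.range m, (T i + 8) + 6 ≤ B) :
    Runs (forTo x N body) s B (fun s' => I m s') := by
  subst hm
  have hwhile : ∀ s', Frame (.while (.nlt (.var x) (.var N))
      (body ;; .nset x (.add (.var x) (.const 1)))) (s.setN x 0) s' →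
      Frame (CNTCost.forTo x N body) s s' := fun s' h =>
    (Frame.seq_left (Exec.nset s x (.const 0)).frame).trans h.seq_right
  refine Runs.den_seq (∑ i ∈ Finset.range (s.nvar N), (T i + 8) + 4) rfl (fun _ => ?_)
    (by simp only [Prog.time, NExp.cost]; omega)
  refine (Runs.while_of_bounded (B := ∑ i ∈ Finset.range (s.nvar N), (T i + 8))
    (I := fun τ s' => ∃ i ≤ s.nvar N, s'.nvar x = i ∧ I i s' ∧
      τ = ∑ i ∈ Finset.range i, (T i + 8)) ?_ ?_ ?_ ?_).mono le_rfl ?_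
  · exact ⟨0, Nat.zero_le _, by simp [Prog.den, NExp.eval], h0, by simp⟩
  · rintro τ s' ⟨i, hi, -, -, rfl⟩
    exact Finset.sum_le_sum_of_subset (Finset.range_subset_range.2 hi)
  · rintro τ s' hf ⟨i, hi, hxi, hIi, rfl⟩ hb
    have hf' := hwhile s' hf
    have hNs : s'.nvar N = s.nvar N :=
      hf'.nv N (by simp [CNTCost.forTo, Prog.wn, hN, hxN])
    simp only [BExp.holds, NExp.eval, hxi, hNs] at hb
    refine ⟨T i + 4, Runs.seq (T i) 4 (step i hb s' hf' hxi hIi) ?_ le_rfl⟩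
    intro s'' hf'' hI''
    refine Runs.of_den rfl le_rfl fun _ => ?_
    have hx'' : s''.nvar x = i := (hf''.nv x hx).trans hxi
    refine ⟨i + 1, hb, ?_, ?_, ?_⟩
    · simp [Prog.den, NExp.eval, hx'']
    · have : Prog.den (.nset x (.add (.var x) (.const 1))) s'' = s''.setN x (i + 1) := by
        simp [Prog.den, NExp.eval, hx'', State.setN]
      rw [this]
      exact hI''
    · rw [Finset.sum_range_succ]
      simp only [BExp.cost, NExp.cost]
  · simp only [BExp.cost, NExp.cost]
    omega
  · rintro s' hf ⟨⟨τ, i, hi, hxi, hIi, -⟩, hb⟩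
    have hf' := hwhile s' hf
    have hNs : s'.nvar N = s.nvar N :=
      hf'.nv N (by simp [CNTCost.forTo, Prog.wn, hN, hxN])
    simp only [BExp.holds, NExp.eval, hxi, hNs, not_lt] at hb
    rwa [show s.nvar N = i by omega]

/-- Loops whose iterations all have the same time bound. -/
theorem Runs.forTo_const {x N : ℕ} {body : Prog} {s : State} {B : ℕ} (I : ℕ → State → Prop) (m : ℕ)
    (T : ℕ) (hm : s.nvar N = m) (hxN : N ≠ x) (hx : x ∉ body.wn) (hN : N ∉ body.wn)
    (h0 : I 0 (s.setN x 0))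
    (step : ∀ i < m, ∀ s', Frame (CNTCost.forTo x N body) s s' → s'.nvar x = i → I i s' →
      Runs body s' T (fun s'' => I (i + 1) (s''.setN x (i + 1))))
    (hB : m * (T + 8) + 6 ≤ B) :
    Runs (CNTCost.forTo x N body) s B (fun s' => I m s') :=
  Runs.forTo I m (fun _ => T) hm hxN hx hN h0 step (by simpa using hB)

end CNTCost

end

noncomputable section

namespace CNTCost

/-! ## Minimum weight partial matchings -/

/-- Partial matchings between `0, …, a - 1` and `0, …, b - 1`. -/
def IsPartialMatching (a b : ℕ) (N : Finset (ℕ × ℕ)) : Prop :=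
  (∀ p ∈ N, p.1 < a ∧ p.2 < b) ∧ ∀ p ∈ N, ∀ q ∈ N, p.1 = q.1 ↔ p.2 = q.2

/-- `m` is the minimum weight of a partial matching. -/
def IsMinMatching (a b : ℕ) (X : ℕ → ℕ → ℝ) (m : ℝ) : Prop :=
  IsLeast {x : ℝ | ∃ N, IsPartialMatching a b N ∧ x = ∑ p ∈ N, X p.1 p.2} m

/-- Dual variables `u`, `v` certifying the matching `p` of the rows below `i` with those of the
columns up to `b` that belong to `S`. The row matched to the column `j` is `p j`, and `p j = a`
if there is none. -/
structure Certified (X : ℕ → ℕ → ℝ) (a b i : ℕ) (S : ℕ → Prop) (p : ℕ → ℕ) (u v : ℕ → ℝ) :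
    Prop where
  u_nonpos : ∀ r < i, u r ≤ 0
  v_nonpos : ∀ j < b, v j ≤ 0
  lt : ∀ j ≤ b, S j → p j ≠ a → p j < i
  tight : ∀ j < b, S j → p j ≠ a → u (p j) + v j = X (p j) j
  inj : ∀ j ≤ b, ∀ j' ≤ b, S j → S j' → p j ≠ a → p j = p j' → j = j'
  free_row : ∀ r < i, (∀ j ≤ b, S j → p j ≠ r) → u r = 0
  free_col : ∀ j < b, S j → p j = a → v j = 0

theorem sum_le_sum_of_subset_of_nonpos {s t : Finset ℕ} {f : ℕ → ℝ} (hst : s ⊆ t)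
    (hf : ∀ j ∈ t, j ∉ s → f j ≤ 0) : ∑ j ∈ t, f j ≤ ∑ j ∈ s, f j := by
  rw [← Finset.sum_sdiff hst]
  have := Finset.sum_nonpos (s := t \ s) (f := f) fun j hj =>
    hf j (Finset.mem_sdiff.1 hj).1 (Finset.mem_sdiff.1 hj).2
  linarith

/-- Linear programming duality. A partial matching weighs at least the sum of the dual variables of
the rows and columns it covers, and adding the uncovered ones can only decrease this sum as they are
nonpositive. The matching `p` attains equality: its edges are tight and the dual variables of free
rows and columns vanish. -/
theorem Certified.isMinMatching {X : ℕ → ℕ → ℝ} {a b : ℕ} {p : ℕ → ℕ} {u v : ℕ → ℝ}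
    (h : Certified X a b a (fun j => j ≠ b) p u v)
    (feas : ∀ r < a, ∀ j < b, u r + v j ≤ X r j) :
    IsMinMatching a b X (∑ r ∈ Finset.range a, u r + ∑ j ∈ Finset.range b, v j) := by
  classical
  constructor
  · have hinj : Set.InjOn p ((Finset.range b).filter fun j => p j ≠ a : Finset ℕ) := by
      intro j hj j' hj' e
      simp only [Finset.coe_filter, Finset.mem_range, Set.mem_ofPred_eq] at hj hj'
      exact h.inj j hj.1.le j' hj'.1.le hj.1.ne hj'.1.ne hj.2 e
    refine ⟨((Finset.range b).filter fun j => p j ≠ a).image fun j => (p j, j), ⟨?_, ?_⟩, ?_⟩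
    · intro q hq
      simp only [Finset.mem_image, Finset.mem_filter, Finset.mem_range] at hq
      obtain ⟨j, ⟨hj, hp⟩, rfl⟩ := hq
      exact ⟨h.lt j hj.le hj.ne hp, hj⟩
    · intro q hq q' hq'
      simp only [Finset.mem_image, Finset.mem_filter, Finset.mem_range] at hq hq'
      obtain ⟨j, ⟨hj, hp⟩, rfl⟩ := hq
      obtain ⟨j', ⟨hj', hp'⟩, rfl⟩ := hq'
      exact ⟨h.inj j hj.le j' hj'.le hj.ne hj'.ne hp, fun e => by simp only at e; rw [e]⟩
    · rw [Finset.sum_image (by intro x _ y _ e; exact (Prod.ext_iff.1 e).2)]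
      have h1 : ∑ r ∈ Finset.range a, u r =
          ∑ j ∈ (Finset.range b).filter fun j => p j ≠ a, u (p j) := by
        rw [← Finset.sum_image (f := u) hinj]
        symm
        apply Finset.sum_subset
        · intro r hr
          simp only [Finset.mem_image, Finset.mem_filter, Finset.mem_range] at hr ⊢
          obtain ⟨j, ⟨hj, hp⟩, rfl⟩ := hr
          exact h.lt j hj.le hj.ne hp
        · intro r hr hr'
          simp only [Finset.mem_image, Finset.mem_filter, Finset.mem_range, not_exists,
            not_and] at hr hr'
          refine h.free_row r hr fun j hj hjb e => hr' j ⟨by omega, by omega⟩ e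
      have h2 : ∑ j ∈ Finset.range b, v j =
          ∑ j ∈ (Finset.range b).filter fun j => p j ≠ a, v j := by
        symm
        apply Finset.sum_subset (Finset.filter_subset _ _)
        intro j hj hj'
        simp only [Finset.mem_filter, Finset.mem_range, not_and, not_not] at hj hj'
        exact h.free_col j hj hj.ne (hj' hj)
      rw [h1, h2, ← Finset.sum_add_distrib]
      refine Finset.sum_congr rfl fun j hj => ?_
      simp only [Finset.mem_filter, Finset.mem_range] at hj
      exact h.tight j hj.1 hj.1.ne hj.2
  · rintro x ⟨N, ⟨hN, hN'⟩, rfl⟩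
    have h1 : ∑ r ∈ Finset.range a, u r ≤ ∑ q ∈ N, u q.1 := by
      rw [← Finset.sum_image (f := u) (g := Prod.fst) (s := N)]
      · refine sum_le_sum_of_subset_of_nonpos ?_ fun r hr _ =>
          h.u_nonpos r (Finset.mem_range.1 hr)
        intro r hr
        obtain ⟨q, hq, rfl⟩ := Finset.mem_image.1 hr
        exact Finset.mem_range.2 (hN q hq).1
      · intro q hq q' hq' e
        exact Prod.ext e ((hN' q hq q' hq').1 e)
    have h2 : ∑ r ∈ Finset.range b, v r ≤ ∑ q ∈ N, v q.2 := by
      rw [← Finset.sum_image (f := v) (g := Prod.snd) (s := N)]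
      · refine sum_le_sum_of_subset_of_nonpos ?_ fun r hr _ =>
          h.v_nonpos r (Finset.mem_range.1 hr)
        intro r hr
        obtain ⟨q, hq, rfl⟩ := Finset.mem_image.1 hr
        exact Finset.mem_range.2 (hN q hq).2
      · intro q hq q' hq' e
        exact Prod.ext ((hN' q hq q' hq').2 e) e
    refine (add_le_add h1 h2).trans ?_
    rw [← Finset.sum_add_distrib]
    exact Finset.sum_le_sum fun q hq => feas _ (hN q hq).1 _ (hN q hq).2

/-! ### The search for an augmenting path and the augmentation. -/

/-- Number of used columns. -/
def usedCard (b : ℕ) (used : ℕ → ℕ) : ℕ := ((Finset.range b).filter fun j => used j = 1).card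

theorem usedCard_le (b : ℕ) (used : ℕ → ℕ) : usedCard b used ≤ b := by
  unfold usedCard
  exact (Finset.card_le_card (Finset.filter_subset _ _)).trans (by simp)

theorem usedCard_update {b : ℕ} {used : ℕ → ℕ} {j : ℕ} (hj : j < b) (hu : used j ≠ 1) :
    usedCard b (Function.update used j 1) = usedCard b used + 1 := by
  classical
  unfold usedCard
  rw [← Finset.card_insert_of_notMem (a := j) (by simp [hu])]
  congr 1
  ext j'
  by_cases h : j' = j
  · subst h; simp [hj]
  · simp [h]

/-- The search for an augmenting path starting at the row `i`, which is matched to the virtual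
column `b`. The columns `j` with `used j = 1` and the rows matched to them form the search tree,
`minv j` is the least slack of an edge between a row of the tree and the column `j`, and `way j` is
the column matched to a row where it is attained. -/
structure Search (X : ℕ → ℕ → ℝ) (a b i : ℕ) (p : ℕ → ℕ) (u v : ℕ → ℝ) (used way : ℕ → ℕ)
    (minv : ℕ → ℝ) (rk : ℕ → ℕ) : Prop where
  cert : Certified X a b (i + 1) (fun _ => True) p u v
  feas : ∀ r < i, ∀ j < b, u r + v j ≤ X r j
  feas_row : ∀ j < b, used j = 1 → u i + v j ≤ X i j
  row_lt : i < a
  virtual : p b = i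
  used_virtual : used b = 1
  matched : ∀ j ≤ b, used j = 1 → p j ≠ a
  minv_le : ∀ j < b, used j ≠ 1 → ∀ j' ≤ b, used j' = 1 → minv j ≤ X (p j') j - u (p j') - v j
  minv_way : ∀ j < b, used j ≠ 1 → way j ≤ b ∧ used (way j) = 1 ∧
    minv j = X (p (way j)) j - u (p (way j)) - v j
  path : ∀ j < b, used j = 1 → way j ≤ b ∧ used (way j) = 1 ∧ rk (way j) < rk j ∧
    u (p (way j)) + v j = X (p (way j)) j
  rk_le : ∀ j ≤ b, used j = 1 → rk j ≤ usedCard b used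
  sign : (∀ j < b, used j ≠ 1) ∨ ∀ j < b, used j ≠ 1 → 0 ≤ minv j

open scoped Classical in
-- The change `δ` is the largest one compatible with both kinds of constraints: `minv` bounds it by
-- the slack of edges leaving the tree, and `-u` keeps the dual variables of tree rows nonpositive.
-- At the minimizing column either a tree row reaches the value zero, so that it may be left free,
-- or an edge leaving the tree becomes tight.
theorem Search.update {X : ℕ → ℕ → ℝ} {a b i : ℕ} {p : ℕ → ℕ} {u v : ℕ → ℝ} {used way : ℕ → ℕ}
    {minv : ℕ → ℝ} {rk : ℕ → ℕ} (h : Search X a b i p u v used way minv rk) {δ : ℝ}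
    {u' v' minv' : ℕ → ℝ} {j₁ : ℕ} (hj₁ : j₁ ≤ b)
    (hδ : δ = if used j₁ = 1 then - u (p j₁) else minv j₁)
    (hle : ∀ j ≤ b, δ ≤ if used j = 1 then - u (p j) else minv j)
    (hu : ∀ r, u' r = if ∃ j ≤ b, used j = 1 ∧ p j = r then u r + δ else u r)
    (hv : ∀ j < b, v' j = if used j = 1 then v j - δ else v j)
    (hm : ∀ j < b, used j ≠ 1 → minv' j = minv j - δ) :
    Search X a b i p u' v' used way minv' rk ∧ (∀ j < b, used j ≠ 1 → 0 ≤ minv' j) ∧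
      (used j₁ = 1 → u' (p j₁) = 0) ∧ (used j₁ ≠ 1 → minv' j₁ = 0) := by
  have hne : ∀ {j}, j ≤ b → used j ≠ 1 → j < b := fun {j} hj hj' =>
    lt_of_le_of_ne hj fun e => hj' (e ▸ h.used_virtual)
  -- Only the first change can be negative, because the new row starts with a value that need not be
  -- feasible. At that moment the tree contains no real column, so no `v j` is raised. Afterwards
  -- `sign` makes all slacks nonnegative.
  have hpos : ∀ j < b, used j = 1 → 0 ≤ δ := by
    intro j hj hju
    have hs := h.sign.resolve_left fun h' => h' j hj hju
    rw [hδ]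
    split_ifs with hu1
    · have := h.cert.u_nonpos _ (h.cert.lt j₁ hj₁ trivial (h.matched j₁ hj₁ hu1))
      linarith
    · exact hs j₁ (hne hj₁ hu1) hu1
  have hut : ∀ j ≤ b, used j = 1 → u' (p j) = u (p j) + δ := fun j hj hju => by
    rw [hu, if_pos ⟨j, hj, hju, rfl⟩]
  have hui : u' i = u i + δ := by
    have := hut b le_rfl h.used_virtual
    rwa [h.virtual] at this
  have hm0 : ∀ j < b, used j ≠ 1 → 0 ≤ minv' j := by
    intro j hj hju
    have := hle j hj.le
    rw [if_neg hju] at this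
    rw [hm j hj hju]
    linarith
  refine ⟨⟨⟨?_, ?_, h.cert.lt, ?_, h.cert.inj, ?_, ?_⟩, ?_, ?_, h.row_lt, h.virtual, h.used_virtual,
    h.matched, ?_, ?_, ?_, h.rk_le, Or.inr hm0⟩, hm0, ?_, ?_⟩
  · intro r hr
    rw [hu]
    split_ifs with hex
    · obtain ⟨j, hj, hju, rfl⟩ := hex
      have := hle j hj
      rw [if_pos hju] at this
      linarith
    · exact h.cert.u_nonpos r hr
  · intro j hj
    rw [hv j hj]
    split_ifs with hju
    · have := hpos j hj hju
      have := h.cert.v_nonpos j hj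
      linarith
    · exact h.cert.v_nonpos j hj
  · intro j hj _ hp
    have ht := h.cert.tight j hj trivial hp
    by_cases hju : used j = 1
    · rw [hut j hj.le hju, hv j hj, if_pos hju]
      linarith
    · rw [hv j hj, if_neg hju, hu, if_neg]
      · exact ht
      · rintro ⟨j', hj', hju', e⟩
        have := h.cert.inj j hj.le j' hj' trivial trivial hp e.symm
        exact hju (this ▸ hju')
  · intro r hr hfree
    rw [hu, if_neg]
    · exact h.cert.free_row r hr hfree
    · rintro ⟨j, hj, -, e⟩
      exact hfree j hj trivial e
  · intro j hj _ hp
    have hju : used j ≠ 1 := fun hju => h.matched j hj.le hju hp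
    rw [hv j hj, if_neg hju]
    exact h.cert.free_col j hj trivial hp
  · intro r hr j hj
    have hf := h.feas r hr j hj
    rw [hu, hv j hj]
    split_ifs with hex hju hju
    · linarith
    · obtain ⟨j', hj', hju', rfl⟩ := hex
      have h1 := hle j hj.le
      rw [if_neg hju] at h1
      have h2 := h.minv_le j hj hju j' hj' hju'
      linarith
    · have := hpos j hj hju
      linarith
    · exact hf
  · intro j hj hju
    have := h.feas_row j hj hju
    rw [hui, hv j hj, if_pos hju]
    linarith
  · intro j hj hju j' hj' hju'
    have := h.minv_le j hj hju j' hj' hju'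
    rw [hm j hj hju, hut j' hj' hju', hv j hj, if_neg hju]
    linarith
  · intro j hj hju
    obtain ⟨h1, h2, h3⟩ := h.minv_way j hj hju
    refine ⟨h1, h2, ?_⟩
    rw [hm j hj hju, hut _ h1 h2, hv j hj, if_neg hju, h3]
    ring
  · intro j hj hju
    obtain ⟨h1, h2, h3, h4⟩ := h.path j hj hju
    refine ⟨h1, h2, h3, ?_⟩
    rw [hut _ h1 h2, hv j hj, if_pos hju]
    linarith
  · intro hju
    rw [hut j₁ hj₁ hju, hδ, if_pos hju]
    ring
  · intro hju
    rw [hm j₁ (hne hj₁ hju) hju, hδ, if_neg hju]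
    ring

/-- A matched column reached by a tight edge joins the tree together with its row. Its rank exceeds
all earlier ranks, so `way` strictly decreases the rank along the tree. The slacks remain
nonnegative because the row that joins was already feasible. -/
theorem Search.mark {X : ℕ → ℕ → ℝ} {a b i : ℕ} {p : ℕ → ℕ} {u v : ℕ → ℝ} {used way : ℕ → ℕ}
    {minv : ℕ → ℝ} {rk : ℕ → ℕ} (h : Search X a b i p u v used way minv rk)
    (hpos : ∀ j < b, used j ≠ 1 → 0 ≤ minv j) {j₁ : ℕ} (hj₁ : j₁ ≤ b) (hu : used j₁ ≠ 1)
    (hp : p j₁ ≠ a) (hm0 : minv j₁ = 0) {way' : ℕ → ℕ} {minv' : ℕ → ℝ}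
    (hw : ∀ j < b, way' j = if Function.update used j₁ 1 j ≠ 1 ∧
      X (p j₁) j - u (p j₁) - v j < minv j then j₁ else way j)
    (hm : ∀ j < b, minv' j = if Function.update used j₁ 1 j ≠ 1 ∧
      X (p j₁) j - u (p j₁) - v j < minv j then X (p j₁) j - u (p j₁) - v j else minv j) :
    Search X a b i p u v (Function.update used j₁ 1) way' minv'
      (Function.update rk j₁ (usedCard b used + 1)) := by
  have hj₁b : j₁ < b := lt_of_le_of_ne hj₁ fun e => hu (e ▸ h.used_virtual)
  -- The row `i` sits in the virtual column, so by injectivity the row of `j₁` is an earlier one, to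
  -- which `feas` applies.
  have hp₁ : p j₁ < i := by
    have h1 := h.cert.lt j₁ hj₁ trivial hp
    have h2 : p j₁ ≠ i := fun e =>
      hj₁b.ne (h.cert.inj j₁ hj₁ b le_rfl trivial trivial hp (e.trans h.virtual.symm))
    omega
  have hold : ∀ j, used j = 1 → Function.update used j₁ 1 j = 1 := by
    intro j hj
    by_cases e : j = j₁
    · subst e; simp
    · simp [e, hj]
  have hnew : ∀ j, Function.update used j₁ 1 j ≠ 1 → used j ≠ 1 := fun j hj hj' => hj (hold j hj')
  have hcase : ∀ j, Function.update used j₁ 1 j = 1 → j = j₁ ∨ used j = 1 := by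
    intro j hj
    by_cases e : j = j₁
    · exact Or.inl e
    · right
      simpa [e] using hj
  have hneq : ∀ j, used j = 1 → j ≠ j₁ := fun j hj e => hu (e ▸ hj)
  have hmin : ∀ j < b, Function.update used j₁ 1 j ≠ 1 →
      minv' j ≤ minv j ∧ minv' j ≤ X (p j₁) j - u (p j₁) - v j := by
    intro j hj hju
    rw [hm j hj]
    split_ifs with hlt
    · exact ⟨hlt.2.le, le_rfl⟩
    · exact ⟨le_rfl, not_lt.1 fun h' => hlt ⟨hju, h'⟩⟩
  refine ⟨h.cert, h.feas, ?_, h.row_lt, h.virtual, hold b h.used_virtual, ?_, ?_, ?_, ?_, ?_, ?_⟩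
  · intro j hj hju
    rcases hcase j hju with rfl | hju
    · have := h.minv_le j hj hu b le_rfl h.used_virtual
      rw [h.virtual, hm0] at this
      linarith
    · exact h.feas_row j hj hju
  · intro j hj hju
    rcases hcase j hju with rfl | hju
    · exact hp
    · exact h.matched j hj hju
  · intro j hj hju j' hj' hju'
    rcases hcase j' hju' with rfl | hju'
    · exact (hmin j hj hju).2
    · exact (hmin j hj hju).1.trans (h.minv_le j hj (hnew j hju) j' hj' hju')
  · intro j hj hju
    rw [hw j hj, hm j hj]
    split_ifs with hlt
    · exact ⟨hj₁, by simp, rfl⟩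
    · obtain ⟨h1, h2, h3⟩ := h.minv_way j hj (hnew j hju)
      exact ⟨h1, hold _ h2, h3⟩
  · intro j hj hju
    rw [hw j hj, if_neg fun h' => h'.1 hju]
    rcases hcase j hju with rfl | hju'
    · obtain ⟨h1, h2, h3⟩ := h.minv_way j hj hu
      refine ⟨h1, hold _ h2, ?_, ?_⟩
      · rw [Function.update_of_ne (hneq _ h2), Function.update_self]
        exact Nat.lt_succ_of_le (h.rk_le _ h1 h2)
      · rw [hm0] at h3
        linarith
    · obtain ⟨h1, h2, h3, h4⟩ := h.path j hj hju'
      refine ⟨h1, hold _ h2, ?_, h4⟩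
      rwa [Function.update_of_ne (hneq _ h2), Function.update_of_ne (hneq _ hju')]
  · intro j hj hju
    rw [usedCard_update hj₁b hu]
    rcases hcase j hju with rfl | hju'
    · simp
    · rw [Function.update_of_ne (hneq _ hju')]
      exact (h.rk_le j hj hju').trans (Nat.le_succ _)
  · right
    intro j hj hju
    rw [hm j hj]
    split_ifs with hlt
    · have := h.feas _ hp₁ j hj
      linarith
    · exact hpos j hj (hnew j hju)

/-- The augmentation along a path of the search tree, where the row that had been matched to the
column `hole` has been matched elsewhere, or released. -/
structure Augmenting (X : ℕ → ℕ → ℝ) (a b i : ℕ) (p : ℕ → ℕ) (u v : ℕ → ℝ) (used way : ℕ → ℕ)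
    (rk : ℕ → ℕ) (hole : ℕ) : Prop where
  cert : Certified X a b i (fun j => j ≠ hole) p u v
  feas : ∀ r < i, ∀ j < b, u r + v j ≤ X r j
  hole_le : hole ≤ b
  matched : ∀ j ≤ b, used j = 1 → j ≠ hole → p j ≠ a
  path : ∀ j < b, used j = 1 ∨ j = hole → rk j ≤ rk hole → way j ≤ b ∧ used (way j) = 1 ∧
    rk (way j) < rk j ∧ u (p (way j)) + v j = X (p (way j)) j

/-- The search ends in one of two ways: a tree row with dual value zero is released, or a free
column is reached by a tight edge. Both leave a hole at `j₁`. A free column is not in the tree and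
needs a new rank, which is why `rk` may change; the bound `b + 1` limits the number of augmentation
steps. -/
theorem Search.augmenting {X : ℕ → ℕ → ℝ} {a b i : ℕ} {p : ℕ → ℕ} {u v : ℕ → ℝ}
    {used way : ℕ → ℕ} {minv : ℕ → ℝ} {rk : ℕ → ℕ} (h : Search X a b i p u v used way minv rk)
    (hpos : ∀ j < b, used j ≠ 1 → 0 ≤ minv j) {j₁ : ℕ} (hj₁ : j₁ ≤ b)
    (hu : used j₁ = 1 → u (p j₁) = 0) (hm : used j₁ ≠ 1 → p j₁ = a ∧ minv j₁ = 0) :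
    ∃ rk', rk' j₁ ≤ b + 1 ∧ Augmenting X a b (i + 1) p u v used way rk' j₁ := by
  have hfeas : ∀ r < i + 1, ∀ j < b, u r + v j ≤ X r j := by
    intro r hr j hj
    rcases Nat.lt_succ_iff_lt_or_eq.1 hr with hr | rfl
    · exact h.feas r hr j hj
    · by_cases hju : used j = 1
      · exact h.feas_row j hj hju
      · have h1 := h.minv_le j hj hju b le_rfl h.used_virtual
        have h2 := hpos j hj hju
        rw [h.virtual] at h1
        linarith
  have hcert : Certified X a b (i + 1) (fun j => j ≠ j₁) p u v := by
    refine ⟨h.cert.u_nonpos, h.cert.v_nonpos, fun j hj _ => h.cert.lt j hj trivial,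
      fun j hj _ => h.cert.tight j hj trivial,
      fun j hj j' hj' _ _ => h.cert.inj j hj j' hj' trivial trivial, ?_,
      fun j hj _ => h.cert.free_col j hj trivial⟩
    intro r hr hfree
    by_cases hr' : p j₁ = r
    · subst hr'
      by_cases hju : used j₁ = 1
      · exact hu hju
      · have := (hm hju).1
        have := h.row_lt
        omega
    · refine h.cert.free_row r hr fun j hj _ e => ?_
      by_cases hjj : j = j₁
      · exact hr' (hjj ▸ e)
      · exact hfree j hj hjj e
  by_cases hju : used j₁ = 1
  · refine ⟨rk, ?_, hcert, hfeas, hj₁, fun j hj hj' _ => h.matched j hj hj', ?_⟩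
    · exact ((h.rk_le j₁ hj₁ hju).trans (usedCard_le _ _)).trans (Nat.le_succ _)
    · rintro j hj hju' -
      refine h.path j hj ?_
      rcases hju' with h' | rfl
      · exact h'
      · exact hju
  · obtain ⟨hpa, hm0⟩ := hm hju
    have hne : ∀ j, used j = 1 → j ≠ j₁ := fun j hj e => hju (e ▸ hj)
    refine ⟨Function.update rk j₁ (usedCard b used + 1), ?_, hcert, hfeas, hj₁,
      fun j hj hj' _ => h.matched j hj hj', ?_⟩
    · simpa using usedCard_le _ _
    · intro j hj hju' _
      by_cases e : j = j₁
      · subst e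
        obtain ⟨h1, h2, h3⟩ := h.minv_way j hj hju
        refine ⟨h1, h2, ?_, by linarith⟩
        rw [Function.update_of_ne (hne _ h2), Function.update_self]
        exact Nat.lt_succ_of_le (h.rk_le _ h1 h2)
      · obtain ⟨h1, h2, h3, h4⟩ := h.path j hj (hju'.resolve_right e)
        refine ⟨h1, h2, ?_, h4⟩
        rwa [Function.update_of_ne (hne _ h2), Function.update_of_ne e]

/-- The row matched to `way hole` moves along its tight edge to `hole`, which moves the hole closer
to the root of the tree. Entries of `p` at ranks above the hole have been overwritten, and therefore
`path` is only claimed for ranks up to that of the hole. -/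
theorem Augmenting.step {X : ℕ → ℕ → ℝ} {a b i : ℕ} {p : ℕ → ℕ} {u v : ℕ → ℝ}
    {used way : ℕ → ℕ} {rk : ℕ → ℕ} {hole : ℕ} (h : Augmenting X a b i p u v used way rk hole)
    (hb : hole ≠ b) :
    Augmenting X a b i (Function.update p hole (p (way hole))) u v used way rk (way hole) ∧
      rk (way hole) < rk hole := by
  have hlt : hole < b := lt_of_le_of_ne h.hole_le hb
  obtain ⟨hw, hwu, hrk, ht⟩ := h.path hole hlt (Or.inr rfl) le_rfl
  have hne : way hole ≠ hole := fun e => by rw [e] at hrk; exact lt_irrefl _ hrk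
  have hpw : p (way hole) ≠ a := h.matched _ hw hwu hne
  refine ⟨⟨⟨h.cert.u_nonpos, h.cert.v_nonpos, ?_, ?_, ?_, ?_, ?_⟩, h.feas, hw, ?_, ?_⟩, hrk⟩
  · intro j hj hjw hp
    by_cases e : j = hole
    · subst e
      rw [Function.update_self] at hp ⊢
      exact h.cert.lt _ hw hne hp
    · rw [Function.update_of_ne e] at hp ⊢
      exact h.cert.lt j hj e hp
  · intro j hj hjw hp
    by_cases e : j = hole
    · subst e
      rwa [Function.update_self]
    · rw [Function.update_of_ne e] at hp ⊢
      exact h.cert.tight j hj e hp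
  · intro j hj j' hj' hjw hjw' hp e
    by_cases e1 : j = hole <;> by_cases e2 : j' = hole
    · rw [e1, e2]
    · subst e1
      rw [Function.update_self, Function.update_of_ne e2] at e
      exact absurd (h.cert.inj _ hw j' hj' hne e2 hpw e).symm hjw'
    · subst e2
      rw [Function.update_self, Function.update_of_ne e1] at e
      exact absurd (h.cert.inj _ hw j hj hne e1 hpw e.symm).symm hjw
    · rw [Function.update_of_ne e1] at hp e
      rw [Function.update_of_ne e2] at e
      exact h.cert.inj j hj j' hj' e1 e2 hp e
  · intro r hr hfree
    refine h.cert.free_row r hr fun j hj hj' e => ?_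
    by_cases e1 : j = way hole
    · subst e1
      refine hfree hole h.hole_le hne.symm ?_
      rwa [Function.update_self]
    · refine hfree j hj e1 ?_
      rwa [Function.update_of_ne hj']
  · intro j hj hjw hp
    by_cases e : j = hole
    · subst e
      rw [Function.update_self] at hp
      exact absurd hp hpw
    · rw [Function.update_of_ne e] at hp
      exact h.cert.free_col j hj e hp
  · intro j hj hju hjw
    by_cases e : j = hole
    · subst e
      rwa [Function.update_self]
    · rw [Function.update_of_ne e]
      exact h.matched j hj hju e
  · intro j hj hju hrj
    have hju' : used j = 1 := by
      rcases hju with h' | rfl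
      · exact h'
      · exact hwu
    obtain ⟨h1, h2, h3, h4⟩ := h.path j hj (Or.inl hju') (by omega)
    refine ⟨h1, h2, h3, ?_⟩
    have : way j ≠ hole := fun e => by rw [e] at h3; omega
    rwa [Function.update_of_ne this]

/-- The new row is placed in the virtual column with dual value 0. Feasibility of this row is not
required yet, and its slacks may be negative; this is the first alternative of `sign`. -/
theorem Certified.search {X : ℕ → ℕ → ℝ} {a b i : ℕ} {p : ℕ → ℕ} {u v : ℕ → ℝ}
    (h : Certified X a b i (fun j => j ≠ b) p u v) (feas : ∀ r < i, ∀ j < b, u r + v j ≤ X r j)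
    (hi : i < a) {used way : ℕ → ℕ} {minv : ℕ → ℝ} (hub : used b = 1)
    (hu : ∀ j < b, used j ≠ 1) (hw : ∀ j < b, way j = b) (hm : ∀ j < b, minv j = X i j - v j) :
    Search X a b i (Function.update p b i) (Function.update u i 0) v used way minv
      (fun _ => 0) := by
  have hlt : ∀ j ≤ b, j ≠ b → j < b := fun j hj hj' => lt_of_le_of_ne hj hj'
  refine ⟨⟨?_, h.v_nonpos, ?_, ?_, ?_, ?_, ?_⟩, ?_, fun j hj hju => absurd hju (hu j hj), hi,
    by simp, hub, ?_, ?_, ?_, fun j hj hju => absurd hju (hu j hj), fun _ _ _ => Nat.zero_le _,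
    Or.inl hu⟩
  · intro r hr
    by_cases e : r = i
    · simp [e]
    · rw [Function.update_of_ne e]
      exact h.u_nonpos r (by omega)
  · intro j hj _ hp
    by_cases e : j = b
    · simp [e]
    · rw [Function.update_of_ne e] at hp ⊢
      exact (h.lt j hj e hp).trans (Nat.lt_succ_self _)
  · intro j hj _ hp
    rw [Function.update_of_ne hj.ne] at hp ⊢
    rw [Function.update_of_ne (h.lt j hj.le hj.ne hp).ne]
    exact h.tight j hj hj.ne hp
  · intro j hj j' hj' _ _ hp e
    by_cases e1 : j = b <;> by_cases e2 : j' = b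
    · rw [e1, e2]
    · rw [e1, Function.update_self, Function.update_of_ne e2] at e
      have := h.lt j' hj' e2 (by omega)
      omega
    · rw [e2, Function.update_self, Function.update_of_ne e1] at e
      have := h.lt j hj e1 (by omega)
      omega
    · rw [Function.update_of_ne e1] at hp e
      rw [Function.update_of_ne e2] at e
      exact h.inj j hj j' hj' e1 e2 hp e
  · intro r hr hfree
    by_cases e : r = i
    · simp [e]
    · rw [Function.update_of_ne e]
      refine h.free_row r (by omega) fun j hj hjb => ?_
      have := hfree j hj trivial
      rwa [Function.update_of_ne hjb] at this
  · intro j hj _ hp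
    rw [Function.update_of_ne hj.ne] at hp
    exact h.free_col j hj hj.ne hp
  · intro r hr j hj
    rw [Function.update_of_ne hr.ne]
    exact feas r hr j hj
  · intro j hj hju
    have e : j = b := by
      by_contra hjb
      exact hu j (hlt j hj hjb) hju
    rw [e, Function.update_self]
    exact hi.ne
  · intro j hj _ j' hj' hju'
    have e : j' = b := by
      by_contra hjb
      exact hu j' (hlt j' hj' hjb) hju'
    rw [e, Function.update_self, Function.update_self, hm j hj]
    simp
  · intro j hj _
    rw [hw j hj]
    refine ⟨le_rfl, hub, ?_⟩
    rw [Function.update_self, Function.update_self, hm j hj]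
    simp

end CNTCost

end

noncomputable section

namespace CNTCost

/-! ## The Hungarian method as a program

Integer registers: `11` number of rows, `12` number of columns, `13` current row, `15` loop
variable, `16` current column, `17` end of the search, `18` number of columns plus one.
Integer arrays: `11` the matching `p`, `12` `way`, `13` `used`.
Real registers: `1` `δ`, `2` auxiliary, `3` the result.
Real arrays: `11` weights, `12` and `13` the dual variables `u` and `v`, `15` `minv`. -/

/-- Initialization. -/
def hungInit : Prog := forTo 15 12 (.nstore 11 (.const 0) (.var 15) (.var 11) ;;
  .rstore 13 (.const 0) (.var 15) .zero)

/-- Initialization of the search. -/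
def hungStart : Prog := forTo 15 12 (.nstore 12 (.const 0) (.var 15) (.var 12) ;;
  .nstore 13 (.const 0) (.var 15) (.const 0) ;;
  .rstore 15 (.const 0) (.var 15)
    (.sub (.arr 11 (.var 13) (.var 15)) (.arr 13 (.const 0) (.var 15))))

/-- The least slack and a column where it is attained. -/
def hungFind : Prog := forTo 15 12
  (.ite (.neq (.arr 13 (.const 0) (.var 15)) (.const 1))
    (.rset 2 (.sub .zero (.arr 12 (.const 0) (.arr 11 (.const 0) (.var 15)))))
    (.rset 2 (.arr 15 (.const 0) (.var 15))) ;;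
  .ite (.rlt (.var 2) (.var 1)) (.rset 1 (.var 2) ;; .nset 16 (.var 15)) .skip)

/-- The change of the dual variables. -/
def hungUpdate : Prog := forTo 15 18
  (.ite (.neq (.arr 13 (.const 0) (.var 15)) (.const 1))
    (.rstore 12 (.const 0) (.arr 11 (.const 0) (.var 15))
      (.add (.arr 12 (.const 0) (.arr 11 (.const 0) (.var 15))) (.var 1)) ;;
     .rstore 13 (.const 0) (.var 15) (.sub (.arr 13 (.const 0) (.var 15)) (.var 1)))
    (.rstore 15 (.const 0) (.var 15) (.sub (.arr 15 (.const 0) (.var 15)) (.var 1))))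

/-- The slack of the edge between the row matched to the column in register `16` and the column in
register `15`. -/
def slackExp : RExp := .sub (.sub (.arr 11 (.arr 11 (.const 0) (.var 16)) (.var 15))
  (.arr 12 (.const 0) (.arr 11 (.const 0) (.var 16)))) (.arr 13 (.const 0) (.var 15))

/-- Extension of the search tree. -/
def hungRelax : Prog := forTo 15 12
  (.ite (.and (.not (.neq (.arr 13 (.const 0) (.var 15)) (.const 1)))
      (.rlt slackExp (.arr 15 (.const 0) (.var 15))))
    (.nstore 12 (.const 0) (.var 15) (.var 16) ;;
      .rstore 15 (.const 0) (.var 15) slackExp)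
    .skip)

/-! ### Effects and running times of the loops of the Hungarian method. -/

theorem hungInit_runs (s : State) {b : ℕ} (hb : s.nvar 12 = b) :
    Runs hungInit s (b * 20 + 10) fun s' =>
      (∀ j < b, s'.narr 11 0 j = s.nvar 11) ∧ ∀ j < b, s'.rarr 13 0 j = 0 := by
  refine Runs.forTo_const (fun i s' => (∀ j < i, s'.narr 11 0 j = s.nvar 11) ∧
    ∀ j < i, s'.rarr 13 0 j = 0) b 12 hb (by decide) (by decide) (by decide) (by simp) ?_ (by omega)
  intro i hi s' hf hx hI
  have h11 := hf.nv 11 (by decide)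
  refine Runs.of_den rfl (by decide) fun _ => ?_
  simp only [Prog.den, NExp.eval, RExp.eval, State.setN_narr, State.setN_rarr, upd_self, upd2_self,
    hx, h11]
  refine ⟨fun j hj => ?_, fun j hj => ?_⟩ <;> by_cases e : j = i
  · simp [e]
  · rw [Function.update_of_ne e]; exact hI.1 j (by omega)
  · simp [e]
  · rw [Function.update_of_ne e]; exact hI.2 j (by omega)

theorem hungStart_runs (s : State) {b : ℕ} (hb : s.nvar 12 = b) :
    Runs hungStart s (b * 40 + 10) fun s' =>
      (∀ j < b, s'.narr 12 0 j = b) ∧ (∀ j < b, s'.narr 13 0 j = 0) ∧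
      ∀ j < b, s'.rarr 15 0 j = s.rarr 11 (s.nvar 13) j - s.rarr 13 0 j := by
  refine Runs.forTo_const (fun i s' => (∀ j < i, s'.narr 12 0 j = b) ∧
    (∀ j < i, s'.narr 13 0 j = 0) ∧
    ∀ j < i, s'.rarr 15 0 j = s.rarr 11 (s.nvar 13) j - s.rarr 13 0 j) b 30 hb (by decide)
    (by decide) (by decide) (by simp) ?_ (by omega)
  intro i hi s' hf hx hI
  have h12 := hf.nv 12 (by decide)
  have h13 := hf.nv 13 (by decide)
  have ha11 := hf.ra 11 (by decide)
  have ha13 := hf.ra 13 (by decide)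
  refine Runs.of_den rfl (by decide) fun _ => ?_
  simp only [Prog.den, NExp.eval, RExp.eval, State.setN_narr, State.setN_rarr, upd_self, upd2_self,
    hx, h12, h13, hb, ha11, ha13, upd_of_ne, ne_eq, Nat.reduceEqDiff, not_false_eq_true]
  refine ⟨fun j hj => ?_, fun j hj => ?_, fun j hj => ?_⟩ <;> by_cases e : j = i
  · simp [e]
  · rw [Function.update_of_ne e]; exact hI.1 j (by omega)
  · simp [e]
  · rw [Function.update_of_ne e]; exact hI.2.1 j (by omega)
  · simp [e]
  · rw [Function.update_of_ne e]; exact hI.2.2 j (by omega)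

open scoped Classical in
/-- The amount by which the dual variables can be changed before the column `j` or the row matched
to it stops the search or joins the tree. -/
def slackAt (s : State) (j : ℕ) : ℝ :=
  if s.narr 13 0 j = 1 then - s.rarr 12 0 (s.narr 11 0 j) else s.rarr 15 0 j

/-- The virtual column is the initial candidate, so the loop only has to inspect the real ones. -/
theorem hungFind_runs (s : State) {b : ℕ} (hb : s.nvar 12 = b) (h16 : s.nvar 16 = b)
    (h1 : s.rvar 1 = slackAt s b) :
    Runs hungFind s (b * 40 + 10) fun s' =>
      s'.nvar 16 ≤ b ∧ s'.rvar 1 = slackAt s (s'.nvar 16) ∧ ∀ j ≤ b, s'.rvar 1 ≤ slackAt s j := by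
  refine (Runs.forTo_const (fun i s' => s'.nvar 16 ≤ b ∧ s'.rvar 1 = slackAt s (s'.nvar 16) ∧
    s'.rvar 1 ≤ slackAt s b ∧ ∀ j < i, s'.rvar 1 ≤ slackAt s j) b 30 hb (by decide)
    (by decide) (by decide) ?_ ?_ (by omega)).mono le_rfl ?_
  · simp [State.setN, h16, h1]
  · intro i hi s' hf hx hI
    have hn11 := hf.na 11 (by decide)
    have hn13 := hf.na 13 (by decide)
    have hr12 := hf.ra 12 (by decide)
    have hr15 := hf.ra 15 (by decide)
    refine Runs.seq (Q' := fun s'' => s''.rvar 2 = slackAt s i ∧ s''.nvar = s'.nvar ∧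
      s''.rvar 1 = s'.rvar 1) 20 10 (Runs.of_den rfl (by decide) fun _ => ?_) ?_ le_rfl
    · simp only [Prog.den, BExp.holds, NExp.eval, RExp.eval, hx, hn11, hn13, hr12, hr15, slackAt]
      split_ifs <;> simp
    · rintro s'' - ⟨h2, hn, hr1⟩
      refine Runs.ite 5 (fun h => Runs.of_den rfl (by decide) fun _ => ?_)
        (fun h => Runs.of_den rfl (by decide) fun _ => ?_) (by decide)
      · simp only [BExp.holds, RExp.eval, h2, hr1] at h
        simp only [Prog.den, RExp.eval, NExp.eval, State.setN, hn, hx, h2, Function.update_self, ne_eq,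
          Nat.reduceEqDiff, not_false_eq_true, Function.update_of_ne, true_and]
        refine ⟨hi.le, h.le.trans hI.2.2.1, fun j hj => ?_⟩
        rcases Nat.lt_succ_iff_lt_or_eq.1 hj with hj | rfl
        · exact h.le.trans (hI.2.2.2 j hj)
        · exact le_rfl
      · simp only [BExp.holds, RExp.eval, h2, hr1, not_lt] at h
        simp only [Prog.den, State.setN, hn, hr1, ne_eq, Nat.reduceEqDiff, not_false_eq_true,
          Function.update_of_ne]
        refine ⟨hI.1, hI.2.1, hI.2.2.1, fun j hj => ?_⟩
        rcases Nat.lt_succ_iff_lt_or_eq.1 hj with hj | rfl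
        · exact hI.2.2.2 j hj
        · exact h
  · rintro s' - ⟨h1, h2, h3, h4⟩
    refine ⟨h1, h2, fun j hj => ?_⟩
    rcases Nat.lt_or_eq_of_le hj with hj | rfl
    · exact h4 j hj
    · exact h3

open scoped Classical in
-- The loop covers `b + 1` columns in order to reach the row in the virtual column; the values
-- stored at the index `b` in the arrays of columns carry no meaning. Injectivity guarantees that
-- the dual variable of a row is changed only once.
theorem hungUpdate_runs (s : State) {b : ℕ} (hb : s.nvar 18 = b + 1)
    (hinj : ∀ j ≤ b, ∀ j' ≤ b, s.narr 13 0 j = 1 → s.narr 13 0 j' = 1 →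
      s.narr 11 0 j = s.narr 11 0 j' → j = j') :
    Runs hungUpdate s ((b + 1) * 50 + 10) fun s' =>
      (∀ r, s'.rarr 12 0 r = if ∃ j ≤ b, s.narr 13 0 j = 1 ∧ s.narr 11 0 j = r then
        s.rarr 12 0 r + s.rvar 1 else s.rarr 12 0 r) ∧
      (∀ j < b, s'.rarr 13 0 j =
        if s.narr 13 0 j = 1 then s.rarr 13 0 j - s.rvar 1 else s.rarr 13 0 j) ∧
      ∀ j < b, s.narr 13 0 j ≠ 1 → s'.rarr 15 0 j = s.rarr 15 0 j - s.rvar 1 := by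
  refine (Runs.forTo_const (fun i s' =>
      (∀ r, s'.rarr 12 0 r = if ∃ j < i, s.narr 13 0 j = 1 ∧ s.narr 11 0 j = r then
        s.rarr 12 0 r + s.rvar 1 else s.rarr 12 0 r) ∧
      (∀ j, s'.rarr 13 0 j =
        if j < i ∧ s.narr 13 0 j = 1 then s.rarr 13 0 j - s.rvar 1 else s.rarr 13 0 j) ∧
      (∀ j, s'.rarr 15 0 j =
        if j < i ∧ s.narr 13 0 j ≠ 1 then s.rarr 15 0 j - s.rvar 1 else s.rarr 15 0 j))
      (b + 1) 42 hb (by decide)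
    (by decide) (by decide) ?_ ?_ (by omega)).mono le_rfl ?_
  · simp [State.setN]
  · intro i hi s' hf hx hI
    have hn11 := hf.na 11 (by decide)
    have hn13 := hf.na 13 (by decide)
    have hr1 := hf.rv 1 (by decide)
    obtain ⟨h12, h13, h15⟩ := hI
    refine Runs.ite 30 (fun h => Runs.of_den rfl (by decide) fun _ => ?_)
        (fun h => Runs.of_den rfl (by decide) fun _ => ?_) (by decide)
    · simp only [BExp.holds, NExp.eval, hx, hn13] at h
      simp only [Prog.den, NExp.eval, RExp.eval, State.setN_rarr, upd_self, upd2_self, hx, hn11,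
        hr1, upd_of_ne, ne_eq, Nat.reduceEqDiff, not_false_eq_true]
      refine ⟨fun r => ?_, fun j => ?_, fun j => ?_⟩
      · by_cases e : r = s.narr 11 0 i
        · subst e
          rw [Function.update_self, h12, if_neg, if_pos ⟨i, Nat.lt_succ_self i, h, rfl⟩]
          rintro ⟨j, hj, hju, e⟩
          have := hinj j (by omega) i (by omega) hju h e
          omega
        · rw [Function.update_of_ne e, h12]
          congr 1
          apply propext
          constructor
          · rintro ⟨j, hj, hju⟩
            exact ⟨j, by omega, hju⟩
          · rintro ⟨j, hj, hju, e'⟩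
            refine ⟨j, ?_, hju, e'⟩
            rcases Nat.lt_succ_iff_lt_or_eq.1 hj with hj | rfl
            · exact hj
            · exact absurd e'.symm e
      · by_cases e : j = i
        · subst e
          simp [h, h13]
        · rw [Function.update_of_ne e, h13]
          congr 1
          simp only [Nat.lt_succ_iff_lt_or_eq, e, or_false]
      · rw [h15]
        congr 1
        by_cases e : j = i
        · subst e
          simp [h]
        · simp only [Nat.lt_succ_iff_lt_or_eq, e, or_false]
    · simp only [BExp.holds, NExp.eval, hx, hn13] at h
      simp only [Prog.den, NExp.eval, RExp.eval, State.setN_rarr, upd_self, upd2_self, hx,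
        hr1, upd_of_ne, ne_eq, Nat.reduceEqDiff, not_false_eq_true]
      refine ⟨fun r => ?_, fun j => ?_, fun j => ?_⟩
      · rw [h12]
        congr 1
        apply propext
        constructor
        · rintro ⟨j, hj, hju⟩
          exact ⟨j, by omega, hju⟩
        · rintro ⟨j, hj, hju, e'⟩
          refine ⟨j, ?_, hju, e'⟩
          rcases Nat.lt_succ_iff_lt_or_eq.1 hj with hj | rfl
          · exact hj
          · exact absurd hju h
      · rw [h13]
        congr 1
        by_cases e : j = i
        · subst e
          simp [h]
        · simp only [Nat.lt_succ_iff_lt_or_eq, e, or_false]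
      · by_cases e : j = i
        · subst e
          simp [h, h15]
        · rw [Function.update_of_ne e, h15]
          congr 1
          simp only [Nat.lt_succ_iff_lt_or_eq, e, or_false]
  · rintro s' - ⟨h1, h2, h3⟩
    refine ⟨fun r => ?_, fun j hj => ?_, fun j hj hju => ?_⟩
    · rw [h1]
      simp only [Nat.lt_succ_iff]
    · rw [h2]
      simp only [Nat.lt_succ_of_lt hj, true_and]
    · rw [h3, if_pos ⟨Nat.lt_succ_of_lt hj, hju⟩]

open scoped Classical in
theorem hungRelax_runs (s : State) {b j₁ : ℕ} (hb : s.nvar 12 = b) (hj₁ : s.nvar 16 = j₁) :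
    Runs hungRelax s (b * 70 + 10) fun s' =>
      (∀ j < b, s'.narr 12 0 j = if s.narr 13 0 j ≠ 1 ∧
        s.rarr 11 (s.narr 11 0 j₁) j - s.rarr 12 0 (s.narr 11 0 j₁) - s.rarr 13 0 j <
          s.rarr 15 0 j then j₁ else s.narr 12 0 j) ∧
      (∀ j < b, s'.rarr 15 0 j = if s.narr 13 0 j ≠ 1 ∧
        s.rarr 11 (s.narr 11 0 j₁) j - s.rarr 12 0 (s.narr 11 0 j₁) - s.rarr 13 0 j <
          s.rarr 15 0 j then
          s.rarr 11 (s.narr 11 0 j₁) j - s.rarr 12 0 (s.narr 11 0 j₁) - s.rarr 13 0 j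
          else s.rarr 15 0 j) := by
  set c : ℕ → ℝ := fun j =>
    s.rarr 11 (s.narr 11 0 j₁) j - s.rarr 12 0 (s.narr 11 0 j₁) - s.rarr 13 0 j with hc
  refine (Runs.forTo_const (fun i s' =>
      (∀ j, s'.narr 12 0 j = if j < i ∧ s.narr 13 0 j ≠ 1 ∧ c j < s.rarr 15 0 j then j₁
        else s.narr 12 0 j) ∧
      (∀ j, s'.rarr 15 0 j = if j < i ∧ s.narr 13 0 j ≠ 1 ∧ c j < s.rarr 15 0 j then c j
        else s.rarr 15 0 j))
      b 62 hb (by decide)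
    (by decide) (by decide) ?_ ?_ (by omega)).mono le_rfl ?_
  · simp [State.setN]
  · intro i hi s' hf hx hI
    have hn11 := hf.na 11 (by decide)
    have hn13 := hf.na 13 (by decide)
    have hr11 := hf.ra 11 (by decide)
    have hr12 := hf.ra 12 (by decide)
    have hr13 := hf.ra 13 (by decide)
    have h16 := (hf.nv 16 (by decide)).trans hj₁
    obtain ⟨h12, h15⟩ := hI
    have h15i : s'.rarr 15 0 i = s.rarr 15 0 i := by rw [h15, if_neg (by simp)]
    have h12i : s'.narr 12 0 i = s.narr 12 0 i := by rw [h12, if_neg (by simp)]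
    refine Runs.ite 30 (fun h => Runs.of_den rfl (by decide) fun _ => ?_)
        (fun h => Runs.of_den rfl (by decide) fun _ => ?_) (by decide)
    · simp only [BExp.holds, NExp.eval, RExp.eval, slackExp, hx, hn13, hn11, hr11, hr12, hr13, h16,
        h15i] at h
      simp only [Prog.den, NExp.eval, RExp.eval, slackExp, State.setN_rarr, State.setN_narr, upd_self,
        upd2_self, hx, hn11, h16, hr11, hr12, hr13,
        upd_of_ne, ne_eq, Nat.reduceEqDiff, not_false_eq_true]
      refine ⟨fun j => ?_, fun j => ?_⟩
      · by_cases e : j = i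
        · subst e
          rw [Function.update_self, if_pos ⟨Nat.lt_succ_self j, h⟩]
        · rw [Function.update_of_ne e, h12]
          simp only [Nat.lt_succ_iff_lt_or_eq, e, or_false, ne_eq]
      · by_cases e : j = i
        · subst e
          rw [Function.update_self, if_pos ⟨Nat.lt_succ_self j, h⟩]
        · rw [Function.update_of_ne e, h15]
          simp only [Nat.lt_succ_iff_lt_or_eq, e, or_false, ne_eq]
    · simp only [BExp.holds, NExp.eval, RExp.eval, slackExp, hx, hn13, hn11, hr11, hr12, hr13, h16,
        h15i] at h
      simp only [Prog.den, State.setN_rarr, State.setN_narr]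
      refine ⟨fun j => ?_, fun j => ?_⟩
      · by_cases e : j = i
        · subst e
          rw [h12i, if_neg fun h' => h h'.2]
        · rw [h12]
          simp only [Nat.lt_succ_iff_lt_or_eq, e, or_false, ne_eq]
      · by_cases e : j = i
        · subst e
          rw [h15i, if_neg fun h' => h h'.2]
        · rw [h15]
          simp only [Nat.lt_succ_iff_lt_or_eq, e, or_false, ne_eq]
  · rintro s' - ⟨h1, h2⟩
    refine ⟨fun j hj => ?_, fun j hj => ?_⟩
    · rw [h1]
      simp only [hj, true_and, hc]
    · rw [h2]
      simp only [hj, true_and, hc]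

end CNTCost

end

/-! ### One stage of the Hungarian method and its overall running time. -/

noncomputable section

namespace CNTCost

/-- One extension of the search tree, or the end of the search. -/
def hungBody : Prog :=
  (.nset 16 (.var 12) ;; .rset 1 (.sub .zero (.arr 12 (.const 0) (.arr 11 (.const 0) (.var 12))))) ;;
  hungFind ;; hungUpdate ;;
  .ite (.neq (.arr 13 (.const 0) (.var 16)) (.const 1)) (.nset 17 (.const 1))
    (.ite (.neq (.arr 11 (.const 0) (.var 16)) (.var 11)) (.nset 17 (.const 1))
      (.nstore 13 (.const 0) (.var 16) (.const 1) ;; hungRelax))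

/-- The augmentation of the matching. -/
def hungAugment : Prog :=
  .while (.not (.neq (.var 16) (.var 12)))
    (.nstore 11 (.const 0) (.var 16) (.arr 11 (.const 0) (.arr 12 (.const 0) (.var 16))) ;;
      .nset 16 (.arr 12 (.const 0) (.var 16)))

/-- The treatment of a row. -/
def hungStage : Prog :=
  hungStart ;;
  (.rstore 12 (.const 0) (.var 13) .zero ;; .nstore 11 (.const 0) (.var 12) (.var 13) ;;
    .nstore 13 (.const 0) (.var 12) (.const 1) ;; .nset 17 (.const 0)) ;;
  .while (.neq (.var 17) (.const 0)) hungBody ;; hungAugment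

/-- The minimum weight of a partial matching. -/
def hung : Prog :=
  .nset 18 (.add (.var 12) (.const 1)) ;; hungInit ;; forTo 13 11 hungStage ;; .rset 3 .zero ;;
  forTo 15 11 (.rset 3 (.add (.var 3) (.arr 12 (.const 0) (.var 15)))) ;;
  forTo 15 12 (.rset 3 (.add (.var 3) (.arr 13 (.const 0) (.var 15))))

/-- `Search` for the memory `s`. -/
def SearchState (X : ℕ → ℕ → ℝ) (a b i : ℕ) (s : State) : Prop :=
  ∃ rk, Search X a b i (s.narr 11 0) (s.rarr 12 0) (s.rarr 13 0) (s.narr 13 0) (s.narr 12 0)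
    (s.rarr 15 0) rk

/-- `Augmenting` for the memory `s`. -/
def AugmentingState (X : ℕ → ℕ → ℝ) (a b i : ℕ) (s : State) : Prop :=
  ∃ rk, rk (s.nvar 16) ≤ b + 1 ∧ Augmenting X a b i (s.narr 11 0) (s.rarr 12 0) (s.rarr 13 0)
    (s.narr 13 0) (s.narr 12 0) rk (s.nvar 16)

/-- Progress is measured by the number of used columns, which grows by one unless the search ends.
The coefficient 160 is the sum of the coefficients 40, 50 and 70 of the three loops. -/
theorem hungBody_runs (s : State) {X : ℕ → ℕ → ℝ} {a b i : ℕ} (ha : s.nvar 11 = a)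
    (hb : s.nvar 12 = b) (hb1 : s.nvar 18 = b + 1) (hX : s.rarr 11 = X) (h0 : s.nvar 17 = 0)
    (h : SearchState X a b i s) :
    Runs hungBody s (160 * b + 150) fun s' =>
      (s'.nvar 17 = 1 ∧ AugmentingState X a b (i + 1) s') ∨
      (s'.nvar 17 = 0 ∧ SearchState X a b i s' ∧
        usedCard b (s'.narr 13 0) = usedCard b (s.narr 13 0) + 1) := by
  classical
  obtain ⟨rk, h⟩ := h
  refine Runs.den_seq (160 * b + 130) rfl (fun _ => ?_)
    (by simp only [Prog.time, NExp.cost, RExp.cost]; omega)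
  set s₁ := ((Prog.nset 16 (.var 12)) ;;
    .rset 1 (.sub .zero (.arr 12 (.const 0) (.arr 11 (.const 0) (.var 12))))).den s with hs₁
  have e12 : s₁.nvar 12 = b := by simp [hs₁, Prog.den, hb]
  have e11 : s₁.nvar 11 = a := by simp [hs₁, Prog.den, ha]
  have e18 : s₁.nvar 18 = b + 1 := by simp [hs₁, Prog.den, hb1]
  have e17 : s₁.nvar 17 = 0 := by simp [hs₁, Prog.den, h0]
  have e16 : s₁.nvar 16 = b := by simp [hs₁, Prog.den, NExp.eval, hb]
  have er1 : s₁.rvar 1 = - s.rarr 12 0 (s.narr 11 0 b) := by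
    simp [hs₁, Prog.den, NExp.eval, RExp.eval, hb]
  have en : s₁.narr = s.narr := by simp [hs₁, Prog.den]
  have er : s₁.rarr = s.rarr := by simp [hs₁, Prog.den]
  clear_value s₁
  refine Runs.seq (b * 40 + 10) (120 * b + 120) (hungFind_runs s₁ e12 e16 ?_) ?_ (by omega)
  · rw [slackAt, en, er, if_pos h.used_virtual, er1]
  rintro s₂ f ⟨hj₁, hδ, hle⟩
  have e12 : s₂.nvar 12 = b := (f.nv 12 (by decide)).trans e12
  have e11 : s₂.nvar 11 = a := (f.nv 11 (by decide)).trans e11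
  have e18 : s₂.nvar 18 = b + 1 := (f.nv 18 (by decide)).trans e18
  have e17 : s₂.nvar 17 = 0 := (f.nv 17 (by decide)).trans e17
  have n11 : s₂.narr 11 = s.narr 11 := (f.na 11 (by decide)).trans (by rw [en])
  have n12 : s₂.narr 12 = s.narr 12 := (f.na 12 (by decide)).trans (by rw [en])
  have n13 : s₂.narr 13 = s.narr 13 := (f.na 13 (by decide)).trans (by rw [en])
  have r11 : s₂.rarr 11 = X := (f.ra 11 (by decide)).trans (by rw [er, hX])
  have r12 : s₂.rarr 12 = s.rarr 12 := (f.ra 12 (by decide)).trans (by rw [er])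
  have r13 : s₂.rarr 13 = s.rarr 13 := (f.ra 13 (by decide)).trans (by rw [er])
  have r15 : s₂.rarr 15 = s.rarr 15 := (f.ra 15 (by decide)).trans (by rw [er])
  clear f
  simp only [slackAt, en, er] at hδ hle
  refine Runs.seq ((b + 1) * 50 + 10) (70 * b + 60) (hungUpdate_runs s₂ e18 ?_) ?_ (by omega)
  · rw [n11, n13]
    intro j hj j' hj' hu hu' e
    exact h.cert.inj j hj j' hj' trivial trivial (h.matched j hj hu) e
  rintro s₃ f ⟨hu, hv, hm⟩
  rw [n11, n13, r12] at hu
  rw [n13, r13] at hv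
  rw [n13, r15] at hm
  set j₁ := s₂.nvar 16 with hj₁'
  obtain ⟨h, hpos, hz, hz'⟩ := h.update hj₁ hδ hle hu hv hm
  have e12 : s₃.nvar 12 = b := (f.nv 12 (by decide)).trans e12
  have e11 : s₃.nvar 11 = a := (f.nv 11 (by decide)).trans e11
  have e17 : s₃.nvar 17 = 0 := (f.nv 17 (by decide)).trans e17
  have e16 : s₃.nvar 16 = j₁ := f.nv 16 (by decide)
  have n11 : s₃.narr 11 = s.narr 11 := (f.na 11 (by decide)).trans n11
  have n12 : s₃.narr 12 = s.narr 12 := (f.na 12 (by decide)).trans n12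
  have n13 : s₃.narr 13 = s.narr 13 := (f.na 13 (by decide)).trans n13
  have r11 : s₃.rarr 11 = X := (f.ra 11 (by decide)).trans r11
  clear_value j₁
  clear f hu hv hm hδ hle
  refine Runs.ite (70 * b + 50) (fun hc => ?_) (fun hc => ?_) ?_
  rotate_left 2
  · simp only [BExp.cost, NExp.cost]; omega
  · simp only [BExp.holds, NExp.eval, e16, n13] at hc
    refine Runs.of_den rfl (by simp only [Prog.time, NExp.cost]; omega) fun _ => ?_
    left
    refine ⟨by simp [Prog.den, NExp.eval], ?_⟩
    simpa [AugmentingState, Prog.den, e16, n11, n12, n13] using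
      h.augmenting hpos hj₁ hz fun hc' => absurd hc hc'
  · simp only [BExp.holds, NExp.eval, e16, n13] at hc
    refine Runs.ite (70 * b + 40) (fun hc' => ?_) (fun hc' => ?_) ?_
    rotate_left 2
    · simp only [BExp.cost, NExp.cost]; omega
    · simp only [BExp.holds, NExp.eval, e16, n11, e11] at hc'
      refine Runs.of_den rfl (by simp only [Prog.time, NExp.cost]; omega) fun _ => ?_
      left
      refine ⟨by simp [Prog.den, NExp.eval], ?_⟩
      simpa [AugmentingState, Prog.den, e16, n11, n12, n13] using
        h.augmenting hpos hj₁ hz fun _ => ⟨hc', hz' hc⟩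
    · simp only [BExp.holds, NExp.eval, e16, n11, e11] at hc'
      refine Runs.den_seq (70 * b + 10) rfl (fun f => ?_)
        (by simp only [Prog.time, NExp.cost]; omega)
      set s₄ := (Prog.nstore 13 (.const 0) (.var 16) (.const 1)).den s₃ with hs₄
      have u4 : s₄.narr 13 0 = Function.update (s.narr 13 0) j₁ 1 := by
        simp [hs₄, Prog.den, NExp.eval, upd_self, upd2_self, e16, n13]
      have n11 : s₄.narr 11 = s.narr 11 := (f.na 11 (by decide)).trans n11
      have n12 : s₄.narr 12 = s.narr 12 := (f.na 12 (by decide)).trans n12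
      have ev : s₄.nvar = s₃.nvar := rfl
      have er : s₄.rarr = s₃.rarr := rfl
      clear_value s₄
      refine (hungRelax_runs s₄ (j₁ := j₁) (by rw [ev, e12]) (by rw [ev, e16])).mono
        (by omega) ?_
      rintro s₅ f ⟨hw, hm⟩
      right
      rw [u4, er, n11, n12, r11] at hw
      rw [u4, er, n11, r11] at hm
      have n11 : s₅.narr 11 = s.narr 11 := (f.na 11 (by decide)).trans n11
      have n13 : s₅.narr 13 0 = Function.update (s.narr 13 0) j₁ 1 := by
        rw [f.na 13 (by decide), u4]
      have r12 : s₅.rarr 12 = s₃.rarr 12 := (f.ra 12 (by decide)).trans (by rw [er])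
      have r13 : s₅.rarr 13 = s₃.rarr 13 := (f.ra 13 (by decide)).trans (by rw [er])
      refine ⟨(f.nv 17 (by decide)).trans (by rw [ev, e17]), ?_, ?_⟩
      · rw [SearchState, n11, n13, r12, r13]
        exact ⟨_, h.mark hpos hj₁ hc hc' (hz' hc) hw hm⟩
      · rw [n13]
        exact usedCard_update (lt_of_le_of_ne hj₁ fun e => hc (e ▸ h.used_virtual)) hc

theorem hungAugment_runs (s : State) {X : ℕ → ℕ → ℝ} {a b i : ℕ} (hb : s.nvar 12 = b)
    (h : AugmentingState X a b i s) :
    Runs hungAugment s ((b + 1) * 20 + 10) fun s' =>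
      Certified X a b i (fun j => j ≠ b) (s'.narr 11 0) (s'.rarr 12 0) (s'.rarr 13 0) ∧
      ∀ r < i, ∀ j < b, s'.rarr 12 0 r + s'.rarr 13 0 j ≤ X r j := by
  obtain ⟨rk, hrk, h⟩ := h
  -- The rank of the hole is the potential: it is at most `b + 1` at the start and decreases in
  -- every step, and a step including its test costs at most 20.
  refine (Runs.while_of_bounded (B := (b + 1) * 20) (I := fun τ s' =>
    τ + rk (s'.nvar 16) * 20 ≤ (b + 1) * 20 ∧ Augmenting X a b i (s'.narr 11 0) (s'.rarr 12 0)
      (s'.rarr 13 0) (s'.narr 13 0) (s'.narr 12 0) rk (s'.nvar 16)) ⟨by omega, h⟩ ?_ ?_ ?_).mono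
      le_rfl ?_
  · rintro τ s' ⟨h, -⟩
    omega
  · rintro τ s' f ⟨hτ, h'⟩ hc
    have hb' : s'.nvar 12 = b := (f.nv 12 (by decide)).trans hb
    simp only [BExp.holds, NExp.eval, hb'] at hc
    obtain ⟨h1, h2⟩ := h'.step hc
    refine ⟨14, Runs.of_den rfl (by decide) fun _ => ⟨?_, ?_⟩⟩
    · simp [Prog.den, NExp.eval, upd_of_ne, BExp.cost, NExp.cost]
      omega
    · simpa [Prog.den, NExp.eval, upd_self, upd2_self, upd_of_ne] using h1
  · simp only [BExp.cost, NExp.cost]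
    omega
  · rintro s' f ⟨⟨τ, -, h'⟩, hc⟩
    have hb' : s'.nvar 12 = b := (f.nv 12 (by decide)).trans hb
    simp only [BExp.holds, NExp.eval, hb', not_not] at hc
    rw [hc] at h'
    exact ⟨h'.cert, h'.feas⟩

/-- At most `b` iterations add a real column to the tree, and one more ends the search. Each costs
`O(b + 1)`, and the augmentation is linear in `b + 1`, so a row is treated in time `O((b + 1)²)`. -/
theorem hungStage_runs (s : State) {X : ℕ → ℕ → ℝ} {a b i : ℕ} (ha : s.nvar 11 = a)
    (hb : s.nvar 12 = b) (hb1 : s.nvar 18 = b + 1) (hX : s.rarr 11 = X) (hi : s.nvar 13 = i)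
    (hia : i < a)
    (h : Certified X a b i (fun j => j ≠ b) (s.narr 11 0) (s.rarr 12 0) (s.rarr 13 0))
    (h' : ∀ r < i, ∀ j < b, s.rarr 12 0 r + s.rarr 13 0 j ≤ X r j) :
    Runs hungStage s ((b + 1) * (160 * b + 160) + 80 * b + 80) fun s' =>
      Certified X a b (i + 1) (fun j => j ≠ b) (s'.narr 11 0) (s'.rarr 12 0) (s'.rarr 13 0) ∧
      ∀ r < i + 1, ∀ j < b, s'.rarr 12 0 r + s'.rarr 13 0 j ≤ X r j := by
  refine Runs.seq (b * 40 + 10) ((b + 1) * (160 * b + 160) + 40 * b + 70) (hungStart_runs s hb) ?_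
    (by omega)
  rintro s₁ f ⟨hw, hu, hm⟩
  refine Runs.den_seq ((b + 1) * (160 * b + 160) + 40 * b + 50) rfl (fun f' => ?_)
    (by simp only [Prog.time, NExp.cost, RExp.cost]; omega)
  have e12 : s₁.nvar 12 = b := (f.nv 12 (by decide)).trans hb
  have e13 : s₁.nvar 13 = i := (f.nv 13 (by decide)).trans hi
  have hS : SearchState X a b i
      ((Prog.rstore 12 (.const 0) (.var 13) .zero ;; .nstore 11 (.const 0) (.var 12) (.var 13) ;;
      .nstore 13 (.const 0) (.var 12) (.const 1) ;; .nset 17 (.const 0)).den s₁) := by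
    refine ⟨fun _ => 0, ?_⟩
    simp only [Prog.den, NExp.eval, RExp.eval, upd_self, upd2_self, upd_of_ne, ne_eq,
      Nat.reduceEqDiff, not_false_eq_true, e12, e13, f.na 11 (by decide), f.ra 12 (by decide),
      f.ra 13 (by decide)]
    refine h.search h' hia (by simp) (fun j hj => ?_) hw (fun j hj => ?_)
    · rw [Function.update_of_ne hj.ne, hu j hj]
      simp
    · rw [hm j hj, hX, hi]
  set s₂ := (Prog.rstore 12 (.const 0) (.var 13) .zero ;;
      .nstore 11 (.const 0) (.var 12) (.var 13) ;;
      .nstore 13 (.const 0) (.var 12) (.const 1) ;; .nset 17 (.const 0)).den s₁ with hs₂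
  have e17 : s₂.nvar 17 = 0 := by simp [hs₂, Prog.den, NExp.eval]
  clear_value s₂
  have e11 : s₂.nvar 11 = a := (f'.nv 11 (by decide)).trans ((f.nv 11 (by decide)).trans ha)
  have e12 : s₂.nvar 12 = b := (f'.nv 12 (by decide)).trans e12
  have e18 : s₂.nvar 18 = b + 1 := (f'.nv 18 (by decide)).trans ((f.nv 18 (by decide)).trans hb1)
  have r11 : s₂.rarr 11 = X := (f'.ra 11 (by decide)).trans ((f.ra 11 (by decide)).trans hX)
  refine Runs.seq ((b + 1) * (160 * b + 160) + 4) ((b + 1) * 20 + 10)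
    (Runs.while_of_bounded (B := (b + 1) * (160 * b + 160)) (I := fun τ s' =>
      (s'.nvar 17 = 1 ∧ AugmentingState X a b (i + 1) s' ∧ τ ≤ (b + 1) * (160 * b + 160)) ∨
      (s'.nvar 17 = 0 ∧ SearchState X a b i s' ∧
        τ ≤ usedCard b (s'.narr 13 0) * (160 * b + 160)))
      (Or.inr ⟨e17, hS, Nat.zero_le _⟩) ?_ ?_ ?_) ?_ (by omega)
  · rintro τ s' (⟨-, -, h⟩ | ⟨-, -, h⟩)
    · exact h
    · exact h.trans (Nat.mul_le_mul_right _ ((usedCard_le _ _).trans (Nat.le_succ _)))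
  · rintro τ s' f hI hc
    simp only [BExp.holds, NExp.eval] at hc
    rcases hI with ⟨h, -⟩ | ⟨-, hS, hτ⟩
    · omega
    have e11 : s'.nvar 11 = a := (f.nv 11 (by decide)).trans e11
    have e12 : s'.nvar 12 = b := (f.nv 12 (by decide)).trans e12
    have e18 : s'.nvar 18 = b + 1 := (f.nv 18 (by decide)).trans e18
    have r11 : s'.rarr 11 = X := (f.ra 11 (by decide)).trans r11
    refine ⟨160 * b + 150, (hungBody_runs s' e11 e12 e18 r11 hc hS).mono le_rfl ?_⟩
    rintro s'' - (⟨h1, h2⟩ | ⟨h1, h2, h3⟩)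
    · left
      refine ⟨h1, h2, ?_⟩
      have := Nat.mul_le_mul_right (160 * b + 160) (usedCard_le b (s'.narr 13 0))
      rw [add_mul]
      simp only [BExp.cost, NExp.cost]
      omega
    · right
      refine ⟨h1, h2, ?_⟩
      rw [h3, add_mul]
      simp only [BExp.cost, NExp.cost]
      omega
  · simp only [BExp.cost, NExp.cost]
    omega
  · rintro s₃ f ⟨⟨τ, hI⟩, hc⟩
    simp only [BExp.holds, NExp.eval] at hc
    rcases hI with ⟨-, hA, -⟩ | ⟨h, -⟩
    · exact hungAugment_runs s₃ ((f.nv 12 (by decide)).trans e12) hA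
    · exact absurd h hc

/-- One stage per row, after which the dual certificate covers all rows and the minimum is the sum
of the dual variables. The bound is quadratic in the columns and linear in the rows; later the
columns are the children in the second tree. -/
theorem hung_runs (s : State) {a b : ℕ} (ha : s.nvar 11 = a) (hb : s.nvar 12 = b) :
    Runs hung s (300 * (a + 1) * (b + 1) * (b + 1)) fun s' =>
      IsMinMatching a b (s.rarr 11) (s'.rvar 3) := by
  -- The sum is bracketed like the sequence of programs, so that each application of `Runs.seq`
  -- splits off one summand.
  refine Runs.mono (B := 10 + ((b * 20 + 10) +
    ((a * (((b + 1) * (160 * b + 160) + 80 * b + 80) + 8) + 6) + (5 + (a * 20 + 6 +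
      (b * 20 + 6)))))) ?_ ?_ (fun _ _ h => h)
  rotate_left
  · ring_nf
    have := Nat.zero_le (a * b)
    have := Nat.zero_le (a * b ^ 2)
    have := Nat.zero_le (b ^ 2)
    omega
  refine Runs.den_seq _ rfl (fun f => ?_) (Nat.add_le_add_right (by decide) _)
  set s₁ := (Prog.nset 18 (.add (.var 12) (.const 1))).den s with hs₁
  have e18 : s₁.nvar 18 = b + 1 := by simp [hs₁, Prog.den, NExp.eval, hb]
  clear_value s₁
  have e11 : s₁.nvar 11 = a := (f.nv 11 (by decide)).trans ha
  have e12 : s₁.nvar 12 = b := (f.nv 12 (by decide)).trans hb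
  have r11 : s₁.rarr 11 = s.rarr 11 := f.ra 11 (by decide)
  clear f hs₁
  refine Runs.seq _ _ (hungInit_runs s₁ e12) ?_ le_rfl
  rintro s₂ f ⟨hp, hv⟩
  rw [e11] at hp
  have e18 : s₂.nvar 18 = b + 1 := (f.nv 18 (by decide)).trans e18
  have e11 : s₂.nvar 11 = a := (f.nv 11 (by decide)).trans e11
  have e12 : s₂.nvar 12 = b := (f.nv 12 (by decide)).trans e12
  have r11 : s₂.rarr 11 = s.rarr 11 := (f.ra 11 (by decide)).trans r11
  clear f
  refine Runs.seq _ _ (Runs.forTo_const (fun i s' =>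
      Certified (s.rarr 11) a b i (fun j => j ≠ b) (s'.narr 11 0) (s'.rarr 12 0) (s'.rarr 13 0) ∧
      ∀ r < i, ∀ j < b, s'.rarr 12 0 r + s'.rarr 13 0 j ≤ s.rarr 11 r j) a
      ((b + 1) * (160 * b + 160) + 80 * b + 80) e11 (by decide) (by decide) (by decide) ?_ ?_ le_rfl)
      ?_ le_rfl
  · refine ⟨⟨by simp, fun j hj => (hv j hj).le, ?_, ?_, ?_, by simp, fun j hj _ _ => hv j hj⟩,
      by simp⟩
    · intro j hj hj' hp'
      exact absurd (hp j (lt_of_le_of_ne hj hj')) hp'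
    · intro j hj hj' hp'
      exact absurd (hp j hj) hp'
    · intro j hj j' _ hj' _ hp'
      exact absurd (hp j (lt_of_le_of_ne hj hj')) hp'
  · intro i hi s' f hx hI
    exact hungStage_runs s' ((f.nv 11 (by decide)).trans e11) ((f.nv 12 (by decide)).trans e12)
      ((f.nv 18 (by decide)).trans e18) ((f.ra 11 (by decide)).trans r11) hx hi hI.1 hI.2
  rintro s₃ f ⟨hc, hfeas⟩
  have e11 : s₃.nvar 11 = a := (f.nv 11 (by decide)).trans e11
  have e12 : s₃.nvar 12 = b := (f.nv 12 (by decide)).trans e12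
  clear f hp hv r11 e18
  have hmin := hc.isMinMatching hfeas
  refine Runs.den_seq _ rfl (fun f => ?_) (Nat.add_le_add_right (by decide) _)
  set s₄ := (Prog.rset 3 .zero).den s₃ with hs₄
  have r3 : s₄.rvar 3 = 0 := by simp [hs₄, Prog.den, RExp.eval]
  clear_value s₄
  have e11 : s₄.nvar 11 = a := (f.nv 11 (by decide)).trans e11
  have e12 : s₄.nvar 12 = b := (f.nv 12 (by decide)).trans e12
  have r12 : s₄.rarr 12 = s₃.rarr 12 := f.ra 12 (by decide)
  have r13 : s₄.rarr 13 = s₃.rarr 13 := f.ra 13 (by decide)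
  clear f
  refine Runs.seq _ _ (Runs.forTo_const (fun i s' =>
      s'.rvar 3 = ∑ r ∈ Finset.range i, s₃.rarr 12 0 r) a 12 e11 (by decide) (by decide)
      (by decide) (by simpa [State.setN] using r3) ?_ le_rfl) ?_ le_rfl
  · intro i hi s' f hx hI
    refine Runs.of_den rfl (by decide) fun _ => ?_
    simp [Prog.den, RExp.eval, NExp.eval, State.setN_rvar, hI, hx, f.ra 12 (by decide), r12,
      Finset.sum_range_succ]
  intro s₅ f h3
  have e12 : s₅.nvar 12 = b := (f.nv 12 (by decide)).trans e12
  have r13 : s₅.rarr 13 = s₃.rarr 13 := (f.ra 13 (by decide)).trans r13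
  refine (Runs.forTo_const (fun i s' =>
      s'.rvar 3 = ∑ r ∈ Finset.range a, s₃.rarr 12 0 r + ∑ j ∈ Finset.range i, s₃.rarr 13 0 j)
      b 12 e12 (by decide) (by decide)
      (by decide) (by simpa [State.setN] using h3) ?_ le_rfl).mono (by omega) ?_
  · intro i hi s' f hx hI
    refine Runs.of_den rfl (by decide) fun _ => ?_
    simp [Prog.den, RExp.eval, NExp.eval, State.setN_rvar, hI, hx, f.ra 13 (by decide), r13,
      Finset.sum_range_succ, add_assoc]
  · intro s' _ h
    rw [h]
    exact hmin

end CNTCost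

end

noncomputable section

namespace CNTCost

/-! ## Enumeration of the nodes of a compressed neighborhood tree by breadth first search -/

/-- Adjacency lists with edge labels. -/
structure AdjData where
  deg : ℕ → ℕ
  adj : ℕ → ℕ → ℕ
  lab : ℕ → ℕ → ℕ

/-- The existence of a walk of length `e` from `v` to `u`. -/
def AdjData.Walk (A : AdjData) (v : ℕ) : ℕ → ℕ → Prop
  | 0, u => u = v
  | e + 1, u => ∃ y, A.Walk v e y ∧ ∃ j < A.deg y, A.adj y j = u

/-- The vertex `u` occurs at the depth `d` of the `k`-redundant neighborhood tree. -/
structure AdjData.IsNode (A : AdjData) (v h k u d : ℕ) : Prop where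
  walk : A.Walk v d u
  le_height : d ≤ h
  le : ∀ e, A.Walk v e u → d ≤ e + k

/-- A node is determined by its vertex and by its depth minus the distance of this vertex, and this
difference lies in `0, …, k`. The bound holds for any list of distinct nodes, so it also applies to
the prefix found by an unfinished search. -/
theorem AdjData.sum_nodes_le (A : AdjData) {v h k N : ℕ} {vtx dep : ℕ → ℕ}
    (hn : ∀ q < N, A.IsNode v h k (vtx q) (dep q))
    (hinj : ∀ q < N, ∀ q' < N, vtx q = vtx q' → dep q = dep q' → q = q') (f : ℕ → ℕ)
    (R : Finset ℕ) (hR : ∀ e u, A.Walk v e u → u ∈ R) :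
    ∑ q ∈ Finset.range N, f (vtx q) ≤ (k + 1) * ∑ u ∈ R, f u := by
  classical
  set md : ℕ → ℕ := fun u => sInf {e | A.Walk v e u} with hmd
  have hle : ∀ q < N, md (vtx q) ≤ dep q ∧ dep q ≤ md (vtx q) + k := fun q hq =>
    ⟨Nat.sInf_le (hn q hq).walk, (hn q hq).le _
      (Nat.sInf_mem (s := {e | A.Walk v e (vtx q)}) ⟨_, (hn q hq).walk⟩)⟩
  have himg : (Finset.range N).image (fun q => (vtx q, dep q - md (vtx q))) ⊆
      R ×ˢ Finset.range (k + 1) := by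
    intro x hx
    obtain ⟨q, hq, rfl⟩ := Finset.mem_image.1 hx
    have hq := Finset.mem_range.1 hq
    have := hle q hq
    simp only [Finset.mem_product, Finset.mem_range]
    exact ⟨hR _ _ (hn q hq).walk, by omega⟩
  calc ∑ q ∈ Finset.range N, f (vtx q)
      = ∑ x ∈ (Finset.range N).image (fun q => (vtx q, dep q - md (vtx q))), f x.1 := by
        rw [Finset.sum_image]
        intro q hq q' hq' e
        have hq := Finset.mem_range.1 hq
        have hq' := Finset.mem_range.1 hq'
        obtain ⟨e1, e2⟩ := Prod.ext_iff.1 e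
        simp only at e1 e2
        refine hinj q hq q' hq' e1 ?_
        have h1 := hle q hq
        have h2 := hle q' hq'
        rw [e1] at h1 e2
        omega
    _ ≤ ∑ x ∈ R ×ˢ Finset.range (k + 1), f x.1 := Finset.sum_le_sum_of_subset himg
    _ = (k + 1) * ∑ u ∈ R, f u := by
        rw [Finset.sum_product]
        simp [Finset.mul_sum]

/-- The first `c` entries of `ch` and `el` describe the children of the node `q` obtained from the
first `lim` neighbors of the vertex represented by `q`. -/
structure Kids (A : AdjData) (v h k N : ℕ) (vtx dep : ℕ → ℕ) (q c lim : ℕ) (ch el : ℕ → ℕ) :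
    Prop where
  le : c ≤ lim
  child : ∀ i < c, q < ch i ∧ ch i < N ∧ dep (ch i) = dep q + 1 ∧
    ∃ j < lim, A.adj (vtx q) j = vtx (ch i) ∧ el i = A.lab (vtx q) j
  inj : ∀ i < c, ∀ i' < c, ch i = ch i' → i = i'
  complete : ∀ j < lim, A.IsNode v h k (A.adj (vtx q) j) (dep q + 1) →
    ∃ i < c, vtx (ch i) = A.adj (vtx q) j

theorem Kids.congr {A : AdjData} {v h k N : ℕ} {vtx dep : ℕ → ℕ} {q c lim : ℕ} {ch el : ℕ → ℕ}
    (H : Kids A v h k N vtx dep q c lim ch el) (hq : q < N) {N' : ℕ} {vtx' dep' ch' el' : ℕ → ℕ}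
    (hN : N ≤ N') (hv : ∀ q < N, vtx' q = vtx q) (hd : ∀ q < N, dep' q = dep q)
    (hc : ∀ i < c, ch' i = ch i) (he : ∀ i < c, el' i = el i) :
    Kids A v h k N' vtx' dep' q c lim ch' el' := by
  refine ⟨H.le, ?_, ?_, ?_⟩
  · intro i hi
    obtain ⟨h1, h2, h3, h4⟩ := H.child i hi
    rw [hc i hi, he i hi, hd q hq, hd _ h2, hv q hq, hv _ h2]
    exact ⟨h1, by omega, h3, h4⟩
  · intro i hi i' hi'
    rw [hc i hi, hc i' hi']
    exact H.inj i hi i' hi'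
  · intro j hj
    rw [hv q hq, hd q hq]
    intro hn
    obtain ⟨i, hi, e⟩ := H.complete j hj hn
    refine ⟨i, hi, ?_⟩
    rw [hc i hi, hv _ (H.child i hi).2.1, e]

theorem Kids.skip {A : AdjData} {v h k N : ℕ} {vtx dep : ℕ → ℕ} {q c lim : ℕ} {ch el : ℕ → ℕ}
    (H : Kids A v h k N vtx dep q c lim ch el)
    (hn : ¬ A.IsNode v h k (A.adj (vtx q) lim) (dep q + 1)) :
    Kids A v h k N vtx dep q c (lim + 1) ch el := by
  refine ⟨H.le.trans (Nat.le_succ _), ?_, H.inj, ?_⟩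
  · intro i hi
    obtain ⟨h1, h2, h3, j, hj, h4⟩ := H.child i hi
    exact ⟨h1, h2, h3, j, by omega, h4⟩
  · intro j hj hn'
    rcases Nat.lt_succ_iff_lt_or_eq.1 hj with hj | rfl
    · exact H.complete j hj hn'
    · exact absurd hn' hn

/-- A neighbor is listed only once in an adjacency list, so the new child differs from those
recorded before. -/
theorem Kids.record {A : AdjData} {v h k N : ℕ} {vtx dep : ℕ → ℕ} {q c lim : ℕ} {ch el : ℕ → ℕ}
    (H : Kids A v h k N vtx dep q c lim ch el) {x : ℕ} (hqx : q < x) (hxN : x < N)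
    (hv : vtx x = A.adj (vtx q) lim) (hd : dep x = dep q + 1)
    (hinj : ∀ j < lim, A.adj (vtx q) j ≠ A.adj (vtx q) lim) :
    Kids A v h k N vtx dep q (c + 1) (lim + 1) (Function.update ch c x)
      (Function.update el c (A.lab (vtx q) lim)) := by
  have hne : ∀ i < c, ch i ≠ x := by
    intro i hi e
    obtain ⟨-, -, -, j, hj, h4, -⟩ := H.child i hi
    exact hinj j hj (by rw [h4, e, hv])
  refine ⟨Nat.succ_le_succ H.le, ?_, ?_, ?_⟩
  · intro i hi
    by_cases e : i = c
    · subst e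
      simp only [Function.update_self]
      exact ⟨hqx, hxN, hd, lim, Nat.lt_succ_self _, hv.symm, rfl⟩
    · simp only [Function.update_of_ne e]
      obtain ⟨h1, h2, h3, j, hj, h4⟩ := H.child i (by omega)
      exact ⟨h1, h2, h3, j, by omega, h4⟩
  · intro i hi i' hi' e
    by_cases e1 : i = c <;> by_cases e2 : i' = c
    · rw [e1, e2]
    · rw [e1, Function.update_self, Function.update_of_ne e2] at e
      exact absurd e.symm (hne i' (by omega))
    · rw [e2, Function.update_self, Function.update_of_ne e1] at e
      exact absurd e (hne i (by omega))
    · rw [Function.update_of_ne e1, Function.update_of_ne e2] at e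
      exact H.inj i (by omega) i' (by omega) e
  · intro j hj hn
    rcases Nat.lt_succ_iff_lt_or_eq.1 hj with hj | rfl
    · obtain ⟨i, hi, e⟩ := H.complete j hj hn
      refine ⟨i, by omega, ?_⟩
      rwa [Function.update_of_ne hi.ne]
    · exact ⟨c, Nat.lt_succ_self _, by simpa using hv⟩

/-! ### Invariants of the breadth first search. -/

/-- The nodes `0, …, N - 1` in the order of discovery, where all nodes before `p` have been
processed. For a vertex `w`, `dist w` is one more than the distance of `w`, `lev w` is the greatest
depth of a node representing `w`, and `idx w` is this node. -/
structure Queue (A : AdjData) (v h k p N : ℕ) (vtx dep dist lev idx : ℕ → ℕ) : Prop where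
  pos : 0 < N
  vtx_zero : vtx 0 = v
  dep_zero : dep 0 = 0
  node : ∀ q < N, A.IsNode v h k (vtx q) (dep q)
  mono : ∀ q q', q ≤ q' → q' < N → dep q ≤ dep q'
  near : ∀ q < N, p < N → dep q ≤ dep p + 1
  inj : ∀ q < N, ∀ q' < N, vtx q = vtx q' → dep q = dep q' → q = q'
  seen : ∀ q < N, dist (vtx q) ≠ 0
  dist_le : ∀ w, dist w ≠ 0 → ∀ e, A.Walk v e w → dist w ≤ e + 1
  dist_walk : ∀ w, dist w ≠ 0 → A.Walk v (dist w - 1) w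
  idx_spec : ∀ w, lev w ≠ 0 → idx w < N ∧ vtx (idx w) = w ∧ dep (idx w) = lev w
  lev_max : ∀ q < N, dep q ≤ lev (vtx q)

section

variable {A : AdjData} {v h k p N : ℕ} {vtx dep dist lev idx : ℕ → ℕ}

/-- The tree is closed under parents: a walk to `y` that is shorter by more than `k` would extend to
such a walk to `u`. -/
theorem AdjData.IsNode.pred {e u : ℕ} (hn : A.IsNode v h k u (e + 1)) :
    ∃ y, A.IsNode v h k y e ∧ ∃ j < A.deg y, A.adj y j = u := by
  obtain ⟨y, hy, j, hj, hu⟩ := hn.walk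
  refine ⟨y, ⟨hy, by have := hn.le_height; omega, fun e' he' => ?_⟩, j, hj, hu⟩
  have := hn.le (e' + 1) ⟨y, he', j, hj, hu⟩
  omega

/-- All nodes up to the depth `d` have been discovered if those of smaller depth have been
processed. -/
theorem Queue.exists_of_isNode (H : Queue A v h k p N vtx dep dist lev idx) {nc : ℕ → ℕ}
    {ch el : ℕ → ℕ → ℕ}
    (hk : ∀ q < p, Kids A v h k N vtx dep q (nc q) (A.deg (vtx q)) (ch q) (el q))
    {d : ℕ} (hd : ∀ q < N, dep q < d → q < p) {e u : ℕ} (he : e ≤ d)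
    (hn : A.IsNode v h k u e) : ∃ q < N, vtx q = u ∧ dep q = e := by
  induction e generalizing u with
  | zero => exact ⟨0, H.pos, H.vtx_zero.trans hn.walk.symm, H.dep_zero⟩
  | succ e ih =>
    obtain ⟨y, hy, j, hj, rfl⟩ := hn.pred
    obtain ⟨q, hq, rfl, rfl⟩ := ih (by omega) hy
    have hqp := hd q hq (by omega)
    obtain ⟨i, hi, e'⟩ := (hk q hqp).complete j hj hn
    obtain ⟨-, h2, h3, -⟩ := (hk q hqp).child i hi
    exact ⟨_, h2, e', h3⟩

/-- A vertex met for the first time from `p` has distance `dep p + 1`, stored with an offset of one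
because 0 means unknown. If it were nearer, it would be a node at its distance, which is at most
`dep p`; all such nodes have already been discovered, and their vertices have been seen. -/
theorem Queue.discover (H : Queue A v h k p N vtx dep dist lev idx) (hp : p < N) {nc : ℕ → ℕ}
    {ch el : ℕ → ℕ → ℕ}
    (hk : ∀ q < p, Kids A v h k N vtx dep q (nc q) (A.deg (vtx q)) (ch q) (el q))
    {w : ℕ} (hw : dist w = 0) (hwalk : A.Walk v (dep p + 1) w) :
    Queue A v h k p N vtx dep (Function.update dist w (dep p + 2)) lev idx := by
  classical
  refine ⟨H.pos, H.vtx_zero, H.dep_zero, H.node, H.mono, H.near, H.inj, ?_, ?_, ?_, H.idx_spec,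
    H.lev_max⟩
  · intro q hq
    by_cases e : vtx q = w
    · simp [e]
    · rw [Function.update_of_ne e]
      exact H.seen q hq
  · intro w' hw' e he
    by_cases e' : w' = w
    · subst e'
      rw [Function.update_self]
      by_contra hlt
      have hex : ∃ e, A.Walk v e w' := ⟨e, he⟩
      have hmin := Nat.find_min' hex he
      have hn : A.IsNode v h k w' (Nat.find hex) :=
        ⟨Nat.find_spec hex, by have := (H.node p hp).le_height; omega,
          fun e' he' => (Nat.find_min' hex he').trans (Nat.le_add_right _ _)⟩
      obtain ⟨q, hq, hv, -⟩ := H.exists_of_isNode hk (d := dep p)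
        (fun q hq hlt => by
          by_contra hqp
          have := H.mono p q (by omega) hq
          omega) (by omega) hn
      exact H.seen q hq (hv ▸ hw)
    · rw [Function.update_of_ne e'] at hw' ⊢
      exact H.dist_le w' hw' e he
  · intro w' hw'
    by_cases e' : w' = w
    · subst e'
      rw [Function.update_self]
      exact hwalk
    · rw [Function.update_of_ne e'] at hw' ⊢
      exact H.dist_walk w' hw'

/-- Since `dist w` is the exact distance plus one, the condition on all walks to `w` becomes a
single comparison. -/
theorem Queue.isNode_iff (H : Queue A v h k p N vtx dep dist lev idx) {w d : ℕ} (hw : dist w ≠ 0)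
    (hwalk : A.Walk v d w) (hd : d ≤ h) : A.IsNode v h k w d ↔ d + 1 ≤ dist w + k := by
  constructor
  · intro hn
    have := hn.le _ (H.dist_walk w hw)
    omega
  · intro hle
    refine ⟨hwalk, hd, fun e he => ?_⟩
    have := H.dist_le w hw e he
    omega

/-- It suffices to remember the deepest node of every vertex: no node found so far is deeper than
`dep p + 1`, so a node for `w` at this depth would have to be that one. This makes the test for
existing nodes take constant time. -/
theorem Queue.append (H : Queue A v h k p N vtx dep dist lev idx) (hp : p < N) {w : ℕ}
    (hw : dist w ≠ 0) (hn : A.IsNode v h k w (dep p + 1)) (hlev : lev w ≠ dep p + 1) :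
    Queue A v h k p (N + 1) (Function.update vtx N w) (Function.update dep N (dep p + 1)) dist
      (Function.update lev w (dep p + 1)) (Function.update idx w N) := by
  have hpos := H.pos
  have hpN : p ≠ N := hp.ne
  have hold : ∀ {q}, q < N + 1 → q ≠ N → q < N := fun h1 h2 => by omega
  have hfresh : ∀ q < N, vtx q = w → dep q ≠ dep p + 1 := by
    intro q hq hv hd
    have h1 := H.lev_max q hq
    rw [hv, hd] at h1
    have h2 := H.idx_spec w (by omega)
    have h3 := H.near _ h2.1 hp
    omega
  refine ⟨by omega, ?_, ?_, ?_, ?_, ?_, ?_, ?_, H.dist_le, H.dist_walk, ?_, ?_⟩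
  · rw [Function.update_of_ne hpos.ne]
    exact H.vtx_zero
  · rw [Function.update_of_ne hpos.ne]
    exact H.dep_zero
  · intro q hq
    by_cases e : q = N
    · subst e
      simpa using hn
    · rw [Function.update_of_ne e, Function.update_of_ne e]
      exact H.node q (hold hq e)
  · intro q q' hqq hq'
    by_cases e' : q' = N
    · subst e'
      by_cases e : q = q'
      · rw [e]
      · rw [Function.update_of_ne e, Function.update_self]
        exact H.near q (by omega) hp
    · have e : q ≠ N := by omega
      rw [Function.update_of_ne e, Function.update_of_ne e']
      exact H.mono q q' hqq (hold hq' e')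
  · intro q hq _
    rw [Function.update_of_ne hpN]
    by_cases e : q = N
    · subst e
      simp
    · rw [Function.update_of_ne e]
      exact H.near q (hold hq e) hp
  · intro q hq q' hq' hv hd
    by_cases e : q = N <;> by_cases e' : q' = N
    · rw [e, e']
    · rw [e, Function.update_self, Function.update_of_ne e'] at hv hd
      exact absurd hd.symm (hfresh q' (hold hq' e') hv.symm)
    · rw [e', Function.update_self, Function.update_of_ne e] at hv hd
      exact absurd hd (hfresh q (hold hq e) hv)
    · rw [Function.update_of_ne e, Function.update_of_ne e'] at hv hd
      exact H.inj q (hold hq e) q' (hold hq' e') hv hd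
  · intro q hq
    by_cases e : q = N
    · subst e
      simpa using hw
    · rw [Function.update_of_ne e]
      exact H.seen q (hold hq e)
  · intro w' hw'
    by_cases e : w' = w
    · subst e
      simp
    · rw [Function.update_of_ne e] at hw' ⊢
      rw [Function.update_of_ne e]
      obtain ⟨h1, h2, h3⟩ := H.idx_spec w' hw'
      rw [Function.update_of_ne h1.ne, Function.update_of_ne h1.ne]
      exact ⟨by omega, h2, h3⟩
  · intro q hq
    by_cases e : q = N
    · subst e
      simp
    · rw [Function.update_of_ne e, Function.update_of_ne e]
      by_cases e' : vtx q = w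
      · rw [e', Function.update_self]
        exact H.near q (hold hq e) hp
      · rw [Function.update_of_ne e']
        exact H.lev_max q (hold hq e)

theorem Queue.next (H : Queue A v h k p N vtx dep dist lev idx) (hp : p < N) :
    Queue A v h k (p + 1) N vtx dep dist lev idx := by
  refine ⟨H.pos, H.vtx_zero, H.dep_zero, H.node, H.mono, ?_, H.inj, H.seen, H.dist_le,
    H.dist_walk, H.idx_spec, H.lev_max⟩
  intro q hq hp'
  have h1 := H.near q hq hp
  have h2 := H.mono p (p + 1) (Nat.le_succ _) hp'
  omega

/-- The value 0 of `lev` also means that there is no node yet. This does not conflict with the root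
at depth 0, as only nodes of positive depth are looked up as children. -/
theorem Queue.start (A : AdjData) (v h k : ℕ) {vtx dep dist lev idx : ℕ → ℕ} (hv : vtx 0 = v)
    (hd : dep 0 = 0) (hdist : ∀ w, dist w = if w = v then 1 else 0) (hlev : ∀ w, lev w = 0) :
    Queue A v h k 0 1 vtx dep dist lev idx := by
  have hq0 : ∀ {q}, q < 1 → q = 0 := fun hq => by omega
  have hdv : ∀ w, dist w ≠ 0 → w = v ∧ dist w = 1 := by
    intro w hw
    rw [hdist] at hw ⊢
    by_cases e : w = v
    · simp [e]
    · simp [e] at hw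
  refine ⟨Nat.one_pos, hv, hd, ?_, ?_, ?_, ?_, ?_, ?_, ?_, ?_, ?_⟩
  · intro q hq
    rw [hq0 hq, hv, hd]
    exact ⟨rfl, Nat.zero_le _, fun _ _ => Nat.zero_le _⟩
  · intro q q' hqq hq'
    rw [hq0 hq', hq0 (lt_of_le_of_lt hqq hq')]
  · intro q hq _
    rw [hq0 hq]
    omega
  · intro q hq q' hq' _ _
    rw [hq0 hq, hq0 hq']
  · intro q hq
    rw [hq0 hq, hv, hdist, if_pos rfl]
    omega
  · intro w hw e _
    rw [(hdv w hw).2]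
    omega
  · intro w hw
    rw [(hdv w hw).2]
    exact (hdv w hw).1
  · intro w hw
    exact absurd (hlev w) hw
  · intro q hq
    rw [hq0 hq, hd]
    omega

end

/-- An enumeration of the nodes of a compressed neighborhood tree with their children. -/
structure IsTree (A : AdjData) (v h k N : ℕ) (vtx dep nc : ℕ → ℕ) (ch el : ℕ → ℕ → ℕ) : Prop where
  pos : 0 < N
  vtx_zero : vtx 0 = v
  dep_zero : dep 0 = 0
  node : ∀ q < N, A.IsNode v h k (vtx q) (dep q)
  inj : ∀ q < N, ∀ q' < N, vtx q = vtx q' → dep q = dep q' → q = q'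
  kids : ∀ q < N, Kids A v h k N vtx dep q (nc q) (A.deg (vtx q)) (ch q) (el q)
  exists_of_isNode : ∀ u d, A.IsNode v h k u d → ∃ q < N, vtx q = u ∧ dep q = d

theorem Queue.isTree {A : AdjData} {v h k N : ℕ} {vtx dep dist lev idx nc : ℕ → ℕ}
    {ch el : ℕ → ℕ → ℕ} (H : Queue A v h k N N vtx dep dist lev idx)
    (hk : ∀ q < N, Kids A v h k N vtx dep q (nc q) (A.deg (vtx q)) (ch q) (el q)) :
    IsTree A v h k N vtx dep nc ch el :=
  ⟨H.pos, H.vtx_zero, H.dep_zero, H.node, H.inj, hk, fun _ d hn =>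
    H.exists_of_isNode hk (d := d) (fun _ hq _ => hq) le_rfl hn⟩

end CNTCost

end

noncomputable section

namespace CNTCost

/-! ## Breadth first search as a program

The program is used for both graphs, with all names shifted by `g`.

Integer registers: `10` start vertex, `20` number of the search, `30` number of nodes, `40` current
node, `50` loop variable, `60` number of neighbors, `70` current vertex, `80` depth of the children,
`90` current neighbor, `100` number of children.
Integer arrays: `0`, `1`, `2` degrees, neighbors, and labels of the edges, `10` `dist`, `20` `lev`,
`30` `idx`, `40` vertices and `50` depths of the nodes, `60` numbers of children, `70` children,
`80` labels of the edges to the children. -/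

/-- The label of the current neighbor as an edge and its distance, if it is new. -/
def buildDiscover (g : ℕ) : Prog :=
  .nset (g + 90) (.arr (g + 1) (.var (g + 70)) (.var (g + 50))) ;;
  .ite (.neq (.arr (g + 10) (.var (g + 20)) (.var (g + 90))) (.const 0))
    (.nstore (g + 10) (.var (g + 20)) (.var (g + 90)) (.add (.var (g + 80)) (.const 1))) .skip

/-- A new node, unless it exists already. -/
def buildAppend (g : ℕ) : Prog :=
  .ite (.neq (.arr (g + 20) (.var (g + 20)) (.var (g + 90))) (.var (g + 80))) .skip
    (.nstore (g + 40) (.const 0) (.var (g + 30)) (.var (g + 90)) ;;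
     .nstore (g + 50) (.const 0) (.var (g + 30)) (.var (g + 80)) ;;
     .nstore (g + 20) (.var (g + 20)) (.var (g + 90)) (.var (g + 80)) ;;
     .nstore (g + 30) (.var (g + 20)) (.var (g + 90)) (.var (g + 30)) ;;
     .nset (g + 30) (.add (.var (g + 30)) (.const 1)))

/-- A new child of the current node. -/
def buildRecord (g : ℕ) : Prog :=
  .nstore (g + 70) (.var (g + 40)) (.var (g + 100)) (.arr (g + 30) (.var (g + 20)) (.var (g + 90))) ;;
  .nstore (g + 80) (.var (g + 40)) (.var (g + 100)) (.arr (g + 2) (.var (g + 70)) (.var (g + 50))) ;;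
  .nset (g + 100) (.add (.var (g + 100)) (.const 1))

/-- The treatment of a neighbor of the current node. -/
def buildStep (g : ℕ) : Prog :=
  buildDiscover g ;;
  .ite (.nlt (.add (.arr (g + 10) (.var (g + 20)) (.var (g + 90))) (.var 4))
      (.add (.var (g + 80)) (.const 1))) .skip
    (buildAppend g ;; buildRecord g)

/-- The treatment of a node. -/
def buildNode (g : ℕ) : Prog :=
  (.nset (g + 70) (.arr (g + 40) (.const 0) (.var (g + 40))) ;;
   .nset (g + 80) (.add (.arr (g + 50) (.const 0) (.var (g + 40))) (.const 1)) ;;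
   .nset (g + 100) (.const 0) ;;
   .nset (g + 60) (.arr g (.var (g + 70)) (.const 0))) ;;
  .ite (.nlt (.var 3) (.var (g + 80))) .skip (forTo (g + 50) (g + 60) (buildStep g)) ;;
  .nstore (g + 60) (.const 0) (.var (g + 40)) (.var (g + 100)) ;;
  .nset (g + 40) (.add (.var (g + 40)) (.const 1))

/-- The breadth first search. -/
def build (g : ℕ) : Prog :=
  (.nset (g + 30) (.const 1) ;;
   .nset (g + 40) (.const 0) ;;
   .nstore (g + 40) (.const 0) (.const 0) (.var (g + 10)) ;;
   .nstore (g + 50) (.const 0) (.const 0) (.const 0) ;;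
   .nstore (g + 10) (.var (g + 20)) (.var (g + 10)) (.const 1)) ;;
  .while (.nlt (.var (g + 40)) (.var (g + 30))) (buildNode g)

theorem buildStep_wn (g : ℕ) : (buildStep g).wn = [g + 90, g + 30, g + 100] := rfl
theorem buildStep_wna (g : ℕ) : (buildStep g).wna =
    [g + 10, g + 40, g + 50, g + 20, g + 30, g + 70, g + 80] := rfl
theorem buildNode_wn (g : ℕ) : (buildNode g).wn =
    [g + 70, g + 80, g + 100, g + 60, g + 50, g + 90, g + 30, g + 100, g + 50, g + 40] := rfl
theorem buildNode_wna (g : ℕ) : (buildNode g).wna =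
    [g + 10, g + 40, g + 50, g + 20, g + 30, g + 70, g + 80, g + 60] := rfl

/-! ### Correctness and running time of the breadth first search. -/

/-- The adjacency lists in memory. -/
def adjData (g : ℕ) (s : State) : AdjData := ⟨fun u => s.narr g u 0, s.narr (g + 1), s.narr (g + 2)⟩

/-- Queue and children of the processed nodes in the memory `s`. -/
structure Built (A : AdjData) (v h k g r p τ : ℕ) (s₀ s : State) : Prop where
  queue : Queue A v h k p (s.nvar (g + 30)) (s.narr (g + 40) 0) (s.narr (g + 50) 0)
    (s.narr (g + 10) r) (s.narr (g + 20) r) (s.narr (g + 30) r)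
  kids : ∀ q < p, Kids A v h k (s.nvar (g + 30)) (s.narr (g + 40) 0) (s.narr (g + 50) 0) q
    (s.narr (g + 60) 0 q) (A.deg (s.narr (g + 40) 0 q)) (s.narr (g + 70) q) (s.narr (g + 80) q)
  rows : ∀ r', r' ≠ r → s.narr (g + 10) r' = s₀.narr (g + 10) r' ∧
    s.narr (g + 20) r' = s₀.narr (g + 20) r'
  time : τ ≤ ∑ q ∈ Finset.range p, (130 * A.deg (s.narr (g + 40) 0 q) + 100)

/-- The state while the node `p` is processed. -/
structure Building (A : AdjData) (v h k g r p u d lim τ : ℕ) (s₀ s : State) : Prop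
    extends Built A v h k g r p τ s₀ s where
  lt : p < s.nvar (g + 30)
  vtx_eq : s.narr (g + 40) 0 p = u
  dep_eq : s.narr (g + 50) 0 p = d
  cur : Kids A v h k (s.nvar (g + 30)) (s.narr (g + 40) 0) (s.narr (g + 50) 0) p
    (s.nvar (g + 100)) lim (s.narr (g + 70) p) (s.narr (g + 80) p)

section

variable {A : AdjData} {v h k g r p u d lim τ : ℕ} {s₀ s : State}

theorem buildDiscover_runs (hB : Building A v h k g r p u d lim τ s₀ s) (hA : adjData g s = A)
    (hr : s.nvar (g + 20) = r) (hj : s.nvar (g + 50) = lim)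
    (hu : s.nvar (g + 70) = u) (hd : s.nvar (g + 80) = d + 1) (hlim : lim < A.deg u) :
    Runs (buildDiscover g) s 30 fun s' => Building A v h k g r p u d lim τ s₀ s' ∧
      s'.narr (g + 10) r (A.adj u lim) ≠ 0 ∧ s'.nvar (g + 90) = A.adj u lim := by
  have hadj : s.narr (g + 1) u lim = A.adj u lim := by rw [← hA]; rfl
  refine Runs.den_seq 20 rfl (fun f => ?_) (by simp [Prog.time, NExp.cost])
  set s₁ := (Prog.nset (g + 90) (.arr (g + 1) (.var (g + 70)) (.var (g + 50)))).den s with hs₁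
  have hw : s₁.nvar (g + 90) = A.adj u lim := by simp [hs₁, Prog.den, NExp.eval, hu, hj, hadj]
  have hr : s₁.nvar (g + 20) = r := by simp [hs₁, Prog.den, hr]
  have hd : s₁.nvar (g + 80) = d + 1 := by simp [hs₁, Prog.den, hd]
  have hB : Building A v h k g r p u d lim τ s₀ s₁ := by
    obtain ⟨⟨h1, h2, h3, h3'⟩, h4, h5, h6, h7⟩ := hB
    constructor
    · constructor <;> simpa [hs₁, Prog.den]
    all_goals simpa [hs₁, Prog.den]
  clear_value s₁
  refine Runs.ite 10 (fun hc => Runs.of_den rfl (by simp [Prog.time, NExp.cost]) fun _ => ?_)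
    (fun hc => Runs.of_den rfl (by simp [Prog.time]) fun _ => ?_) (by simp [BExp.cost, NExp.cost])
  · simp only [BExp.holds, NExp.eval, hr, hw] at hc
    have hwalk : A.Walk v (d + 1) (A.adj u lim) := by
      have := (hB.queue.node p hB.lt).walk
      rw [hB.vtx_eq, hB.dep_eq] at this
      exact ⟨u, this, lim, hlim, rfl⟩
    have hq := hB.queue.discover hB.lt hB.kids hc (by rw [hB.dep_eq]; exact hwalk)
    rw [hB.dep_eq] at hq
    obtain ⟨⟨h1, h2, h3, h3'⟩, h4, h5, h6, h7⟩ := hB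
    refine ⟨⟨⟨?_, ?_, fun r' hr' => ?_, ?_⟩, ?_, ?_, ?_, ?_⟩, ?_, ?_⟩
    · simpa [Prog.den, NExp.eval, upd_self, upd2_self, upd_of_ne, hr, hw, hd] using hq
    · simpa [Prog.den, NExp.eval, upd_of_ne] using h2
    · simpa [Prog.den, NExp.eval, upd_self, upd2_of_ne, upd_of_ne, hr, hr'] using h3 r' hr'
    · simpa [Prog.den, upd_of_ne] using h3'
    · simpa [Prog.den] using h4
    · simpa [Prog.den, upd_of_ne] using h5
    · simpa [Prog.den, upd_of_ne] using h6
    · simpa [Prog.den, upd_of_ne] using h7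
    · simp [Prog.den, NExp.eval, upd_self, upd2_self, hr, hw]
    · simpa [Prog.den] using hw
  · simp only [BExp.holds, NExp.eval, hr, hw] at hc
    exact ⟨hB, hc, hw⟩

theorem buildAppend_runs (hB : Building A v h k g r p u d lim τ s₀ s)
    (hr : s.nvar (g + 20) = r) {w : ℕ} (hw : s.nvar (g + 90) = w) (hd : s.nvar (g + 80) = d + 1)
    (hn : A.IsNode v h k w (d + 1)) (hdw : s.narr (g + 10) r w ≠ 0) :
    Runs (buildAppend g) s 50 fun s' => Building A v h k g r p u d lim τ s₀ s' ∧
      s'.narr (g + 20) r w = d + 1 := by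
  refine Runs.ite 30 (fun hc => Runs.of_den rfl (by simp [Prog.time]) fun _ => ?_)
    (fun hc => Runs.of_den rfl (by simp [Prog.time, NExp.cost]) fun _ => ?_)
    (by simp [BExp.cost, NExp.cost])
  · simp only [BExp.holds, NExp.eval, hr, hw, hd] at hc
    exact ⟨hB, hc⟩
  · simp only [BExp.holds, NExp.eval, hr, hw, hd] at hc
    have hq := hB.queue.append hB.lt hdw (by rwa [hB.dep_eq]) (by rwa [hB.dep_eq])
    rw [hB.dep_eq] at hq
    have hext : ∀ q ≤ p, ∀ c lim ch el, Kids A v h k (s.nvar (g + 30)) (s.narr (g + 40) 0)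
        (s.narr (g + 50) 0) q c lim ch el → Kids A v h k (s.nvar (g + 30) + 1)
        (Function.update (s.narr (g + 40) 0) (s.nvar (g + 30)) w)
        (Function.update (s.narr (g + 50) 0) (s.nvar (g + 30)) (d + 1)) q c lim ch el := by
      intro q hq c lim ch el hk
      exact hk.congr (hq.trans_lt hB.lt) (Nat.le_succ _)
        (fun q' hq' => Function.update_of_ne hq'.ne _ _)
        (fun q' hq' => Function.update_of_ne hq'.ne _ _) (fun _ _ => rfl) (fun _ _ => rfl)
    have hv : ∀ q ≤ p, Function.update (s.narr (g + 40) 0) (s.nvar (g + 30)) w q =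
        s.narr (g + 40) 0 q := fun q hq =>
      Function.update_of_ne (hq.trans_lt hB.lt).ne _ _
    obtain ⟨⟨h1, h2, h3, h3'⟩, h4, h5, h6, h7⟩ := hB
    refine ⟨⟨⟨?_, fun q hq => ?_, fun r' hr' => ?_, ?_⟩, ?_, ?_, ?_, ?_⟩, ?_⟩
    · simpa [Prog.den, NExp.eval, upd_self, upd2_self, upd_of_ne, hr, hw, hd] using hq
    · have := hext q hq.le _ _ _ _ (h2 q hq)
      rw [← hv q hq.le] at this
      simpa [Prog.den, NExp.eval, upd_self, upd2_self, upd_of_ne, hw, hd] using this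
    · simpa [Prog.den, NExp.eval, upd_self, upd2_of_ne, upd_of_ne, hr, hr'] using h3 r' hr'
    · refine h3'.trans (le_of_eq (Finset.sum_congr rfl fun q hq => ?_))
      rw [← hv q (Finset.mem_range.1 hq).le]
      simp [Prog.den, NExp.eval, upd_self, upd2_self, upd_of_ne, hw]
    · simpa [Prog.den, NExp.eval] using Nat.lt_succ_of_lt h4
    · simpa [Prog.den, NExp.eval, upd_self, upd2_self, upd_of_ne, hw, h4.ne] using h5
    · simpa [Prog.den, NExp.eval, upd_self, upd2_self, upd_of_ne, hd, h4.ne] using h6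
    · simpa [Prog.den, NExp.eval, upd_self, upd2_self, upd_of_ne, hw, hd] using
        hext p le_rfl _ _ _ _ h7
    · simp [Prog.den, NExp.eval, upd_self, upd2_self, upd_of_ne, hw, hd, hr]

theorem buildRecord_runs (hB : Building A v h k g r p u d lim τ s₀ s) (hA : adjData g s = A)
    (hinj : ∀ j < lim, A.adj u j ≠ A.adj u lim)
    (hr : s.nvar (g + 20) = r) (hp : s.nvar (g + 40) = p) (hj : s.nvar (g + 50) = lim)
    (hu : s.nvar (g + 70) = u) (hw : s.nvar (g + 90) = A.adj u lim)
    (hlev : s.narr (g + 20) r (A.adj u lim) = d + 1) :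
    Runs (buildRecord g) s 20 fun s' => Building A v h k g r p u d (lim + 1) τ s₀ s' := by
  refine Runs.of_den rfl (by simp [buildRecord, Prog.time, NExp.cost]) fun _ => ?_
  have hlab : s.narr (g + 2) u lim = A.lab u lim := by rw [← hA]; rfl
  obtain ⟨h1, h2, h3⟩ := hB.queue.idx_spec (A.adj u lim) (by omega)
  rw [hlev] at h3
  have hk := hB.cur.record (x := s.narr (g + 30) r (A.adj u lim)) ?_ h1
    (by rw [h2, hB.vtx_eq]) (by rw [h3, hB.dep_eq]) (by rwa [hB.vtx_eq])
  · rw [hB.vtx_eq] at hk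
    obtain ⟨⟨h1, h2, h3, h3'⟩, h4, h5, h6, h7⟩ := hB
    refine ⟨⟨?_, fun q hq => ?_, fun r' hr' => ?_, ?_⟩, ?_, ?_, ?_, ?_⟩
    · simpa [buildRecord, Prog.den, NExp.eval, upd_of_ne] using h1
    · simpa [buildRecord, Prog.den, NExp.eval, upd_of_ne, upd_self, hp, upd2_of_ne, hq.ne] using h2 q hq
    · simpa [buildRecord, Prog.den, NExp.eval, upd_of_ne] using h3 r' hr'
    · simpa [buildRecord, Prog.den, NExp.eval, upd_of_ne] using h3'
    · simpa [buildRecord, Prog.den, NExp.eval] using h4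
    · simpa [buildRecord, Prog.den, NExp.eval, upd_of_ne] using h5
    · simpa [buildRecord, Prog.den, NExp.eval, upd_of_ne] using h6
    · simpa [buildRecord, Prog.den, NExp.eval, upd_of_ne, upd_self, upd2_self, hp, hr, hw, hu, hj, hlab] using hk
  -- Depths are monotone in the order of discovery, so a child, which is deeper than `p`, has a
  -- larger index. Hence the indices are a topological order of the graph.
  · by_contra hlt
    have := hB.queue.mono _ _ (not_lt.1 hlt) hB.lt
    rw [h3, hB.dep_eq] at this
    omega

theorem buildStep_runs (hB : Building A v h k g r p u d lim τ s₀ s) (hA : adjData g s = A)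
    (hinj : ∀ j < lim, A.adj u j ≠ A.adj u lim) (hk : s.nvar 4 = k)
    (hr : s.nvar (g + 20) = r) (hp : s.nvar (g + 40) = p) (hj : s.nvar (g + 50) = lim)
    (hu : s.nvar (g + 70) = u) (hd : s.nvar (g + 80) = d + 1) (hlim : lim < A.deg u)
    (hdh : d + 1 ≤ h) :
    Runs (buildStep g) s 120 fun s' => Building A v h k g r p u d (lim + 1) τ s₀ s' := by
  refine Runs.seq 30 90 (buildDiscover_runs hB hA hr hj hu hd hlim) ?_ le_rfl
  rintro s₁ f ⟨hB, hdw, hw⟩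
  have hA : adjData g s₁ = A := by
    rw [← hA]
    simp [adjData, f.na, buildDiscover, Prog.wna]
  have hk : s₁.nvar 4 = k := by rw [f.nv _ (by simp [buildDiscover, Prog.wn]), hk]
  have hr : s₁.nvar (g + 20) = r := by rw [f.nv _ (by simp [buildDiscover, Prog.wn]), hr]
  have hp : s₁.nvar (g + 40) = p := by rw [f.nv _ (by simp [buildDiscover, Prog.wn]), hp]
  have hj : s₁.nvar (g + 50) = lim := by rw [f.nv _ (by simp [buildDiscover, Prog.wn]), hj]
  have hu : s₁.nvar (g + 70) = u := by rw [f.nv _ (by simp [buildDiscover, Prog.wn]), hu]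
  have hd : s₁.nvar (g + 80) = d + 1 := by rw [f.nv _ (by simp [buildDiscover, Prog.wn]), hd]
  clear f
  have hwalk : A.Walk v (d + 1) (A.adj u lim) := by
    have := (hB.queue.node p hB.lt).walk
    rw [hB.vtx_eq, hB.dep_eq] at this
    exact ⟨u, this, lim, hlim, rfl⟩
  have hiff := hB.queue.isNode_iff hdw hwalk hdh
  refine Runs.ite 70 (fun hc => Runs.of_den rfl (by simp [Prog.time]) fun _ => ?_)
    (fun hc => ?_) (by simp [BExp.cost, NExp.cost])
  · simp only [BExp.holds, NExp.eval, hr, hw, hk, hd] at hc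
    refine ⟨hB.toBuilt, hB.lt, hB.vtx_eq, hB.dep_eq, hB.cur.skip ?_⟩
    rw [hB.vtx_eq, hB.dep_eq, hiff]
    omega
  · simp only [BExp.holds, NExp.eval, hr, hw, hk, hd] at hc
    have hn := hiff.2 (by omega)
    refine Runs.seq 50 20 (buildAppend_runs hB hr hw hd hn hdw) ?_ le_rfl
    rintro s₂ f ⟨hB, hlev⟩
    refine buildRecord_runs hB ?_ hinj ?_ ?_ ?_ ?_ ?_ hlev
    · rw [← hA]
      simp [adjData, f.na, buildAppend, Prog.wna]
    all_goals rwa [f.nv _ (by simp [buildAppend, Prog.wn])]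

theorem buildNode_runs (hB : Built A v h k g r p τ s₀ s) (hA : adjData g s = A)
    (hinj : ∀ u, ∀ j < A.deg u, ∀ j' < A.deg u, A.adj u j = A.adj u j' → j = j')
    (hh : s.nvar 3 = h) (hk : s.nvar 4 = k) (hr : s.nvar (g + 20) = r) (hp : s.nvar (g + 40) = p)
    (hlt : p < s.nvar (g + 30)) :
    Runs (buildNode g) s (130 * A.deg (s.narr (g + 40) 0 p) + 60) fun s' =>
      Built A v h k g r (p + 1) (τ + (130 * A.deg (s.narr (g + 40) 0 p) + 100)) s₀ s' ∧
      s'.nvar (g + 40) = p + 1 ∧ p < s'.nvar (g + 30) := by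
  set u := s.narr (g + 40) 0 p with hu
  set d := s.narr (g + 50) 0 p with hd
  have hdeg : s.narr g u 0 = A.deg u := by rw [← hA]; rfl
  refine Runs.den_seq (130 * A.deg u + 40) rfl (fun f => ?_)
    (by simp only [Prog.time, NExp.cost]; omega)
  set s₁ := (Prog.nset (g + 70) (.arr (g + 40) (.const 0) (.var (g + 40))) ;;
   .nset (g + 80) (.add (.arr (g + 50) (.const 0) (.var (g + 40))) (.const 1)) ;;
   .nset (g + 100) (.const 0) ;;
   .nset (g + 60) (.arr g (.var (g + 70)) (.const 0))).den s with hs₁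
  have e70 : s₁.nvar (g + 70) = u := by simp [hs₁, Prog.den, NExp.eval, hp, hu]
  have e80 : s₁.nvar (g + 80) = d + 1 := by simp [hs₁, Prog.den, NExp.eval, hp, hd]
  have e60 : s₁.nvar (g + 60) = A.deg u := by
    simp [hs₁, Prog.den, NExp.eval, hp, ← hu, hdeg]
  have e40 : s₁.nvar (g + 40) = p := by simp [hs₁, Prog.den, hp]
  have e20 : s₁.nvar (g + 20) = r := by simp [hs₁, Prog.den, hr]
  have e3 : s₁.nvar 3 = h := by simp [hs₁, Prog.den, hh]
  have e4 : s₁.nvar 4 = k := by simp [hs₁, Prog.den, hk]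
  have hA : adjData g s₁ = A := hA
  have hB : Building A v h k g r p u d 0 τ s₀ s₁ := by
    obtain ⟨h1, h2, h3, h4⟩ := hB
    refine ⟨⟨?_, ?_, ?_, ?_⟩, ?_, rfl, rfl, ⟨?_, ?_, ?_, ?_⟩⟩
    · simpa [hs₁, Prog.den] using h1
    · simpa [hs₁, Prog.den] using h2
    · simpa [hs₁, Prog.den] using h3
    · simpa [hs₁, Prog.den] using h4
    · simpa [hs₁, Prog.den] using hlt
    all_goals simp [hs₁, Prog.den, NExp.eval]
  clear_value s₁ u d
  clear f hu hd
  refine Runs.seq (Q' := fun s' => Building A v h k g r p u d (A.deg u) τ s₀ s')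
    (130 * A.deg u + 20) 20 (Runs.ite (130 * A.deg u + 10) (fun hc => ?_) (fun hc => ?_)
      (by simp only [BExp.cost, NExp.cost]; omega)) ?_ le_rfl
  · simp only [BExp.holds, NExp.eval, e3, e80] at hc
    refine Runs.of_den rfl (by simp only [Prog.time]; omega) fun _ => ?_
    -- The node lies at the greatest admissible depth, so the empty list of children is already
    -- complete for all neighbors.
    refine ⟨hB.toBuilt, hB.lt, hB.vtx_eq, hB.dep_eq, Nat.zero_le _ |>.trans' hB.cur.le,
      fun i hi => ?_, hB.cur.inj, fun j _ hn => ?_⟩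
    · exact absurd hi (by have := hB.cur.le; simp only [Prog.den]; omega)
    · have := hn.le_height
      simp only [Prog.den, hB.dep_eq] at this
      omega
  · simp only [BExp.holds, NExp.eval, e3, e80] at hc
    refine Runs.forTo_const (fun i s' => Building A v h k g r p u d i τ s₀ s') (A.deg u) 120 e60
      (by simp) (by simp [buildStep_wn]) (by simp [buildStep_wn]) ?_ ?_ (by omega)
    · obtain ⟨⟨h1, h2, h3, h3'⟩, h4, h5, h6, h7⟩ := hB
      constructor
      · constructor <;> simpa [State.setN]
      all_goals simpa [State.setN]
    · intro i hi s' f hx hI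
      refine (buildStep_runs hI ?_ ?_ ?_ ?_ ?_ hx ?_ ?_ hi (by omega)).mono le_rfl ?_
      · rw [← hA]
        simp [adjData, f.na, forTo, Prog.wna, buildStep_wna]
      · intro j hj e
        exact hj.ne (hinj u j (hj.trans hi) i hi e)
      · rw [f.nv _ (by simp [forTo, Prog.wn, buildStep_wn]), e4]
      · rw [f.nv _ (by simp [forTo, Prog.wn, buildStep_wn]), e20]
      · rw [f.nv _ (by simp [forTo, Prog.wn, buildStep_wn]), e40]
      · rw [f.nv _ (by simp [forTo, Prog.wn, buildStep_wn]), e70]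
      · rw [f.nv _ (by simp [forTo, Prog.wn, buildStep_wn]), e80]
      · rintro s'' - ⟨⟨h1, h2, h3, h3'⟩, h4, h5, h6, h7⟩
        constructor
        · constructor <;> simpa [State.setN]
        all_goals simpa [State.setN]
  · rintro s₂ f hB
    have e40 : s₂.nvar (g + 40) = p := by
      rw [f.nv _ (by simp [forTo, Prog.wn, buildStep_wn]), e40]
    refine Runs.of_den rfl (by simp [Prog.time, NExp.cost]) fun _ => ?_
    have hq := hB.queue.next hB.lt
    have hcur := hB.cur
    obtain ⟨⟨h1, h2, h3, h3'⟩, h4, h5, h6, h7⟩ := hB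
    refine ⟨⟨?_, fun q hq => ?_, ?_, ?_⟩, ?_, ?_⟩
    · simpa [Prog.den, upd_of_ne] using hq
    · rcases Nat.lt_succ_iff_lt_or_eq.1 hq with hq | rfl
      · simpa [Prog.den, NExp.eval, upd_self, upd2_self, upd_of_ne, e40, hq.ne] using h2 q hq
      · simpa [Prog.den, NExp.eval, upd_self, upd2_self, upd_of_ne, e40, h5] using hcur
    · simpa [Prog.den, upd_of_ne] using h3
    · simp only [Prog.den, ne_eq, Nat.add_left_cancel_iff, Nat.reduceEqDiff, not_false_eq_true,
        upd_of_ne]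
      rw [Finset.sum_range_succ, h5]
      omega
    · simp [Prog.den, NExp.eval, e40]
    · simpa [Prog.den] using h4

/-- The breadth first search enumerates the nodes of the compressed neighborhood tree, in a time
that is bounded in terms of a bound on the total degree of the nodes. -/
theorem build_runs (s : State) {B : ℕ} (hA : adjData g s = A)
    (hinj : ∀ u, ∀ j < A.deg u, ∀ j' < A.deg u, A.adj u j = A.adj u j' → j = j')
    (hh : s.nvar 3 = h) (hk : s.nvar 4 = k) (hr : s.nvar (g + 20) = r) (hv : s.nvar (g + 10) = v)
    (hdist : ∀ w, s.narr (g + 10) r w = 0) (hlev : ∀ w, s.narr (g + 20) r w = 0)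
    (hbound : ∀ (N : ℕ) (vtx dep : ℕ → ℕ), (∀ q < N, A.IsNode v h k (vtx q) (dep q)) →
      (∀ q < N, ∀ q' < N, vtx q = vtx q' → dep q = dep q' → q = q') →
      ∑ q ∈ Finset.range N, (A.deg (vtx q) + 1) ≤ B) :
    Runs (build g) s (130 * B + 40) fun s' =>
      IsTree A v h k (s'.nvar (g + 30)) (s'.narr (g + 40) 0) (s'.narr (g + 50) 0)
        (s'.narr (g + 60) 0) (s'.narr (g + 70)) (s'.narr (g + 80)) ∧
      ∀ r', r' ≠ r → s'.narr (g + 10) r' = s.narr (g + 10) r' ∧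
        s'.narr (g + 20) r' = s.narr (g + 20) r' := by
  refine Runs.den_seq (130 * B + 10) rfl (fun f => ?_)
    (by simp only [Prog.time, NExp.cost]; omega)
  set s₁ := (Prog.nset (g + 30) (.const 1) ;;
   .nset (g + 40) (.const 0) ;;
   .nstore (g + 40) (.const 0) (.const 0) (.var (g + 10)) ;;
   .nstore (g + 50) (.const 0) (.const 0) (.const 0) ;;
   .nstore (g + 10) (.var (g + 20)) (.var (g + 10)) (.const 1)).den s with hs₁
  have e40 : s₁.nvar (g + 40) = 0 := by simp [hs₁, Prog.den, NExp.eval]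
  have e20 : s₁.nvar (g + 20) = r := by simp [hs₁, Prog.den, hr]
  have e3 : s₁.nvar 3 = h := by simp [hs₁, Prog.den, hh]
  have e4 : s₁.nvar 4 = k := by simp [hs₁, Prog.den, hk]
  have hA : adjData g s₁ = A := by
    rw [← hA]
    simp [adjData, f.na, Prog.wna]
  have hB : Built A v h k g r 0 0 s s₁ := by
    refine ⟨?_, by simp, fun r' hr' => ?_, by simp⟩
    · have e30 : s₁.nvar (g + 30) = 1 := by simp [hs₁, Prog.den, NExp.eval]
      rw [e30]
      apply Queue.start
      · simp [hs₁, Prog.den, NExp.eval, upd_self, upd2_self, upd_of_ne, hv]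
      · simp [hs₁, Prog.den, NExp.eval, upd_self, upd2_self, upd_of_ne]
      · intro w
        simp [hs₁, Prog.den, NExp.eval, upd_self, upd2_self, upd_of_ne, hr, hv,
          Function.update_apply, hdist]
      · intro w
        simp [hs₁, Prog.den, upd_of_ne, hlev]
    · simp [hs₁, Prog.den, NExp.eval, upd_self, upd_of_ne, upd2_of_ne, hr, hr']
  clear_value s₁
  refine (Runs.while_of_bounded (B := 130 * B) (I := fun τ s' => ∃ p, s'.nvar (g + 40) = p ∧
    p ≤ s'.nvar (g + 30) ∧ Built A v h k g r p τ s s') ?_ ?_ ?_ ?_).mono le_rfl ?_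
  · exact ⟨0, e40, Nat.zero_le _, hB⟩
  · rintro τ s' ⟨p, -, hp, hB⟩
    refine hB.time.trans ?_
    -- The processed nodes form a list of distinct nodes, so their total degree is bounded while the
    -- search is still running. This is what shows that the search terminates.
    have h1 := hbound p (s'.narr (g + 40) 0) (s'.narr (g + 50) 0)
      (fun q hq => hB.queue.node q (hq.trans_le hp))
      (fun q hq q' hq' => hB.queue.inj q (hq.trans_le hp) q' (hq'.trans_le hp))
    refine le_trans ?_ (Nat.mul_le_mul_left 130 h1)
    rw [Finset.mul_sum]
    exact Finset.sum_le_sum fun q _ => by omega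
  · rintro τ s' f ⟨p, hp, hpN, hB⟩ hc
    simp only [BExp.holds, NExp.eval, hp] at hc
    have hA : adjData g s' = A := by
      rw [← hA]
      simp [adjData, f.na, Prog.wna, buildNode_wna]
    refine ⟨_, (buildNode_runs hB hA hinj ?_ ?_ ?_ hp hc).mono le_rfl ?_⟩
    · rw [f.nv _ (by simp [Prog.wn, buildNode_wn]), e3]
    · rw [f.nv _ (by simp [Prog.wn, buildNode_wn]), e4]
    · rw [f.nv _ (by simp [Prog.wn, buildNode_wn]), e20]
    · rintro s'' - ⟨hB', hp', hlt⟩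
      refine ⟨p + 1, hp', hlt, hB'.queue, hB'.kids, hB'.rows, le_trans ?_ hB'.time⟩
      simp only [BExp.cost, NExp.cost]
      omega
  · simp only [BExp.cost, NExp.cost]
    omega
  · rintro s' - ⟨⟨τ, p, hp, hpN, hB⟩, hc⟩
    simp only [BExp.holds, NExp.eval, hp, not_lt] at hc
    have e : p = s'.nvar (g + 30) := le_antisymm hpN hc
    subst e
    exact ⟨hB.queue.isTree hB.kids, hB.rows⟩

end

end CNTCost

end

noncomputable section

namespace CNTCost

/-! ## The tree edit distance of trees presented by layered graphs -/

/-- The tree `T` unfolds the graph with nodes `0, …, N - 1`, where `φ u` is the node of the graph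
corresponding to the node `u` of the tree, and `idx u` is its index among its siblings. -/
structure Presents {L : ℕ} (T : RootedTree (Fin L)) (N : ℕ) (dep vl nc : ℕ → ℕ) (ch el : ℕ → ℕ → ℕ)
    (φ idx : T.Node → ℕ) : Prop where
  root : φ T.root = 0
  lt : ∀ u, φ u < N
  depth : ∀ u, T.depth u = dep (φ u)
  vlabel : ∀ u, (T.vlabel u : ℕ) = vl (φ u)
  idx_lt : ∀ u, u ≠ T.root → idx u < nc (φ (T.parent u))
  child : ∀ u, u ≠ T.root → φ u = ch (φ (T.parent u)) (idx u)
  elabel : ∀ u, u ≠ T.root → (T.elabel u : ℕ) = el (φ (T.parent u)) (idx u)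
  ex : ∀ u, ∀ i < nc (φ u), ∃ w, w ≠ T.root ∧ T.parent w = u ∧ idx w = i
  inj : ∀ w w', w ≠ T.root → w' ≠ T.root → T.parent w = T.parent w' → idx w = idx w' → w = w'

/-- `S p` is the cost of deleting all proper descendants of `p`, and `E p i` is the cost of deleting
the subtree of the child of `p` with the index `i`, where `vd` and `ed` are the costs of deleting
vertices and edges. -/
structure SubtreeCosts (N : ℕ) (dep vl nc : ℕ → ℕ) (ch el : ℕ → ℕ → ℕ) (lam vd ed : ℕ → ℝ)
    (E : ℕ → ℕ → ℝ) (S : ℕ → ℝ) : Prop where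
  subtree : ∀ p < N, ∀ i < nc p,
    E p i = lam (dep (ch p i)) * (vd (vl (ch p i)) + ed (el p i)) + S (ch p i)
  sum : ∀ p < N, S p = ∑ i ∈ Finset.range (nc p), E p i

/-- The weights of the matchings of the children of the nodes `p` and `q`, where `F` is the matrix
of distances of subtrees. -/
def childWeight (dep : ℕ → ℕ) (ch ch' el el' : ℕ → ℕ → ℕ) (lam : ℕ → ℝ) (es E E' F : ℕ → ℕ → ℝ)
    (p q i j : ℕ) : ℝ :=
  lam (dep (ch p i)) * es (el p i) (el' q j) + F (ch p i) (ch' q j) - E p i - E' q j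

section

variable {L : ℕ} {T : RootedTree (Fin L)} {N : ℕ} {dep vl nc : ℕ → ℕ} {ch el : ℕ → ℕ → ℕ}
  {φ idx : T.Node → ℕ} {lam vd ed : ℕ → ℝ} {E : ℕ → ℕ → ℝ} {S : ℕ → ℝ}

open scoped Classical in
theorem Presents.sum_children (P : Presents T N dep vl nc ch el φ idx) (f : ℕ → ℝ) (u : T.Node) :
    ∑ w with w ≠ T.root ∧ T.parent w = u, f (idx w) = ∑ i ∈ Finset.range (nc (φ u)), f i := by
  refine Finset.sum_bij (fun w _ => idx w) ?_ ?_ ?_ (fun _ _ => rfl)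
  · intro w hw
    obtain ⟨h1, rfl⟩ := (Finset.mem_filter.1 hw).2
    exact Finset.mem_range.2 (P.idx_lt w h1)
  · intro w hw w' hw' e
    obtain ⟨h1, h2⟩ := (Finset.mem_filter.1 hw).2
    obtain ⟨h3, h4⟩ := (Finset.mem_filter.1 hw').2
    exact P.inj w w' h1 h3 (h2.trans h4.symm) e
  · intro i hi
    obtain ⟨w, h1, h2, h3⟩ := P.ex u i (Finset.mem_range.1 hi)
    exact ⟨w, by simp [h1, h2], h3⟩

open scoped Classical in
/-- The cost of deleting the subtree of a node, or zero for the root. -/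
def subtreeCost (T : RootedTree (Fin L)) (φ idx : T.Node → ℕ) (E : ℕ → ℕ → ℝ) (u : T.Node) : ℝ :=
  if u = T.root then 0 else E (φ (T.parent u)) (idx u)

open scoped Classical in
-- The cost of deleting a single node is the cost of its subtree minus that of its proper
-- descendants, so it equals `subtreeCost` minus `S`. Summed over the whole tree, `S` equals
-- `subtreeCost`, because `S` collects the subtrees of the children. Thus the sum over the unmatched
-- nodes is expressed by the matched ones.
theorem Presents.sum_unmatched (P : Presents T N dep vl nc ch el φ idx)
    (C : SubtreeCosts N dep vl nc ch el lam vd ed E S) {vd' ed' : Fin L → ℝ}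
    (hvd : ∀ a : Fin L, vd a = vd' a) (hed : ∀ a : Fin L, ed a = ed' a) (U : Finset T.Node)
    (hU : T.root ∉ U) :
    ∑ u ∈ U, lam (T.depth u) *
        (vd' (T.vlabel u) + if u = T.root then 0 else ed' (T.elabel u)) =
      ∑ u ∈ Uᶜ, (S (φ u) - subtreeCost T φ idx E u) := by
  have h1 : ∑ u, S (φ u) = ∑ u, subtreeCost T φ idx E u := by
    have h2 : ∀ u, S (φ u) =
        ∑ w with w ≠ T.root ∧ T.parent w = u, subtreeCost T φ idx E w := by
      intro u
      rw [C.sum _ (P.lt u), ← P.sum_children]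
      refine Finset.sum_congr rfl fun w hw => ?_
      obtain ⟨h1, rfl⟩ := (Finset.mem_filter.1 hw).2
      simp [subtreeCost, h1]
    have h3 : ∑ w with w ≠ T.root, subtreeCost T φ idx E w = ∑ u, subtreeCost T φ idx E u := by
      rw [Finset.sum_filter]
      refine Finset.sum_congr rfl fun w _ => ?_
      by_cases e : w = T.root
      · simp [e, subtreeCost]
      · simp [e]
    rw [← h3, ← Finset.sum_fiberwise_of_maps_to (s := Finset.univ.filter fun w => w ≠ T.root)
      (t := Finset.univ) (g := T.parent) (fun _ _ => Finset.mem_univ _)]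
    refine Finset.sum_congr rfl fun u _ => ?_
    rw [h2, Finset.filter_filter]
  have h2 : ∑ u, (S (φ u) - subtreeCost T φ idx E u) = 0 := by
    rw [Finset.sum_sub_distrib, h1, sub_self]
  rw [← Finset.sum_add_sum_compl U] at h2
  have h3 : ∑ u ∈ U, lam (T.depth u) *
        (vd' (T.vlabel u) + if u = T.root then 0 else ed' (T.elabel u)) =
      - ∑ u ∈ U, (S (φ u) - subtreeCost T φ idx E u) := by
    rw [← Finset.sum_neg_distrib]
    refine Finset.sum_congr rfl fun u hu => ?_
    have hr : u ≠ T.root := fun e => hU (e ▸ hu)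
    have := C.subtree _ (P.lt (T.parent u)) _ (P.idx_lt u hr)
    rw [← P.child u hr, ← P.elabel u hr, ← P.vlabel, ← P.depth, hvd, hed] at this
    simp only [subtreeCost, hr, if_false, this]
    ring
  linarith

end

/-! ### The recurrence for the edit distance. -/

section

variable {L : ℕ} {T T' : RootedTree (Fin L)} {N N' : ℕ} {dep vl nc dep' vl' nc' : ℕ → ℕ}
  {ch el ch' el' : ℕ → ℕ → ℕ} {φ idx : T.Node → ℕ} {φ' idx' : T'.Node → ℕ}
  {lam vd ed vi ei : ℕ → ℝ} {vs es : ℕ → ℕ → ℝ} {E E' F m : ℕ → ℕ → ℝ} {S S' : ℕ → ℝ}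
  {c : EditCosts L} {M : Finset (T.Node × T'.Node)}

theorem IsSDM.root_iff (h : IsSDM T T' M) {p : T.Node × T'.Node} (hp : p ∈ M) :
    p.1 = T.root ↔ p.2 = T'.root :=
  h.inj p hp _ h.root_mem

open scoped Classical in
/-- The cost of a mapping in terms of the weights of the matchings of children it induces. -/
theorem IsSDM.mappingCost_eq (h : IsSDM T T' M) (P : Presents T N dep vl nc ch el φ idx)
    (P' : Presents T' N' dep' vl' nc' ch' el' φ' idx')
    (C : SubtreeCosts N dep vl nc ch el lam vd ed E S)
    (C' : SubtreeCosts N' dep' vl' nc' ch' el' lam vi ei E' S')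
    (hvd : ∀ a : Fin L, vd a = c.vdel a) (hed : ∀ a : Fin L, ed a = c.edel a)
    (hvi : ∀ a : Fin L, vi a = c.vins a) (hei : ∀ a : Fin L, ei a = c.eins a)
    (hvs : ∀ a b : Fin L, vs a b = c.vsub a b) (hes : ∀ a b : Fin L, es a b = c.esub a b)
    (hF : ∀ p < N, ∀ q < N', F p q = lam (dep p) * vs (vl p) (vl' q) + S p + S' q + m p q) :
    mappingCost c T T' lam M = F 0 0 + ∑ p ∈ M,
      (∑ w ∈ M with w.1 ≠ T.root ∧ (T.parent w.1, T'.parent w.2) = p,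
        childWeight dep ch ch' el el' lam es E E' F (φ p.1) (φ' p.2) (idx w.1) (idx' w.2) -
        m (φ p.1) (φ' p.2)) := by
  -- The nodes that are not deleted are the first components of `M`, each occurring once.
  have h1 : ∑ u with ∀ u', (u, u') ∉ M, lam (T.depth u) * nodeDelCost c T u =
      ∑ p ∈ M, (S (φ p.1) - subtreeCost T φ idx E p.1) := by
    have := P.sum_unmatched C hvd hed (Finset.univ.filter fun u => ∀ u', (u, u') ∉ M)
      (by simpa using ⟨_, h.root_mem⟩)
    simp only [nodeDelCost]
    rw [this, ← Finset.sum_image (f := fun u => S (φ u) - subtreeCost T φ idx E u)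
      (g := Prod.fst) (s := M)]
    · refine Finset.sum_congr ?_ fun _ _ => rfl
      ext u
      simp
    · intro p hp q hq e
      exact Prod.ext e ((h.inj p hp q hq).1 e)
  have h2 : ∑ u' with ∀ u, (u, u') ∉ M, lam (T'.depth u') * nodeInsCost c T' u' =
      ∑ p ∈ M, (S' (φ' p.2) - subtreeCost T' φ' idx' E' p.2) := by
    have := P'.sum_unmatched C' hvi hei (Finset.univ.filter fun u' => ∀ u, (u, u') ∉ M)
      (by simpa using ⟨_, h.root_mem⟩)
    simp only [nodeInsCost]
    rw [this, ← Finset.sum_image (f := fun u => S' (φ' u) - subtreeCost T' φ' idx' E' u)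
      (g := Prod.snd) (s := M)]
    · refine Finset.sum_congr ?_ fun _ _ => rfl
      ext u
      simp
    · intro p hp q hq e
      exact Prod.ext ((h.inj p hp q hq).2 e) e
  set X : T.Node × T'.Node → ℝ := fun w =>
    childWeight dep ch ch' el el' lam es E E' F (φ (T.parent w.1)) (φ' (T'.parent w.2)) (idx w.1)
      (idx' w.2) with hX
  -- Every pair contributes `F - m` for itself. A pair other than the roots also contributes its
  -- weight as a pair of children, minus `F`.
  have h3 : ∀ p ∈ M, lam (T.depth p.1) * relabelCost c T T' p.1 p.2 +
      (S (φ p.1) - subtreeCost T φ idx E p.1) + (S' (φ' p.2) - subtreeCost T' φ' idx' E' p.2) =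
      F (φ p.1) (φ' p.2) - m (φ p.1) (φ' p.2) +
        if p.1 = T.root then 0 else X p - F (φ p.1) (φ' p.2) := by
    intro p hp
    have hFp := hF _ (P.lt p.1) _ (P'.lt p.2)
    rw [← P.depth, ← P.vlabel, ← P'.vlabel, hvs] at hFp
    by_cases e : p.1 = T.root
    · have e' := (h.root_iff hp).1 e
      simp only [relabelCost, subtreeCost, e, e', if_true] at hFp ⊢
      linarith
    · have e' : ¬ p.2 = T'.root := fun e' => e ((h.root_iff hp).2 e')
      simp only [relabelCost, subtreeCost, e, e', if_false, hX, childWeight]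
      rw [← P.child _ e, ← P'.child _ e', ← P.depth, ← P.elabel _ e, ← P'.elabel _ e', hes]
      linarith
  have h4 : ∑ p ∈ M, (if p.1 = T.root then 0 else X p - F (φ p.1) (φ' p.2)) =
      ∑ w ∈ M with w.1 ≠ T.root, X w - ∑ w ∈ M with w.1 ≠ T.root, F (φ w.1) (φ' w.2) := by
    rw [← Finset.sum_sub_distrib, Finset.sum_filter]
    refine Finset.sum_congr rfl fun p _ => ?_
    by_cases e : p.1 = T.root <;> simp [e]
  -- The positive and the negative occurrences of `F` cancel except at the pair of roots, which
  -- leaves `F 0 0`.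
  have h5 : ∑ p ∈ M, F (φ p.1) (φ' p.2) =
      ∑ w ∈ M with w.1 ≠ T.root, F (φ w.1) (φ' w.2) + F 0 0 := by
    rw [← Finset.sum_filter_add_sum_filter_not M fun p => p.1 ≠ T.root]
    congr 1
    have : M.filter (fun p => ¬ p.1 ≠ T.root) = {(T.root, T'.root)} := by
      ext p
      simp only [not_not, Finset.mem_filter, Finset.mem_singleton]
      constructor
      · rintro ⟨hp, e⟩
        exact Prod.ext e ((h.root_iff hp).1 e)
      · rintro rfl
        exact ⟨h.root_mem, rfl⟩
    rw [this, Finset.sum_singleton, P.root, P'.root]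
  have h6 : ∑ w ∈ M with w.1 ≠ T.root, X w =
      ∑ p ∈ M, ∑ w ∈ M with w.1 ≠ T.root ∧ (T.parent w.1, T'.parent w.2) = p,
        childWeight dep ch ch' el el' lam es E E' F (φ p.1) (φ' p.2) (idx w.1) (idx' w.2) := by
    rw [← Finset.sum_fiberwise_of_maps_to (t := M)
      (g := fun w => (T.parent w.1, T'.parent w.2))
      fun w hw => h.parent_mem w (Finset.mem_filter.1 hw).1]
    refine Finset.sum_congr rfl fun p _ => ?_
    rw [Finset.filter_filter]
    refine Finset.sum_congr rfl fun w hw => ?_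
    obtain ⟨-, -, rfl⟩ := Finset.mem_filter.1 hw
    rfl
  rw [mappingCost, h1, h2, ← Finset.sum_add_distrib, ← Finset.sum_add_distrib,
    Finset.sum_congr rfl h3, Finset.sum_add_distrib, h4, Finset.sum_sub_distrib, h5, h6,
    Finset.sum_sub_distrib]
  ring

open scoped Classical in
/-- The pairs of children that a mapping induces at a pair of nodes, as pairs of indices. -/
theorem sum_child_pairs (P : Presents T N dep vl nc ch el φ idx)
    (P' : Presents T' N' dep' vl' nc' ch' el' φ' idx') (hroot : ∀ p ∈ M, p.1 = T.root ↔ p.2 = T'.root)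
    (p : T.Node × T'.Node) (f : ℕ → ℕ → ℝ) :
    ∑ w ∈ M with w.1 ≠ T.root ∧ (T.parent w.1, T'.parent w.2) = p, f (idx w.1) (idx' w.2) =
      ∑ x ∈ (M.filter fun w => w.1 ≠ T.root ∧ (T.parent w.1, T'.parent w.2) = p).image
        (fun w => (idx w.1, idx' w.2)), f x.1 x.2 := by
  rw [Finset.sum_image]
  intro w hw x hx e
  obtain ⟨hw, hw1, hw2⟩ := Finset.mem_filter.1 hw
  obtain ⟨hx, hx1, hx2⟩ := Finset.mem_filter.1 hx
  obtain ⟨e1, e2⟩ := Prod.ext_iff.1 e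
  obtain ⟨e3, e4⟩ := Prod.ext_iff.1 (hw2.trans hx2.symm)
  exact Prod.ext (P.inj _ _ hw1 hx1 e3 e1)
    (P'.inj _ _ (fun e => hw1 ((hroot w hw).2 e)) (fun e => hx1 ((hroot x hx).2 e)) e4 e2)

/-- The mapping obtained from matchings of the children of all pairs of nodes. -/
inductive OptimalPair (T T' : RootedTree (Fin L)) (φ idx : T.Node → ℕ) (φ' idx' : T'.Node → ℕ)
    (Nm : ℕ → ℕ → Finset (ℕ × ℕ)) : T.Node → T'.Node → Prop where
  | root : OptimalPair T T' φ idx φ' idx' Nm T.root T'.root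
  | child (w : T.Node) (w' : T'.Node) : w ≠ T.root → w' ≠ T'.root →
      OptimalPair T T' φ idx φ' idx' Nm (T.parent w) (T'.parent w') →
      (idx w, idx' w') ∈ Nm (φ (T.parent w)) (φ' (T'.parent w')) →
      OptimalPair T T' φ idx φ' idx' Nm w w'

/-- Downward induction from the roots: equal nodes have equal parents, whose partners agree by
induction, and the matching used at this pair of parents is injective on the indices of children. -/
theorem OptimalPair.inj (P : Presents T N dep vl nc ch el φ idx)
    (P' : Presents T' N' dep' vl' nc' ch' el' φ' idx') {Nm : ℕ → ℕ → Finset (ℕ × ℕ)}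
    (hN : ∀ p < N, ∀ q < N', IsPartialMatching (nc p) (nc' q) (Nm p q)) {w : T.Node} {w' : T'.Node}
    (h : OptimalPair T T' φ idx φ' idx' Nm w w') :
    ∀ x x', OptimalPair T T' φ idx φ' idx' Nm x x' → (w = x ↔ w' = x') := by
  induction h with
  | root =>
    rintro x x' (_ | ⟨_, _, h1, h2, -, -⟩)
    · simp
    · exact ⟨fun e => absurd e.symm h1, fun e => absurd e.symm h2⟩
  | child w w' h1 h2 h3 h4 ih =>
    rintro x x' (_ | ⟨_, _, h1', h2', h3', h4'⟩)
    · exact ⟨fun e => absurd e h1, fun e => absurd e h2⟩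
    · have hN := (hN _ (P.lt (T.parent w)) _ (P'.lt (T'.parent w'))).2 _ h4
      constructor
      · rintro rfl
        have e := (ih _ _ h3').1 rfl
        rw [← e] at h4'
        exact P'.inj _ _ h2 h2' e ((hN _ h4').1 rfl)
      · rintro rfl
        have e := (ih _ _ h3').2 rfl
        rw [← e] at h4'
        exact P.inj _ _ h1 h1' e ((hN _ h4').2 rfl)

/-- By `IsSDM.mappingCost_eq` the cost of a mapping exceeds `F 0 0` by the total excess of its
induced matchings over the minima `m`. The excess is never negative, and it is zero for the mapping
`OptimalPair` built from optimal matchings. -/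
theorem sdted_eq (P : Presents T N dep vl nc ch el φ idx)
    (P' : Presents T' N' dep' vl' nc' ch' el' φ' idx')
    (C : SubtreeCosts N dep vl nc ch el lam vd ed E S)
    (C' : SubtreeCosts N' dep' vl' nc' ch' el' lam vi ei E' S')
    (hvd : ∀ a : Fin L, vd a = c.vdel a) (hed : ∀ a : Fin L, ed a = c.edel a)
    (hvi : ∀ a : Fin L, vi a = c.vins a) (hei : ∀ a : Fin L, ei a = c.eins a)
    (hvs : ∀ a b : Fin L, vs a b = c.vsub a b) (hes : ∀ a b : Fin L, es a b = c.esub a b)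
    (hF : ∀ p < N, ∀ q < N', F p q = lam (dep p) * vs (vl p) (vl' q) + S p + S' q + m p q)
    (hm : ∀ p < N, ∀ q < N', IsMinMatching (nc p) (nc' q)
      (childWeight dep ch ch' el el' lam es E E' F p q) (m p q)) :
    sdted c T T' lam = F 0 0 := by
  classical
  apply (sdted_isLeast c T T' lam).unique
  constructor
  · have hex : ∀ p q, ∃ Nm, p < N → q < N' → IsPartialMatching (nc p) (nc' q) Nm ∧
        m p q = ∑ x ∈ Nm, childWeight dep ch ch' el el' lam es E E' F p q x.1 x.2 := by
      intro p q
      by_cases hp : p < N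
      · by_cases hq : q < N'
        · obtain ⟨Nm, h⟩ := (hm p hp q hq).1
          exact ⟨Nm, fun _ _ => h⟩
        · exact ⟨∅, fun _ h => absurd h hq⟩
      · exact ⟨∅, fun h => absurd h hp⟩
    -- One matching is fixed for each pair of nodes of the graphs, so all copies of this pair in the
    -- trees use the same one. Outside the range the empty set is a dummy value.
    choose Nm hNm using hex
    have hinj := fun {w : T.Node} {w' : T'.Node}
      (h : OptimalPair T T' φ idx φ' idx' Nm w w') =>
      h.inj P P' (fun p hp q hq => (hNm p q hp hq).1)
    set M : Finset (T.Node × T'.Node) :=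
      Finset.univ.filter fun p => OptimalPair T T' φ idx φ' idx' Nm p.1 p.2 with hM
    have hmem : ∀ p, p ∈ M ↔ OptimalPair T T' φ idx φ' idx' Nm p.1 p.2 := by simp [hM]
    have hS : IsSDM T T' M := by
      refine ⟨fun p hp q hq => hinj ((hmem p).1 hp) _ _ ((hmem q).1 hq), (hmem _).2 .root, ?_⟩
      rintro ⟨p, p'⟩ hp
      rw [hmem] at hp ⊢
      rcases hp with _ | ⟨_, _, -, -, h, -⟩
      · simp only [T.parent_root, T'.parent_root]
        exact .root
      · exact h
    refine ⟨M, hS, ?_⟩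
    rw [hS.mappingCost_eq P P' C C' hvd hed hvi hei hvs hes hF]
    rw [Finset.sum_eq_zero, add_zero]
    intro p hp
    rw [sum_child_pairs P P' (fun p hp => hS.root_iff hp) p
      (childWeight dep ch ch' el el' lam es E E' F (φ p.1) (φ' p.2)),
      (hNm _ _ (P.lt p.1) (P'.lt p.2)).2, sub_eq_zero]
    refine Finset.sum_congr ?_ fun _ _ => rfl
    ext x
    simp only [Finset.mem_image, Finset.mem_filter]
    constructor
    · rintro ⟨w, ⟨hw, hw1, rfl⟩, rfl⟩
      obtain ⟨w1, w2⟩ := w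
      rw [hmem] at hw
      rcases hw with _ | ⟨_, _, -, -, -, h⟩
      · exact absurd rfl hw1
      · exact h
    · intro hx
      obtain ⟨h1, h2⟩ := (hNm _ _ (P.lt p.1) (P'.lt p.2)).1.1 x hx
      obtain ⟨w, hw1, hw2, hw3⟩ := P.ex p.1 x.1 h1
      obtain ⟨w', hw1', hw2', hw3'⟩ := P'.ex p.2 x.2 h2
      refine ⟨(w, w'), ⟨(hmem _).2 (.child w w' hw1 hw1' ?_ ?_), hw1, ?_⟩, ?_⟩
      · rw [hw2, hw2']
        exact (hmem _).1 hp
      · rw [hw2, hw2', hw3, hw3']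
        exact hx
      · rw [hw2, hw2']
      · rw [hw3, hw3']
  · rintro x ⟨M, hS, rfl⟩
    rw [hS.mappingCost_eq P P' C C' hvd hed hvi hei hvs hes hF]
    refine le_add_of_nonneg_right (Finset.sum_nonneg fun p hp => sub_nonneg.2 ?_)
    rw [sum_child_pairs P P' (fun p hp => hS.root_iff hp) p
      (childWeight dep ch ch' el el' lam es E E' F (φ p.1) (φ' p.2))]
    refine (hm _ (P.lt p.1) _ (P'.lt p.2)).2 ⟨_, ⟨?_, ?_⟩, rfl⟩
    · intro x hx
      simp only [Finset.mem_image, Finset.mem_filter] at hx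
      obtain ⟨w, ⟨hw, hw1, rfl⟩, rfl⟩ := hx
      exact ⟨P.idx_lt _ hw1, P'.idx_lt _ fun e => hw1 ((hS.root_iff hw).2 e)⟩
    · intro x hx y hy
      simp only [Finset.mem_image, Finset.mem_filter] at hx hy
      obtain ⟨w, ⟨hw, hw1, rfl⟩, rfl⟩ := hx
      obtain ⟨z, ⟨hz, hz1, hz2⟩, rfl⟩ := hy
      obtain ⟨e1, e2⟩ := Prod.ext_iff.1 hz2
      simp only at e1 e2 ⊢
      constructor
      · intro e
        rw [← (hS.inj w hw z hz).1 (P.inj _ _ hw1 hz1 e1.symm e)]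
      · intro e
        rw [(hS.inj w hw z hz).2 (P'.inj _ _ (fun e => hw1 ((hS.root_iff hw).2 e))
          (fun e => hz1 ((hS.root_iff hz).2 e)) e2.symm e)]

end

end CNTCost

end

noncomputable section

namespace CNTCost

/-! ## Compressed neighborhood trees in terms of the enumeration of their nodes -/

theorem RootedTree.depth_root {Λ : Type} (T : RootedTree Λ) : T.depth T.root = 0 := by
  classical
  rw [RootedTree.depth, Nat.find_eq_zero]
  rfl

theorem RootedTree.depth_of_ne {Λ : Type} (T : RootedTree Λ) {u : T.Node} (hu : u ≠ T.root) :
    T.depth u = T.depth (T.parent u) + 1 := by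
  classical
  rw [RootedTree.depth, RootedTree.depth, Nat.find_eq_iff]
  refine ⟨Nat.find_spec (T.reach (T.parent u)), ?_⟩
  intro d hd he
  cases d with
  | zero => exact hu he
  | succ d => exact Nat.find_min (T.reach (T.parent u)) (by omega) he

section

variable {Λ : Type} (C : CompressedTree Λ)

theorem CompressedTree.unfold_parent {w x : C.Node} {l : List C.Node} (h : w :: x :: l ∈ C.paths)
    (h' : x :: l ∈ C.paths) : C.unfold.parent ⟨w :: x :: l, h⟩ = ⟨x :: l, h'⟩ := by
  simp [CompressedTree.unfold]

theorem CompressedTree.unfold_ne_root {w x : C.Node} {l : List C.Node} (h : w :: x :: l ∈ C.paths) :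
    (⟨w :: x :: l, h⟩ : C.paths) ≠ C.unfold.root := by
  intro e
  have := congrArg (fun p : C.paths => p.1.length) e
  simp [CompressedTree.unfold] at this

theorem CompressedTree.cons_cons_mem_paths {w x : C.Node} {l : List C.Node} :
    w :: x :: l ∈ C.paths ↔ C.Child x w ∧ x :: l ∈ C.paths := by
  simp only [CompressedTree.paths, Set.mem_ofPred_eq, List.isChain_cons_cons, List.getLast?_cons_cons]
  tauto

theorem CompressedTree.eq_root_or (u : C.unfold.Node) : u = C.unfold.root ∨
    ∃ (w x : C.Node) (l : List C.Node) (h : w :: x :: l ∈ C.paths), u = ⟨w :: x :: l, h⟩ := by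
  obtain ⟨l, hl⟩ := u
  match l, hl with
  | [], hl => exact absurd hl C.nil_notMem_paths
  | [w], hl =>
    left
    have h' : w = C.root := by simpa [CompressedTree.paths] using hl
    subst h'
    rfl
  | w :: x :: l, hl => exact Or.inr ⟨w, x, l, hl, rfl⟩

theorem CompressedTree.unfold_depth (u : C.unfold.Node) :
    C.unfold.depth u = C.depth (C.endpoint u) := by
  obtain ⟨l, hl⟩ := u
  induction l with
  | nil => exact absurd hl C.nil_notMem_paths
  | cons w l ih =>
    rcases C.eq_root_or ⟨w :: l, hl⟩ with e | ⟨w', x, l', h, e⟩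
    · rw [e, RootedTree.depth_root]
      exact C.depth_root.symm
    · have e' : w :: l = w' :: x :: l' := congrArg Subtype.val e
      obtain ⟨rfl, rfl⟩ := List.cons.inj e'
      obtain ⟨h1, h2⟩ := C.cons_cons_mem_paths.1 hl
      refine (C.unfold.depth_of_ne (u := ⟨w :: x :: l', hl⟩) (C.unfold_ne_root hl)).trans ?_
      refine (congrArg (fun t => C.unfold.depth t + 1) (C.unfold_parent hl h2)).trans ?_
      exact (congrArg (fun t => t + 1) (ih h2)).trans (C.depth_child _ _ h1).symm

theorem CompressedTree.unfold_elabel {w x : C.Node} {l : List C.Node} (h : w :: x :: l ∈ C.paths) :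
    C.unfold.elabel ⟨w :: x :: l, h⟩ = C.elabel x w := by
  simp [CompressedTree.unfold, CompressedTree.endpoint]

end

/-! ### From adjacency lists to neighborhood trees. -/

/-- The adjacency lists of a labeled graph. -/
structure Encodes {n L : ℕ} (A : AdjData) (vlab : ℕ → ℕ) (G : LabeledGraph n L) : Prop where
  deg : ∀ v : Fin n, A.deg v = G.graph.degree v
  adj : ∀ (v : Fin n), ∀ j < A.deg v, ∃ w : Fin n, A.adj v j = w ∧ G.graph.Adj v w ∧
    A.lab v j = G.elabel s(v, w)
  surj : ∀ v w : Fin n, G.graph.Adj v w → ∃ j < A.deg v, A.adj v j = w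
  inj : ∀ u, ∀ j < A.deg u, ∀ j' < A.deg u, A.adj u j = A.adj u j' → j = j'
  vlab : ∀ v : Fin n, vlab v = G.vlabel v

section

variable {n L : ℕ} {A : AdjData} {vlab : ℕ → ℕ} {G : LabeledGraph n L} {v : Fin n} {h k : ℕ}

theorem Encodes.walk_lt (H : Encodes A vlab G) {e u : ℕ} (hw : A.Walk v e u) : u < n := by
  induction e generalizing u with
  | zero =>
    have : u = v := hw
    omega
  | succ e ih =>
    obtain ⟨y, hy, j, hj, rfl⟩ := hw
    obtain ⟨w, hw, -⟩ := H.adj ⟨y, ih hy⟩ j hj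
    simp only at hw
    rw [hw]
    exact w.2

theorem Encodes.walk_iff (H : Encodes A vlab G) {e : ℕ} {u : Fin n} : A.Walk v e u ↔
    ∃ l, (u :: l).IsChain G.graph.Adj ∧ (u :: l).getLast? = some v ∧ l.length = e := by
  induction e generalizing u with
  | zero =>
    constructor
    · intro hw
      have : u = v := Fin.ext hw
      exact ⟨[], by simp, by simp [this], rfl⟩
    · rintro ⟨l, -, h2, h3⟩
      rw [List.length_eq_zero_iff] at h3
      subst h3
      have : u = v := by simpa using h2
      exact congrArg Fin.val this
  | succ e ih =>
    constructor
    · rintro ⟨y, hy, j, hj, hu⟩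
      have hyn := H.walk_lt hy
      obtain ⟨l, h1, h2, h3⟩ := (ih (u := ⟨y, hyn⟩)).1 hy
      obtain ⟨w, hw, hadj, -⟩ := H.adj ⟨y, hyn⟩ j hj
      have : w = u := Fin.ext (hw.symm.trans hu)
      subst this
      refine ⟨⟨y, hyn⟩ :: l, ?_, ?_, by simp [h3]⟩
      · rw [List.isChain_cons_cons]
        exact ⟨hadj.symm, h1⟩
      · rwa [List.getLast?_cons_cons]
    · rintro ⟨l, h1, h2, h3⟩
      match l, h1, h2, h3 with
      | y :: l, h1, h2, h3 =>
        rw [List.isChain_cons_cons] at h1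
        rw [List.getLast?_cons_cons] at h2
        obtain ⟨j, hj, e'⟩ := H.surj y u h1.1.symm
        exact ⟨y, ih.2 ⟨l, h1.2, h2, by simpa using h3⟩, j, hj, e'⟩

theorem Encodes.isNode_iff (H : Encodes A vlab G) {d : ℕ} {u : Fin n} : A.IsNode v h k u d ↔
    ∃ l, u :: l ∈ ntNodes G v h k ∧ l.length = d := by
  constructor
  · intro hn
    obtain ⟨l, h1, h2, rfl⟩ := H.walk_iff.1 hn.walk
    refine ⟨l, ⟨⟨h1, h2, by simpa using hn.le_height⟩, ?_⟩, rfl⟩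
    rintro l' ⟨h1', h2', h3'⟩ hh
    match l', h1', h2', h3', hh with
    | u' :: l', h1', h2', _, hh =>
      have : u = u' := by simpa using hh
      subst this
      simpa using hn.le _ (H.walk_iff.2 ⟨l', h1', h2', rfl⟩)
  · rintro ⟨l, ⟨⟨h1, h2, h3⟩, h4⟩, rfl⟩
    have hle : l.length ≤ h := by simpa using h3
    refine ⟨H.walk_iff.2 ⟨l, h1, h2, rfl⟩, hle, fun e he => ?_⟩
    obtain ⟨l', h1', h2', rfl⟩ := H.walk_iff.1 he
    -- The definition of the tree only compares with walks of length at most `h`; longer walks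
    -- impose no condition, because the depth of the node is at most `h`.
    by_cases hh : l'.length ≤ h
    · simpa using h4 (u :: l') ⟨h1', h2', by simpa using hh⟩ rfl
    · omega

theorem Encodes.isNode (H : Encodes A vlab G) (z : (cNT G v h k).Node) :
    A.IsNode v h k z.1.1 z.1.2 :=
  H.isNode_iff.2 z.2

/-- Adjacency and consecutive depths suffice: whether a walk is a node of the redundant tree depends
only on its length and its end. A walk representing `z`, extended by one step, has the length and
the end of some walk representing `y`, and is therefore a node as well. -/
theorem cNT_child_iff (z y : (cNT G v h k).Node) :
    (cNT G v h k).Child z y ↔ G.graph.Adj z.1.1 y.1.1 ∧ (y.1.2 : ℕ) = z.1.2 + 1 := by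
  constructor
  · rintro ⟨l, ⟨⟨h1, -, -⟩, -⟩, h4, h5⟩
    rw [List.isChain_cons_cons] at h1
    exact ⟨h1.1.symm, by omega⟩
  · rintro ⟨hadj, hd⟩
    obtain ⟨l, ⟨⟨h1, h2, -⟩, -⟩, h4⟩ := z.2
    obtain ⟨l', ⟨⟨-, -, h3'⟩, h4'⟩, h5'⟩ := y.2
    have hlen : l.length + 1 = l'.length := by omega
    refine ⟨l, ⟨⟨?_, ?_, ?_⟩, ?_⟩, h4, by omega⟩
    · rw [List.isChain_cons_cons]
      exact ⟨hadj.symm, h1⟩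
    · rwa [List.getLast?_cons_cons]
    · simpa [hlen] using h3'
    · intro x hx hh
      simpa [hlen] using h4' x hx hh

variable {N : ℕ} {vtx dep nc : ℕ → ℕ} {ch el : ℕ → ℕ → ℕ}

/-- A node of the unfolded tree is a path; `φ` sends it to the number of its endpoint, and `idx` is
the position of the endpoint in the list of children of the preceding node. A path is determined by
its parent and its endpoint, hence by its parent and this position. -/
theorem Encodes.exists_presents (H : Encodes A vlab G)
    (hT : IsTree A v h k N vtx dep nc ch el) :
    ∃ φ idx, Presents (cNT G v h k).unfold N dep (fun q => vlab (vtx q)) nc ch el φ idx := by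
  classical
  set C := cNT G v h k with hC
  -- `ι` sends a pair of a vertex and a depth to its number in the enumeration.
  choose ι hιN hιv hιd using fun z : C.Node => hT.exists_of_isNode _ _ (H.isNode z)
  have hι : ∀ z y, ι z = ι y → z = y := by
    intro z y e
    apply Subtype.ext
    apply Prod.ext
    · apply Fin.ext
      rw [← hιv z, ← hιv y, e]
    · apply Fin.ext
      rw [← hιd z, ← hιd y, e]
  have hchild : ∀ z y, C.Child z y → ∃ i < nc (ι z), ch (ι z) i = ι y := by
    intro z y hzy
    obtain ⟨hadj, hd⟩ := (cNT_child_iff z y).1 hzy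
    obtain ⟨j, hj, e⟩ := H.surj _ _ hadj
    have hk := hT.kids _ (hιN z)
    obtain ⟨i, hi, e'⟩ := hk.complete j (by rwa [hιv z]) (by
      rw [hιv, hιd, e, ← hd]
      exact H.isNode y)
    refine ⟨i, hi, hT.inj _ (hk.child i hi).2.1 _ (hιN y) ?_ ?_⟩
    · rw [e', hιv, hιv, e]
    · rw [(hk.child i hi).2.2.1, hιd, hιd, hd]
  have hlab : ∀ z y i, i < nc (ι z) → ch (ι z) i = ι y →
      C.Child z y ∧ (G.elabel s(z.1.1, y.1.1) : ℕ) = el (ι z) i := by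
    intro z y i hi e
    obtain ⟨-, -, h3, j, hj, h4, h5⟩ := (hT.kids _ (hιN z)).child i hi
    rw [hιv] at hj h4 h5
    obtain ⟨w, hw1, hw2, hw3⟩ := H.adj _ j hj
    rw [e, hιv] at h4
    have : w = y.1.1 := Fin.ext (hw1.symm.trans h4)
    subst this
    rw [e, hιd, hιd] at h3
    exact ⟨(cNT_child_iff z y).2 ⟨hw2, h3⟩, by rw [h5, hw3]⟩
  have hex : ∀ w : C.unfold.Node, w ≠ C.unfold.root →
      ∃ i < nc (ι (C.endpoint (C.unfold.parent w))),
        ch (ι (C.endpoint (C.unfold.parent w))) i = ι (C.endpoint w) := by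
    intro w hw
    rcases C.eq_root_or w with e | ⟨y, x, l, hl, rfl⟩
    · exact absurd e hw
    · obtain ⟨h1, h2⟩ := C.cons_cons_mem_paths.1 hl
      rw [C.unfold_parent hl h2]
      exact hchild x y h1
  -- The value at the root is arbitrary and never used.
  choose! idx hidx hidx' using hex
  refine ⟨fun u => ι (C.endpoint u), idx, ?_, fun u => hιN _, ?_, ?_, hidx,
    fun u hu => (hidx' u hu).symm, ?_, ?_, ?_⟩
  · refine hT.inj _ (hιN _) _ hT.pos ?_ ?_
    · rw [hιv, hT.vtx_zero]
      rfl
    · rw [hιd, hT.dep_zero]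
      rfl
  · intro u
    rw [C.unfold_depth, hιd]
    rfl
  · intro u
    simp only [hιv, H.vlab]
    rfl
  · intro u hu
    have h1 := hidx u hu
    have h2 := hidx' u hu
    have h3 := (hlab _ _ _ h1 h2).2
    rw [← h3]
    rcases C.eq_root_or u with e | ⟨y, x, l, hl, rfl⟩
    · exact absurd e hu
    · obtain ⟨h4, h5⟩ := C.cons_cons_mem_paths.1 hl
      rw [C.unfold_parent hl h5, C.unfold_elabel]
      rfl
  · intro u i hi
    obtain ⟨-, hN, hd, j, hj, hv, -⟩ := (hT.kids _ (hιN (C.endpoint u))).child i hi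
    have hn := hT.node _ hN
    have hlt := H.walk_lt hn.walk
    -- The number stored as the child belongs to a pair `y` of the compressed tree; prepending `y`
    -- to the path `u` gives the required child.
    set y : C.Node := ⟨(⟨_, hlt⟩, ⟨_, Nat.lt_succ_of_le hn.le_height⟩), H.isNode_iff.1 hn⟩ with hy
    have he : ch (ι (C.endpoint u)) i = ι y :=
      hT.inj _ hN _ (hιN y) (by rw [hιv]) (by rw [hιd])
    have hc := (hlab _ y i hi he).1
    obtain ⟨l, hl⟩ := u
    match l, hl with
    | [], hl => exact absurd hl C.nil_notMem_paths
    | x :: l, hl =>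
      have hp : y :: x :: l ∈ C.paths := C.cons_cons_mem_paths.2 ⟨hc, hl⟩
      have hne := C.unfold_ne_root hp
      refine ⟨⟨y :: x :: l, hp⟩, hne, C.unfold_parent hp hl, ?_⟩
      have h1 := hidx _ hne
      have h2 := hidx' _ hne
      rw [C.unfold_parent hp hl] at h1 h2
      exact (hT.kids _ (hιN _)).inj _ h1 _ hi (h2.trans he.symm)
  · intro w w' hw hw' hpar he
    have h1 := hidx' w hw
    have h2 := hidx' w' hw'
    rw [hpar, he, h2] at h1
    have h3 := hι _ _ h1
    rcases C.eq_root_or w with e | ⟨y, x, l, hl, rfl⟩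
    · exact absurd e hw
    rcases C.eq_root_or w' with e | ⟨y', x', l', hl', rfl⟩
    · exact absurd e hw'
    obtain ⟨-, h5⟩ := C.cons_cons_mem_paths.1 hl
    obtain ⟨-, h5'⟩ := C.cons_cons_mem_paths.1 hl'
    rw [C.unfold_parent hl h5, C.unfold_parent hl' h5'] at hpar
    have h6 := congrArg Subtype.val hpar
    simp only at h6
    have h7 : y = y' := h3.symm
    subst h7
    apply Subtype.ext
    simp only [h6]

end

end CNTCost

end

noncomputable section

namespace CNTCost

/-! ## The costs of deleting subtrees as a program

As in the breadth first search, all names are shifted by `g`.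

Integer registers: `110` and `130` loop variables, `120` current node, `140` number of its children.
Real register: `10` sum. Real arrays: `20` costs of the subtrees of the children, `30` their sums.
The real arrays `ad` and `ae` contain the costs of vertices and edges. -/

/-- The child of the current node given by the register `130`. -/
def descChild (g : ℕ) : NExp := .arr (g + 70) (.var (g + 120)) (.var (g + 130))

/-- The cost of the subtree of a child. -/
def descStep (g ad ae : ℕ) : Prog :=
  .rstore (g + 20) (.var (g + 120)) (.var (g + 130))
    (.add (.mul (.arr 6 (.arr (g + 50) (.const 0) (descChild g)) (.const 0))
      (.add (.arr ad (.arr (g + 3) (.arr (g + 40) (.const 0) (descChild g)) (.const 0)) (.const 0))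
        (.arr ae (.arr (g + 80) (.var (g + 120)) (.var (g + 130))) (.const 0))))
      (.arr (g + 30) (.const 0) (descChild g))) ;;
  .rset (g + 10) (.add (.var (g + 10)) (.arr (g + 20) (.var (g + 120)) (.var (g + 130))))

/-- The costs of the subtrees of the children of a node. -/
def descNode (g ad ae : ℕ) : Prog :=
  (.nset (g + 120) (.sub (.sub (.var (g + 30)) (.var (g + 110))) (.const 1)) ;;
   .nset (g + 140) (.arr (g + 60) (.const 0) (.var (g + 120))) ;;
   .rset (g + 10) .zero) ;;
  forTo (g + 130) (g + 140) (descStep g ad ae) ;;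
  .rstore (g + 30) (.const 0) (.var (g + 120)) (.var (g + 10))

/-- The costs of all subtrees. -/
def desc (g ad ae : ℕ) : Prog := forTo (g + 110) (g + 30) (descNode g ad ae)

theorem descStep_wn (g ad ae : ℕ) : (descStep g ad ae).wn = [] := rfl
theorem descStep_wna (g ad ae : ℕ) : (descStep g ad ae).wna = [] := rfl
theorem descStep_wra (g ad ae : ℕ) : (descStep g ad ae).wra = [g + 20] := rfl
theorem descNode_wn (g ad ae : ℕ) : (descNode g ad ae).wn =
    [g + 120, g + 140, g + 130, g + 130] := rfl
theorem descNode_wna (g ad ae : ℕ) : (descNode g ad ae).wna = [] := rfl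
theorem descNode_wra (g ad ae : ℕ) : (descNode g ad ae).wra = [g + 20, g + 30] := rfl

/-- The nodes are treated in descending order, so the subtree costs of the children are final when
they are read. The assumptions on `ad` and `ae` keep the tables of edit costs apart from the arrays
that are written. -/
theorem desc_runs (g ad ae : ℕ) (had : ad < 10) (hae : ae < 10) (s : State) {N B : ℕ}
    {dep vtx nc : ℕ → ℕ} {ch el : ℕ → ℕ → ℕ} (hN : s.nvar (g + 30) = N)
    (hvtx : s.narr (g + 40) 0 = vtx) (hdep : s.narr (g + 50) 0 = dep) (hnc : s.narr (g + 60) 0 = nc)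
    (hch : s.narr (g + 70) = ch) (hel : s.narr (g + 80) = el)
    (hlt : ∀ p < N, ∀ i < nc p, p < ch p i ∧ ch p i < N)
    (hB : ∑ p ∈ Finset.range N, (nc p + 1) ≤ B) :
    Runs (desc g ad ae) s (100 * B + 6) fun s' =>
      SubtreeCosts N dep (fun q => s.narr (g + 3) (vtx q) 0) nc ch el (fun d => s.rarr 6 d 0)
        (fun a => s.rarr ad a 0) (fun a => s.rarr ae a 0) (s'.rarr (g + 20)) (s'.rarr (g + 30) 0) := by
  have n1 : ad ≠ g + 20 := by omega
  have n2 : ad ≠ g + 30 := by omega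
  have n3 : ae ≠ g + 20 := by omega
  have n4 : ae ≠ g + 30 := by omega
  set cost : ℕ → ℕ → ℝ := fun p i => s.rarr 6 (dep (ch p i)) 0 *
    (s.rarr ad (s.narr (g + 3) (vtx (ch p i)) 0) 0 + s.rarr ae (el p i) 0) with hcost
  refine (Runs.forTo (fun t s' => ∀ p < N, N ≤ p + t →
    (∀ i < nc p, s'.rarr (g + 20) p i = cost p i + s'.rarr (g + 30) 0 (ch p i)) ∧
    s'.rarr (g + 30) 0 p = ∑ i ∈ Finset.range (nc p), s'.rarr (g + 20) p i) N
    (fun t => 60 * nc (N - 1 - t) + 40) hN (by simp) (by simp [descNode_wn]) (by simp [descNode_wn])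
    (by intro p hp h; omega) ?_ ?_).mono le_rfl ?_
  · intro t ht s' f hx hI
    set p := N - 1 - t with hp
    have hpN : p < N := by omega
    have fn : ∀ x, x ≠ g + 110 → x ≠ g + 120 → x ≠ g + 130 → x ≠ g + 140 → s'.nvar x = s.nvar x :=
      fun x h1 h2 h3 h4 => f.nv x (by simp [forTo, Prog.wn, descNode_wn, h1, h2, h3, h4])
    have fa : s'.narr = s.narr := funext fun x =>
      f.na x (by simp [forTo, Prog.wna, descNode_wna])
    have fr : ∀ x, x ≠ g + 20 → x ≠ g + 30 → s'.rarr x = s.rarr x :=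
      fun x h1 h2 => f.ra x (by simp [forTo, Prog.wra, descNode_wra, h1, h2])
    refine Runs.den_seq (60 * nc p + 20) rfl (fun f' => ?_)
      (by simp only [Prog.time, NExp.cost, RExp.cost]; omega)
    set s₁ := (Prog.nset (g + 120) (.sub (.sub (.var (g + 30)) (.var (g + 110))) (.const 1)) ;;
      .nset (g + 140) (.arr (g + 60) (.const 0) (.var (g + 120))) ;;
      .rset (g + 10) .zero).den s' with hs₁
    have hNt : s'.nvar (g + 30) - s'.nvar (g + 110) - 1 = p := by
      rw [fn _ (by simp) (by simp) (by simp) (by simp), hN, hx]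
      omega
    have e120 : s₁.nvar (g + 120) = p := by simp [hs₁, Prog.den, NExp.eval, hNt]
    have e140 : s₁.nvar (g + 140) = nc p := by
      simp [hs₁, Prog.den, NExp.eval, hNt, fa, hnc]
    have er10 : s₁.rvar (g + 10) = 0 := by simp [hs₁, Prog.den, RExp.eval]
    have ea : s₁.narr = s.narr := fa
    have er : s₁.rarr = s'.rarr := rfl
    clear_value s₁
    clear f'
    refine Runs.seq (60 * nc p + 6) 6 (Runs.forTo_const (fun i s'' =>
      (∀ j < i, s''.rarr (g + 20) p j = cost p j + s'.rarr (g + 30) 0 (ch p j)) ∧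
      (∀ p', p' ≠ p → s''.rarr (g + 20) p' = s'.rarr (g + 20) p') ∧
      s''.rvar (g + 10) = ∑ j ∈ Finset.range i, s''.rarr (g + 20) p j) (nc p) 48 e140
      (by simp) (by simp [descStep_wn]) (by simp [descStep_wn]) ?_ ?_ (by omega)) ?_ (by omega)
    · refine ⟨by simp, fun p' _ => ?_, ?_⟩
      · rw [State.setN_rarr, er]
      · simpa [State.setN] using er10
    · rintro i hi s'' f' hx' ⟨hI1, hI2, hI3⟩
      have e120 : s''.nvar (g + 120) = p := by
        rw [f'.nv _ (by simp [forTo, Prog.wn, descStep_wn]), e120]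
      have ea : s''.narr = s.narr := by
        rw [← ea]
        exact funext fun x => f'.na x (by simp [forTo, Prog.wna, descStep_wna])
      have fr' : ∀ x, x ≠ g + 20 → s''.rarr x = s'.rarr x := fun x h1 => by
        rw [f'.ra _ (by simp [forTo, Prog.wra, descStep_wra, h1]), er]
      have r6 : s''.rarr 6 = s.rarr 6 := (fr' 6 (by omega)).trans (fr 6 (by omega) (by omega))
      have rad : s''.rarr ad = s.rarr ad := (fr' ad n1).trans (fr ad n1 n2)
      have rae : s''.rarr ae = s.rarr ae := (fr' ae n3).trans (fr ae n3 n4)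
      have r30 : s''.rarr (g + 30) = s'.rarr (g + 30) := fr' _ (by simp)
      have hset : ((descStep g ad ae).den s'').rarr (g + 20) p =
          Function.update (s''.rarr (g + 20) p) i (cost p i + s'.rarr (g + 30) 0 (ch p i)) := by
        simp [descStep, descChild, Prog.den, NExp.eval, RExp.eval, upd_self, upd2_self, e120, hx', ea,
          hch, hdep, hel, hvtx, r6, rad, rae, r30, hcost]
      refine Runs.of_den rfl (by simp [descStep, descChild, Prog.time, NExp.cost, RExp.cost])
        fun _ => ⟨fun j hj => ?_, fun p' hp' => ?_, ?_⟩
      · rw [State.setN_rarr, hset]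
        by_cases e : j = i
        · simp [e]
        · rw [Function.update_of_ne e]
          exact hI1 j (by omega)
      · rw [State.setN_rarr, ← hI2 p' hp']
        simp [descStep, Prog.den, NExp.eval, upd_self, e120, upd2_of_ne, hp']
      · rw [State.setN_rarr, State.setN_rvar, hset, Finset.sum_range_succ, Function.update_self]
        have h1 : ((descStep g ad ae).den s'').rvar (g + 10) = s''.rvar (g + 10) +
            ((descStep g ad ae).den s'').rarr (g + 20) p i := by
          simp [descStep, Prog.den, NExp.eval, RExp.eval, e120, hx']
        rw [h1, hset, Function.update_self, hI3]
        congr 1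
        refine Finset.sum_congr rfl fun j hj => ?_
        rw [Function.update_of_ne (Finset.mem_range.1 hj).ne]
    · rintro s₂ f' ⟨hI1, hI2, hI3⟩
      have e120 : s₂.nvar (g + 120) = p := by
        rw [f'.nv _ (by simp [forTo, Prog.wn, descStep_wn]), e120]
      have r30 : s₂.rarr (g + 30) = s'.rarr (g + 30) := by
        rw [f'.ra _ (by simp [forTo, Prog.wra, descStep_wra]), er]
      refine Runs.of_den rfl (by simp [Prog.time, NExp.cost, RExp.cost]) fun _ => ?_
      have h30 : (Prog.den (.rstore (g + 30) (.const 0) (.var (g + 120)) (.var (g + 10)))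
          s₂).rarr (g + 30) 0 = Function.update (s'.rarr (g + 30) 0) p (s₂.rvar (g + 10)) := by
        simp [Prog.den, NExp.eval, RExp.eval, upd_self, upd2_self, e120, r30]
      have h20 : (Prog.den (.rstore (g + 30) (.const 0) (.var (g + 120)) (.var (g + 10)))
          s₂).rarr (g + 20) = s₂.rarr (g + 20) := by
        simp [Prog.den, upd_of_ne]
      intro p' hp' hpt
      rw [State.setN_rarr, h30, h20]
      have hch' : ∀ i < nc p', ch p' i ≠ p := fun i hi => by
        have := hlt p' hp' i hi
        omega
      by_cases e : p' = p
      · rw [e] at hch' ⊢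
        refine ⟨fun i hi => ?_, ?_⟩
        · rw [hI1 i hi, Function.update_of_ne (hch' i hi)]
        · rw [Function.update_self, hI3]
      · rw [Function.update_of_ne e, hI2 p' e]
        obtain ⟨h1, h2⟩ := hI p' hp' (by omega)
        refine ⟨fun i hi => ?_, h2⟩
        rw [h1 i hi, Function.update_of_ne (hch' i hi)]
  · refine Nat.add_le_add_right (le_trans ?_ (Nat.mul_le_mul_left 100 hB)) 6
    rw [Finset.sum_range_reflect (fun p => 60 * nc p + 40 + 8) N, Finset.mul_sum]
    exact Finset.sum_le_sum fun p _ => by omega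
  · intro s' _ hI
    exact ⟨fun p hp i hi => (hI p hp (by omega)).1 i hi, fun p hp => (hI p hp (by omega)).2⟩

end CNTCost

end

noncomputable section

namespace CNTCost

/-! ## The distances of all pairs of subtrees as a program

Integer registers: `21` and `23` loop variables, `22` current node of the first tree, `23` current
node of the second tree, `25` and `26` loop variables. Real array: `16` the distances. -/

/-- The weight of a pair of children. -/
def weightStep : Prog :=
  .rstore 11 (.var 25) (.var 26)
    (.sub (.sub (.add (.mul (.arr 6 (.arr 50 (.const 0) (.arr 70 (.var 22) (.var 25))) (.const 0))
        (.arr 3 (.arr 80 (.var 22) (.var 25)) (.arr 84 (.var 23) (.var 26))))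
      (.arr 16 (.arr 70 (.var 22) (.var 25)) (.arr 74 (.var 23) (.var 26))))
      (.arr 20 (.var 22) (.var 25))) (.arr 24 (.var 23) (.var 26)))

/-- The weights of all pairs of children of the current nodes. -/
def weights : Prog := forTo 25 11 (forTo 26 12 weightStep)

/-- The distance of the subtrees of the current nodes. -/
def distStep : Prog :=
  (.nset 11 (.arr 60 (.const 0) (.var 22)) ;; .nset 12 (.arr 64 (.const 0) (.var 23))) ;;
  weights ;; hung ;;
  .rstore 16 (.var 22) (.var 23)
    (.add (.add (.add (.mul (.arr 6 (.arr 50 (.const 0) (.var 22)) (.const 0))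
      (.arr 0 (.arr 3 (.arr 40 (.const 0) (.var 22)) (.const 0))
        (.arr 7 (.arr 44 (.const 0) (.var 23)) (.const 0))))
      (.arr 30 (.const 0) (.var 22))) (.arr 34 (.const 0) (.var 23))) (.var 3))

/-- The distances of all pairs of subtrees. -/
def dists : Prog :=
  forTo 21 30 (.nset 22 (.sub (.sub (.var 30) (.var 21)) (.const 1)) ;; forTo 23 34 distStep)

theorem IsMinMatching.congr {a b : ℕ} {X Y : ℕ → ℕ → ℝ} {m : ℝ} (h : IsMinMatching a b X m)
    (hXY : ∀ i < a, ∀ j < b, Y i j = X i j) : IsMinMatching a b Y m := by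
  have : {x : ℝ | ∃ N, IsPartialMatching a b N ∧ x = ∑ p ∈ N, Y p.1 p.2} =
      {x : ℝ | ∃ N, IsPartialMatching a b N ∧ x = ∑ p ∈ N, X p.1 p.2} := by
    ext x
    constructor <;> rintro ⟨N, hN, rfl⟩ <;> refine ⟨N, hN, Finset.sum_congr rfl fun p hp => ?_⟩
    · rw [hXY _ (hN.1 p hp).1 _ (hN.1 p hp).2]
    · rw [hXY _ (hN.1 p hp).1 _ (hN.1 p hp).2]
  rw [IsMinMatching, this]
  exact h

theorem weights_runs (s : State) {a b p q : ℕ} (ha : s.nvar 11 = a) (hb : s.nvar 12 = b)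
    (hp : s.nvar 22 = p) (hq : s.nvar 23 = q) :
    Runs weights s (a * (b * 48 + 20) + 6) fun s' => ∀ i < a, ∀ j < b, s'.rarr 11 i j =
      childWeight (s.narr 50 0) (s.narr 70) (s.narr 74) (s.narr 80) (s.narr 84)
        (fun d => s.rarr 6 d 0) (s.rarr 3) (s.rarr 20) (s.rarr 24) (s.rarr 16) p q i j := by
  set W := childWeight (s.narr 50 0) (s.narr 70) (s.narr 74) (s.narr 80) (s.narr 84)
        (fun d => s.rarr 6 d 0) (s.rarr 3) (s.rarr 20) (s.rarr 24) (s.rarr 16) p q with hW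
  refine Runs.forTo_const (fun t s' => ∀ i < t, ∀ j < b, s'.rarr 11 i j = W i j) a (b * 48 + 12) ha
    (by decide) (by decide) (by decide) (by simp) ?_ (le_of_eq (by ring))
  intro i hi s' f hx hI
  have e12 : s'.nvar 12 = b := (f.nv 12 (by decide)).trans hb
  refine (Runs.forTo_const (fun t s'' => (∀ i' < i, ∀ j < b, s''.rarr 11 i' j = W i' j) ∧
    ∀ j < t, s''.rarr 11 i j = W i j) b 40 e12
    (by decide) (by decide) (by decide) ⟨hI, by simp⟩ ?_ (by omega)).mono le_rfl ?_
  · rintro j hj s'' f' hx' ⟨hI1, hI2⟩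
    have e22 : s''.nvar 22 = p := (f'.nv 22 (by decide)).trans ((f.nv 22 (by decide)).trans hp)
    have e23 : s''.nvar 23 = q := (f'.nv 23 (by decide)).trans ((f.nv 23 (by decide)).trans hq)
    have e25 : s''.nvar 25 = i := (f'.nv 25 (by decide)).trans hx
    have ea : s''.narr = s.narr := funext fun x => (f'.na x (List.not_mem_nil)).trans
      (f.na x (List.not_mem_nil))
    have er : ∀ x, x ≠ 11 → s''.rarr x = s.rarr x := fun x hx =>
      (f'.ra x (by simpa [forTo, weightStep, Prog.wra] using hx)).trans
        (f.ra x (by simpa [forTo, weightStep, Prog.wra] using hx))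
    have hset : (weightStep.den s'').rarr 11 = upd2 (s''.rarr 11) i j (W i j) := by
      simp [weightStep, Prog.den, NExp.eval, RExp.eval, upd_self, e22, e23, e25, hx', ea, er, hW,
        childWeight]
    refine Runs.of_den rfl (by decide) fun _ => ⟨fun i' hi' j' hj' => ?_, fun j' hj' => ?_⟩
    · rw [State.setN_rarr, hset, upd2_of_ne _ _ _ hi'.ne]
      exact hI1 i' hi' j' hj'
    · rw [State.setN_rarr, hset, upd2_self]
      by_cases e : j' = j
      · simp [e]
      · rw [Function.update_of_ne e]
        exact hI2 j' (by omega)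
  · rintro s'' - ⟨h1, h2⟩ i' hi' j hj
    rw [State.setN_rarr]
    rcases Nat.lt_succ_iff_lt_or_eq.1 hi' with hi' | rfl
    · exact h1 i' hi' j hj
    · exact h2 j hj

/-! ### The recurrence of the distances and its evaluation. -/

/-- The entry of `F` for the nodes `p` and `q` satisfies the recurrence of the distances of
subtrees. -/
def IsDist (dep vl nc vl' nc' : ℕ → ℕ) (ch ch' el el' : ℕ → ℕ → ℕ) (lam : ℕ → ℝ)
    (vs es E E' : ℕ → ℕ → ℝ) (S S' : ℕ → ℝ) (F : ℕ → ℕ → ℝ) (p q : ℕ) : Prop :=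
  ∃ m, F p q = lam (dep p) * vs (vl p) (vl' q) + S p + S' q + m ∧
    IsMinMatching (nc p) (nc' q) (childWeight dep ch ch' el el' lam es E E' F p q) m

/-- The recurrence at `p`, `q` reads only this entry and the rows of the children of `p`, so it
survives writing to other rows. -/
theorem IsDist.congr {dep vl nc vl' nc' : ℕ → ℕ} {ch ch' el el' : ℕ → ℕ → ℕ} {lam : ℕ → ℝ}
    {vs es E E' : ℕ → ℕ → ℝ} {S S' : ℕ → ℝ} {F F' : ℕ → ℕ → ℝ} {p q : ℕ}
    (h : IsDist dep vl nc vl' nc' ch ch' el el' lam vs es E E' S S' F p q) (hpq : F' p q = F p q)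
    (hF : ∀ i < nc p, F' (ch p i) = F (ch p i)) :
    IsDist dep vl nc vl' nc' ch ch' el el' lam vs es E E' S S' F' p q := by
  obtain ⟨m, h1, h2⟩ := h
  refine ⟨m, hpq.trans h1, h2.congr fun i hi j _ => ?_⟩
  rw [childWeight, childWeight, hF i hi]

/-- `IsDist` for the arrays in memory. -/
def IsDistAt (s : State) (F : ℕ → ℕ → ℝ) (p q : ℕ) : Prop :=
  IsDist (s.narr 50 0) (fun p => s.narr 3 (s.narr 40 0 p) 0) (s.narr 60 0)
    (fun q => s.narr 7 (s.narr 44 0 q) 0) (s.narr 64 0) (s.narr 70) (s.narr 74) (s.narr 80)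
    (s.narr 84) (fun d => s.rarr 6 d 0) (s.rarr 0) (s.rarr 3) (s.rarr 20) (s.rarr 24) (s.rarr 30 0)
    (s.rarr 34 0) F p q

/-- No child of `p` is `p` itself, so storing the new entry does not affect the weights from which
it was computed. -/
theorem distStep_runs (s : State) {p q : ℕ} (hp : s.nvar 22 = p) (hq : s.nvar 23 = q)
    (hch : ∀ i < s.narr 60 0 p, s.narr 70 p i ≠ p) :
    Runs distStep s (450 * (s.narr 60 0 p + 1) * (s.narr 64 0 q + 1) * (s.narr 64 0 q + 1))
      fun s' => ∃ x, s'.rarr 16 = upd2 (s.rarr 16) p q x ∧ IsDistAt s (upd2 (s.rarr 16) p q x) p q := by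
  set a := s.narr 60 0 p with ha
  set b := s.narr 64 0 q with hb
  refine Runs.mono (B := 10 + (a * (b * 48 + 20) + 6 + (300 * (a + 1) * (b + 1) * (b + 1) + 40)))
    ?_ ?_ (fun _ _ h => h)
  rotate_left
  · ring_nf
    have := Nat.zero_le (a * b)
    have := Nat.zero_le (a * b ^ 2)
    have := Nat.zero_le (b ^ 2)
    omega
  refine Runs.den_seq _ rfl (fun f => ?_) (Nat.add_le_add_right (by decide) _)
  set s₁ := (Prog.nset 11 (.arr 60 (.const 0) (.var 22)) ;;
    .nset 12 (.arr 64 (.const 0) (.var 23))).den s with hs₁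
  have e11 : s₁.nvar 11 = a := by simp [hs₁, Prog.den, NExp.eval, hp, ha]
  have e12 : s₁.nvar 12 = b := by simp [hs₁, Prog.den, NExp.eval, hq, hb]
  have e22 : s₁.nvar 22 = p := by simp [hs₁, Prog.den, hp]
  have e23 : s₁.nvar 23 = q := by simp [hs₁, Prog.den, hq]
  have ea : s₁.narr = s.narr := rfl
  have er : s₁.rarr = s.rarr := rfl
  clear_value s₁
  refine Runs.seq _ _ (weights_runs s₁ e11 e12 e22 e23) ?_ le_rfl
  intro s₂ f₂ hW
  rw [ea, er] at hW
  refine Runs.seq _ _ (hung_runs s₂ ((f₂.nv 11 (by decide)).trans e11)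
    ((f₂.nv 12 (by decide)).trans e12)) ?_ le_rfl
  intro s₃ f₃ hm
  have hm := hm.congr (Y := childWeight (s.narr 50 0) (s.narr 70) (s.narr 74) (s.narr 80) (s.narr 84)
        (fun d => s.rarr 6 d 0) (s.rarr 3) (s.rarr 20) (s.rarr 24) (s.rarr 16) p q)
        fun i hi j hj => (hW i hi j hj).symm
  have e22 : s₃.nvar 22 = p := (f₃.nv 22 (by decide)).trans ((f₂.nv 22 (by decide)).trans e22)
  have e23 : s₃.nvar 23 = q := (f₃.nv 23 (by decide)).trans ((f₂.nv 23 (by decide)).trans e23)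
  have na : ∀ x, x ∉ hung.wna → s₃.narr x = s.narr x := fun x hx =>
    (f₃.na x hx).trans ((f₂.na x List.not_mem_nil).trans (by rw [ea]))
  have ra : ∀ x, x ∉ hung.wra → x ∉ weights.wra → s₃.rarr x = s.rarr x := fun x hx hx' =>
    (f₃.ra x hx).trans ((f₂.ra x hx').trans (by rw [er]))
  refine Runs.of_den rfl (by decide) fun _ => ?_
  refine ⟨s.rarr 6 (s.narr 50 0 p) 0 * s.rarr 0 (s.narr 3 (s.narr 40 0 p) 0)
    (s.narr 7 (s.narr 44 0 q) 0) + s.rarr 30 0 p + s.rarr 34 0 q + s₃.rvar 3, ?_, ?_⟩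
  · simp only [Prog.den, NExp.eval, RExp.eval, e22, e23, upd_self]
    rw [na 50 (by decide), na 3 (by decide), na 40 (by decide), na 7 (by decide), na 44 (by decide),
      ra 6 (by decide) (by decide), ra 0 (by decide) (by decide), ra 30 (by decide) (by decide),
      ra 34 (by decide) (by decide), ra 16 (by decide) (by decide)]
  · refine ⟨s₃.rvar 3, by rw [upd2_self, Function.update_self], hm.congr fun i hi j _ => ?_⟩
    rw [childWeight, childWeight, upd2_of_ne _ _ _ (hch i hi)]

/-- One of the two factors `b + 1` in the time of a matching is bounded by `D + 1`, and the
remaining product of numbers of children is summed over both trees separately. Hence the degree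
bound enters only linearly, and only through the second tree. -/
theorem dists_runs (s : State) {N N' B B' D : ℕ} (hN : s.nvar 30 = N) (hN' : s.nvar 34 = N')
    (hch : ∀ p < N, ∀ i < s.narr 60 0 p, p < s.narr 70 p i ∧ s.narr 70 p i < N)
    (hB : ∑ p ∈ Finset.range N, (s.narr 60 0 p + 1) ≤ B)
    (hB' : ∑ q ∈ Finset.range N', (s.narr 64 0 q + 1) ≤ B') (h1 : 1 ≤ B')
    (hD : ∀ q < N', s.narr 64 0 q ≤ D) :
    Runs dists s (500 * B * B' * (D + 1) + 6) fun s' => ∀ p < N, ∀ q < N',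
      IsDistAt s (s'.rarr 16) p q := by
  have hmono : ∀ {s' : State} {F : ℕ → ℕ → ℝ} {p q : ℕ}, (∀ x, x ∉ dists.wna → s'.narr x = s.narr x) →
      (∀ x, x ∉ dists.wra → s'.rarr x = s.rarr x) → IsDistAt s' F p q → IsDistAt s F p q := by
    intro s' F p q h1 h2 h
    simpa only [IsDistAt, h1 50 (by decide), h1 3 (by decide), h1 40 (by decide), h1 60 (by decide),
      h1 7 (by decide), h1 44 (by decide), h1 64 (by decide), h1 70 (by decide), h1 74 (by decide),
      h1 80 (by decide), h1 84 (by decide), h2 6 (by decide), h2 0 (by decide), h2 3 (by decide),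
      h2 20 (by decide), h2 24 (by decide), h2 30 (by decide), h2 34 (by decide)] using h
  refine (Runs.forTo (fun t s' => ∀ p < N, N ≤ p + t → ∀ q < N', IsDistAt s (s'.rarr 16) p q) N
    (fun t => 480 * (s.narr 60 0 (N - 1 - t) + 1) * B' * (D + 1)) hN (by decide) (by decide)
    (by decide) (by intro p hp h; omega) ?_ ?_).mono le_rfl ?_
  · intro t ht s' f hx hI
    set p := N - 1 - t with hp
    set a := s.narr 60 0 p with ha
    have hpN : p < N := by omega
    have hpos : 0 < (a + 1) * B' * (D + 1) := by positivity
    refine Runs.den_seq (470 * ((a + 1) * B' * (D + 1))) rfl (fun f' => ?_)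
      (by
        have : 480 * (a + 1) * B' * (D + 1) = 480 * ((a + 1) * B' * (D + 1)) := by ring
        simp only [Prog.time, NExp.cost]
        omega)
    set s₁ := (Prog.nset 22 (.sub (.sub (.var 30) (.var 21)) (.const 1))).den s' with hs₁
    have e22 : s₁.nvar 22 = p := by
      have : s'.nvar 30 = N := (f.nv 30 (by decide)).trans hN
      simp [hs₁, Prog.den, NExp.eval, this, hx, hp]
      omega
    have e34 : s₁.nvar 34 = N' := (f'.nv 34 (by decide)).trans ((f.nv 34 (by decide)).trans hN')
    have ea : s₁.narr = s'.narr := rfl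
    have er : s₁.rarr = s'.rarr := rfl
    clear_value s₁
    refine (Runs.forTo (fun j s'' => (∀ p' < N, N ≤ p' + t → ∀ q < N',
        IsDistAt s (s''.rarr 16) p' q) ∧ ∀ q < j, IsDistAt s (s''.rarr 16) p q) N'
      (fun q => 450 * (a + 1) * (s.narr 64 0 q + 1) * (D + 1)) e34 (by decide) (by decide)
      (by decide) ⟨by rw [State.setN_rarr, er]; exact hI, by simp⟩ ?_ ?_).mono le_rfl ?_
    · rintro q hq s'' f'' hx' ⟨hI1, hI2⟩
      have na : ∀ x, x ∉ dists.wna → s''.narr x = s.narr x := fun x hx => by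
        rw [f''.na x, ea, f.na x hx]
        intro h
        exact hx (by simpa [dists, forTo, Prog.wna] using h)
      have ra : ∀ x, x ∉ dists.wra → s''.rarr x = s.rarr x := fun x hx => by
        rw [f''.ra x, er, f.ra x hx]
        intro h
        exact hx (by simpa [dists, forTo, Prog.wra] using h)
      have e22 : s''.nvar 22 = p := (f''.nv 22 (by decide)).trans e22
      refine (distStep_runs s'' e22 hx' ?_).mono ?_ ?_
      · rw [na 60 (by decide), na 70 (by decide)]
        intro i hi
        have := hch p hpN i hi
        omega
      · rw [na 60 (by decide), na 64 (by decide)]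
        exact Nat.mul_le_mul_left _ (Nat.succ_le_succ (hD q hq))
      · rintro s₃ - ⟨x, hx3, hd⟩
        rw [State.setN_rarr, hx3]
        refine ⟨fun p' hp' hpt q' hq' => ?_, fun q' hq' => ?_⟩
        -- The finished rows have indices above `p`, and so do the children of their nodes; writing
        -- to the row `p` preserves their recurrences.
        · have hne : p' ≠ p := by omega
          refine (hI1 p' hp' hpt q' hq').congr (by rw [upd2_of_ne _ _ _ hne]) fun i hi => ?_
          have := hch p' hp' i hi
          exact upd2_of_ne _ _ _ (by omega)
        · by_cases e : q' = q
          · subst e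
            exact hmono na ra hd
          · refine (hI2 q' (by omega)).congr (by rw [upd2_self, Function.update_of_ne e])
              fun i hi => ?_
            have := hch p hpN i hi
            exact upd2_of_ne _ _ _ (by omega)
    · have h2 : ∑ q ∈ Finset.range N', (450 * (a + 1) * (s.narr 64 0 q + 1) * (D + 1) + 8) ≤
          458 * ((a + 1) * B' * (D + 1)) := by
        calc ∑ q ∈ Finset.range N', (450 * (a + 1) * (s.narr 64 0 q + 1) * (D + 1) + 8)
            ≤ ∑ q ∈ Finset.range N', 458 * (a + 1) * (D + 1) * (s.narr 64 0 q + 1) := by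
              refine Finset.sum_le_sum fun q _ => ?_
              have h1 : 0 < (a + 1) * (s.narr 64 0 q + 1) * (D + 1) := by positivity
              have h2 : 450 * (a + 1) * (s.narr 64 0 q + 1) * (D + 1) =
                450 * ((a + 1) * (s.narr 64 0 q + 1) * (D + 1)) := by ring
              have h3 : 458 * (a + 1) * (D + 1) * (s.narr 64 0 q + 1) =
                458 * ((a + 1) * (s.narr 64 0 q + 1) * (D + 1)) := by ring
              omega
          _ = 458 * (a + 1) * (D + 1) * ∑ q ∈ Finset.range N', (s.narr 64 0 q + 1) := by
              rw [Finset.mul_sum]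
          _ ≤ 458 * (a + 1) * (D + 1) * B' := Nat.mul_le_mul_left _ hB'
          _ = 458 * ((a + 1) * B' * (D + 1)) := by ring
      omega
    · rintro s'' - ⟨h1, h2⟩ p' hp' hpt q hq
      rw [State.setN_rarr]
      by_cases e : p' = p
      · rw [e]
        exact h2 q hq
      · exact h1 p' hp' (by omega) q hq
  · refine Nat.add_le_add_right ?_ 6
    rw [Finset.sum_range_reflect (fun p => 480 * (s.narr 60 0 p + 1) * B' * (D + 1) + 8) N]
    calc ∑ p ∈ Finset.range N, (480 * (s.narr 60 0 p + 1) * B' * (D + 1) + 8)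
        ≤ ∑ p ∈ Finset.range N, 500 * B' * (D + 1) * (s.narr 60 0 p + 1) := by
          refine Finset.sum_le_sum fun p _ => ?_
          have h2 : 0 < (s.narr 60 0 p + 1) * B' * (D + 1) := by positivity
          have h3 : 480 * (s.narr 60 0 p + 1) * B' * (D + 1) =
            480 * ((s.narr 60 0 p + 1) * B' * (D + 1)) := by ring
          have h4 : 500 * B' * (D + 1) * (s.narr 60 0 p + 1) =
            500 * ((s.narr 60 0 p + 1) * B' * (D + 1)) := by ring
          omega
      _ = 500 * B' * (D + 1) * ∑ p ∈ Finset.range N, (s.narr 60 0 p + 1) := by rw [Finset.mul_sum]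
      _ ≤ 500 * B' * (D + 1) * B := Nat.mul_le_mul_left _ hB
      _ = 500 * B * B' * (D + 1) := by ring
  · intro s' _ hI p hp q hq
    exact hI p hp (by omega) q hq

end CNTCost

end

noncomputable section

namespace CNTCost

/-! ## Sizes of compressed neighborhood trees -/

section

variable {n L : ℕ} {A : AdjData} {vlab : ℕ → ℕ} {G : LabeledGraph n L}

theorem LabeledGraph.sum_degree (G : LabeledGraph n L) :
    ∑ v, G.graph.degree v = 2 * G.numEdges := by
  rw [G.graph.sum_degrees_eq_twice_card_edges]
  rfl

/-- Only the start vertex can be reachable with degree zero, so over the reachable vertices degree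
plus one sums to at most `4 m + 1`. Restricting to reachable vertices is what removes `n` from the
bound. -/
theorem Encodes.sum_nodes_le (H : Encodes A vlab G) {v : Fin n} {h k N : ℕ} {vtx dep : ℕ → ℕ}
    (hn : ∀ q < N, A.IsNode v h k (vtx q) (dep q))
    (hinj : ∀ q < N, ∀ q' < N, vtx q = vtx q' → dep q = dep q' → q = q') :
    ∑ q ∈ Finset.range N, (A.deg (vtx q) + 1) ≤ 5 * (k + 1) * max 1 G.numEdges := by
  classical
  set U : Finset (Fin n) := {u | u = v ∨ G.graph.degree u ≠ 0} with hU
  have hR : ∀ e u, A.Walk v e u → u ∈ U.image Fin.val := by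
    intro e u hw
    have hlt := H.walk_lt hw
    refine Finset.mem_image.2 ⟨⟨u, hlt⟩, ?_, rfl⟩
    rw [hU, Finset.mem_filter]
    refine ⟨Finset.mem_univ _, ?_⟩
    cases e with
    | zero => exact Or.inl (Fin.ext hw)
    | succ e =>
      right
      obtain ⟨y, hy, j, hj, hu⟩ := hw
      obtain ⟨w, hw, hadj, -⟩ := H.adj ⟨y, H.walk_lt hy⟩ j hj
      have e' : (⟨u, hlt⟩ : Fin n) = w := Fin.ext (hu.symm.trans hw)
      rw [e']
      exact ((G.graph.degree_pos_iff_exists_adj w).2 ⟨_, hadj.symm⟩).ne'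
  refine (A.sum_nodes_le hn hinj (fun u => A.deg u + 1) _ hR).trans ?_
  rw [Finset.sum_image fun _ _ _ _ e => Fin.ext e]
  have h1 : ∑ u ∈ U, (A.deg u + 1) ≤ 5 * max 1 G.numEdges := by
    calc ∑ u ∈ U, (A.deg u + 1)
        ≤ ∑ u ∈ U, (2 * G.graph.degree u + if u = v then 1 else 0) := by
          refine Finset.sum_le_sum fun u hu => ?_
          rw [H.deg]
          have := (Finset.mem_filter.1 hu).2
          split <;> omega
      _ ≤ ∑ u, (2 * G.graph.degree u + if u = v then 1 else 0) :=
          Finset.sum_le_sum_of_subset (Finset.subset_univ _)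
      _ = 2 * (2 * G.numEdges) + 1 := by
          rw [Finset.sum_add_distrib, ← Finset.mul_sum, G.sum_degree]
          simp
      _ ≤ 5 * max 1 G.numEdges := by omega
  calc (k + 1) * ∑ u ∈ U, (A.deg u + 1) ≤ (k + 1) * (5 * max 1 G.numEdges) :=
        Nat.mul_le_mul_left _ h1
    _ = _ := by ring

theorem Encodes.sum_adj (H : Encodes A vlab G) (v : Fin n) (f : ℕ → ℝ) :
    ∑ j ∈ Finset.range (A.deg v), f (A.lab v j) =
      ∑ u ∈ G.graph.neighborFinset v, f (G.elabel s(v, u)) := by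
  have hadj : ∀ j, ∃ w : Fin n, j < A.deg v → A.adj v j = w ∧ G.graph.Adj v w ∧
      A.lab v j = G.elabel s(v, w) := by
    intro j
    by_cases hj : j < A.deg v
    · obtain ⟨w, hw⟩ := H.adj v j hj
      exact ⟨w, fun _ => hw⟩
    · exact ⟨v, fun h => absurd h hj⟩
  choose w hw using hadj
  refine Finset.sum_bij (fun j _ => w j) ?_ ?_ ?_ ?_
  · intro j hj
    rw [SimpleGraph.mem_neighborFinset]
    exact (hw j (Finset.mem_range.1 hj)).2.1
  · intro j hj j' hj' e
    have hj := Finset.mem_range.1 hj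
    have hj' := Finset.mem_range.1 hj'
    exact H.inj v j hj j' hj' (by rw [(hw j hj).1, (hw j' hj').1, e])
  · intro u hu
    rw [SimpleGraph.mem_neighborFinset] at hu
    obtain ⟨j, hj, e⟩ := H.surj v u hu
    exact ⟨j, Finset.mem_range.2 hj, Fin.ext ((hw j hj).1.symm.trans e)⟩
  · intro j hj
    rw [(hw j (Finset.mem_range.1 hj)).2.2]

end

/-- The input contains the weights of the levels up to `h` only, and no node of the trees is deeper.
-/
theorem sdted_congr {L : ℕ} (c : EditCosts L) {T T' : RootedTree (Fin L)} {lam lam' : ℕ → ℝ}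
    (h : ∀ u, lam (T.depth u) = lam' (T.depth u)) (h' : ∀ u, lam (T'.depth u) = lam' (T'.depth u)) :
    sdted c T T' lam = sdted c T T' lam' := by
  simp only [sdted, mappingCost, h, h']

/-! ## The memory layout of the input -/

/-- The memory `s` holds the input. -/
structure HoldsInput {n n' L : ℕ} (G : LabeledGraph n L) (H : LabeledGraph n' L) (c : EditCosts L)
    (lam : ℕ → ℝ) (h k : ℕ) (s : State) : Prop where
  n_eq : s.nvar 0 = n
  n'_eq : s.nvar 1 = n'
  h_eq : s.nvar 3 = h
  k_eq : s.nvar 4 = k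
  encG : Encodes (adjData 0 s) (fun u => s.narr 3 u 0) G
  encH : Encodes (adjData 4 s) (fun u => s.narr 7 u 0) H
  vsub : ∀ a b : Fin L, s.rarr 0 a b = c.vsub a b
  vdel : ∀ a : Fin L, s.rarr 1 a 0 = c.vdel a
  vins : ∀ a : Fin L, s.rarr 2 a 0 = c.vins a
  esub : ∀ a b : Fin L, s.rarr 3 a b = c.esub a b
  edel : ∀ a : Fin L, s.rarr 4 a 0 = c.edel a
  eins : ∀ a : Fin L, s.rarr 5 a 0 = c.eins a
  lam_eq : ∀ d ≤ h, s.rarr 6 d 0 = lam d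

section

variable {n n' L : ℕ} {G : LabeledGraph n L} {H : LabeledGraph n' L} {c : EditCosts L}
  {lam : ℕ → ℝ} {h k : ℕ} {s s' : State}

theorem HoldsInput.congr (I : HoldsInput G H c lam h k s) (hv : ∀ x < 5, s'.nvar x = s.nvar x)
    (ha : ∀ a < 8, s'.narr a = s.narr a) (hr : ∀ a < 7, s'.rarr a = s.rarr a) :
    HoldsInput G H c lam h k s' := by
  obtain ⟨h1, h2, h3, h4, h5, h6, h7, h8, h9, h10, h11, h12, h13⟩ := I
  have e1 : adjData 0 s' = adjData 0 s := by simp [adjData, ha]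
  have e2 : adjData 4 s' = adjData 4 s := by simp [adjData, ha]
  constructor <;> simpa [e1, e2, ha, hv, hr]

/-- The arrays of an encoded graph. -/
theorem LabeledGraph.encodes (G : LabeledGraph n L) (adj : G.AdjLists) :
    Encodes ⟨fun u => G.encode adj 0 u 0, G.encode adj 1, G.encode adj 2⟩
      (fun u => G.encode adj 3 u 0) G := by
  have hdeg : ∀ v : Fin n, G.encode adj 0 v 0 = G.graph.degree v := by
    intro v
    simp [LabeledGraph.encode, table]
  -- Injectivity of the lists is demanded for all natural numbers; beyond the vertices the degree
  -- cell is zero and the condition is empty.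
  have hdeg' : ∀ u, n ≤ u → G.encode adj 0 u 0 = 0 := by
    intro u hu
    simp [LabeledGraph.encode, table, hu]
  have hadj : ∀ (v : Fin n) (j) (hj : j < G.graph.degree v),
      G.encode adj 1 v j = (adj v ⟨j, hj⟩ : Fin n) := by
    intro v j hj
    simp [LabeledGraph.encode, table₂, hj]
  have hlab : ∀ (v : Fin n) (j) (hj : j < G.graph.degree v),
      G.encode adj 2 v j = G.elabel s(v, (adj v ⟨j, hj⟩ : Fin n)) := by
    intro v j hj
    simp [LabeledGraph.encode, table₂, hj]
  refine ⟨hdeg, ?_, ?_, ?_, ?_⟩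
  · intro v j hj
    simp only [hdeg] at hj
    exact ⟨adj v ⟨j, hj⟩, hadj v j hj, (adj v ⟨j, hj⟩).2, hlab v j hj⟩
  · intro v w hw
    refine ⟨(adj v).symm ⟨w, hw⟩, by simp only [hdeg, Fin.is_lt], ?_⟩
    refine (hadj v _ ((adj v).symm ⟨w, hw⟩).2).trans ?_
    rw [Fin.eta, Equiv.apply_symm_apply]
  · intro u j hj j' hj' e
    simp only at hj hj' e
    by_cases hu : u < n
    · have e1 := hdeg ⟨u, hu⟩
      simp only at e1
      rw [e1] at hj hj'
      have e2 := hadj ⟨u, hu⟩ j hj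
      have e3 := hadj ⟨u, hu⟩ j' hj'
      simp only at e2 e3
      rw [e2, e3] at e
      have := (adj ⟨u, hu⟩).injective (Subtype.ext (Fin.ext e))
      exact congrArg Fin.val this
    · rw [hdeg' u (by omega)] at hj
      omega
  · intro v
    simp [LabeledGraph.encode, table]

theorem holdsInput_initState (adjG : G.AdjLists) (adjH : H.AdjLists) :
    HoldsInput G H c lam h k (initState G H c lam h k adjG adjH) := by
  refine ⟨rfl, rfl, rfl, rfl, G.encodes adjG, H.encodes adjH, ?_, ?_, ?_, ?_, ?_, ?_, ?_⟩
  · intro a b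
    simp [initState, table₂]
  · intro a
    simp [initState, table]
  · intro a
    simp [initState, table]
  · intro a b
    simp [initState, table₂]
  · intro a
    simp [initState, table]
  · intro a
    simp [initState, table]
  · intro d hd
    simp [initState, table, Nat.lt_succ_iff, hd]

end

/-! ## The cost matrix -/

/-- Deletion or insertion costs of all vertices with their incident edges. -/
def starCosts (g N ad ae out : ℕ) : Prog :=
  forTo 32 N
    ((.nset 36 (.arr g (.var 32) (.const 0)) ;;
      .rset 4 (.arr ad (.arr (g + 3) (.var 32) (.const 0)) (.const 0))) ;;
     forTo 35 36 (.rset 4 (.add (.var 4)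
      (.arr ae (.arr (g + 2) (.var 32) (.var 35)) (.const 0)))) ;;
     .rstore out (.var 32) (.const 0) (.var 4))

theorem starCosts_runs (g N ad ae out : ℕ) (hN : N < 32) (had : ad ≠ out) (hae : ae ≠ out)
    (s : State) {n : ℕ} (hn : s.nvar N = n) :
    Runs (starCosts g N ad ae out) s (∑ v ∈ Finset.range n, (20 * s.narr g v 0 + 40) + 6) fun s' =>
      ∀ v < n, s'.rarr out v 0 = s.rarr ad (s.narr (g + 3) v 0) 0 +
        ∑ j ∈ Finset.range (s.narr g v 0), s.rarr ae (s.narr (g + 2) v j) 0 := by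
  refine Runs.forTo (fun i s' => ∀ v < i, s'.rarr out v 0 = s.rarr ad (s.narr (g + 3) v 0) 0 +
        ∑ j ∈ Finset.range (s.narr g v 0), s.rarr ae (s.narr (g + 2) v j) 0) n
    (fun v => 20 * s.narr g v 0 + 32) hn (by omega) (by simp [forTo, Prog.wn])
    (by simp [forTo, Prog.wn]; omega) (by simp) ?_ le_rfl
  intro v _ s' f hx hI
  have na : s'.narr = s.narr := funext fun a => f.na a (by simp [forTo, Prog.wna])
  have ra : ∀ a, a ≠ out → s'.rarr a = s.rarr a := fun a ha =>
    f.ra a (by simp [forTo, Prog.wra, ha])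
  refine Runs.den_seq (20 * s.narr g v 0 + 20) rfl (fun f' => ?_)
    (by simp only [Prog.time, NExp.cost, RExp.cost]; omega)
  set s₁ := Prog.den (.nset 36 (.arr g (.var 32) (.const 0)) ;;
      .rset 4 (.arr ad (.arr (g + 3) (.var 32) (.const 0)) (.const 0))) s' with hs₁
  have e36 : s₁.nvar 36 = s.narr g v 0 := by simp [hs₁, Prog.den, NExp.eval, hx, na]
  have e32 : s₁.nvar 32 = v := by simp [hs₁, Prog.den, hx]
  have e4 : s₁.rvar 4 = s.rarr ad (s.narr (g + 3) v 0) 0 := by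
    simp [hs₁, Prog.den, NExp.eval, RExp.eval, hx, na, ra _ had]
  have na₁ : s₁.narr = s.narr := na
  have ra₁ : s₁.rarr = s'.rarr := rfl
  clear_value s₁
  refine Runs.seq (s.narr g v 0 * 18 + 6) 14 (Runs.forTo_const (fun i s'' => s''.rvar 4 =
      s.rarr ad (s.narr (g + 3) v 0) 0 +
        ∑ j ∈ Finset.range i, s.rarr ae (s.narr (g + 2) v j) 0) (s.narr g v 0) 10 e36 (by decide)
      (by simp [Prog.wn]) (by simp [Prog.wn]) (by simp [State.setN_rvar, e4]) ?_ ?_) ?_ (by omega)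
  · intro i _ s₂ f₂ hx₂ h4
    refine Runs.of_den rfl (by simp [Prog.time, NExp.cost, RExp.cost]) fun _ => ?_
    have e32 : s₂.nvar 32 = v := (f₂.nv 32 (by simp [forTo, Prog.wn])).trans e32
    have na₂ : s₂.narr = s.narr := (funext fun a => f₂.na a (by simp [forTo, Prog.wna])).trans na₁
    have ra₂ : s₂.rarr = s'.rarr := (funext fun a => f₂.ra a (by simp [forTo, Prog.wra])).trans ra₁
    rw [State.setN_rvar, Finset.sum_range_succ, ← add_assoc, ← h4]
    simp [Prog.den, NExp.eval, RExp.eval, e32, na₂, ra₂, hx₂, ra _ hae]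
  · omega
  · intro s₂ f₂ h4
    refine Runs.of_den rfl (by simp [Prog.time, NExp.cost, RExp.cost]) fun _ => ?_
    have e32 : s₂.nvar 32 = v := (f₂.nv 32 (by simp [forTo, Prog.wn])).trans e32
    have ra₂ : s₂.rarr = s'.rarr := (funext fun a => f₂.ra a (by simp [forTo, Prog.wra])).trans ra₁
    intro u hu
    simp only [State.setN_rarr, Prog.den, NExp.eval, RExp.eval, e32, upd_self, ra₂, h4]
    by_cases e : u = v
    · rw [e, upd2_self, Function.update_self]
    · rw [upd2_of_ne _ _ _ e]
      exact hI u (by omega)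

/-- The distance of the trees of the vertices in the registers `32` and `33`. The register `31`
counts the calls, and each call uses fresh rows of the arrays `10`, `14`, `20`, `24`. -/
def pairDist : Prog :=
  (.nset 31 (.add (.var 31) (.const 1)) ;;
   .nset 20 (.var 31) ;;
   .nset 24 (.var 31) ;;
   .nset 10 (.var 32) ;;
   .nset 14 (.var 33)) ;;
  build 0 ;; build 4 ;; desc 0 1 4 ;; desc 4 2 5 ;; dists ;;
  .rstore 7 (.var 32) (.var 33) (.arr 16 (.const 0) (.const 0))

/-- The rows of the arrays `10`, `14`, `20`, `24` after the row `r` are unused. -/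
def Fresh (s : State) (r : ℕ) : Prop :=
  ∀ r', r < r' → ∀ w, s.narr 10 r' w = 0 ∧ s.narr 14 r' w = 0 ∧ s.narr 20 r' w = 0 ∧
    s.narr 24 r' w = 0

/-! ### One pair of vertices, all pairs, and the complete matrix. -/

section

variable {n n' L : ℕ} {G : LabeledGraph n L} {H : LabeledGraph n' L} {c : EditCosts L}
  {lam : ℕ → ℝ} {h k : ℕ} {s : State}

theorem IsTree.sum_nc_le {A : AdjData} {v N : ℕ} {vtx dep nc : ℕ → ℕ} {ch el : ℕ → ℕ → ℕ}
    (hT : IsTree A v h k N vtx dep nc ch el) :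
    ∑ q ∈ Finset.range N, (nc q + 1) ≤ ∑ q ∈ Finset.range N, (A.deg (vtx q) + 1) :=
  Finset.sum_le_sum fun q hq => Nat.succ_le_succ (hT.kids q (Finset.mem_range.1 hq)).le

theorem Encodes.nc_le_maxDegree {A : AdjData} {vlab : ℕ → ℕ} (E : Encodes A vlab G) {v : Fin n}
    {N : ℕ} {vtx dep nc : ℕ → ℕ} {ch el : ℕ → ℕ → ℕ} (hT : IsTree A v h k N vtx dep nc ch el)
    {q : ℕ} (hq : q < N) : nc q ≤ G.graph.maxDegree := by
  refine (hT.kids q hq).le.trans ?_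
  have hlt := E.walk_lt (hT.node q hq).walk
  have := E.deg ⟨_, hlt⟩
  simp only at this
  rw [this]
  exact G.graph.degree_le_maxDegree _

theorem sdted_of_isDist (I : HoldsInput G H c lam h k s) (v : Fin n) (v' : Fin n')
    {N N' : ℕ} {vtx dep nc vtx' dep' nc' : ℕ → ℕ} {ch el ch' el' : ℕ → ℕ → ℕ}
    (hT : IsTree (adjData 0 s) v h k N vtx dep nc ch el)
    (hT' : IsTree (adjData 4 s) v' h k N' vtx' dep' nc' ch' el')
    {E E' F : ℕ → ℕ → ℝ} {S S' : ℕ → ℝ}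
    (C : SubtreeCosts N dep (fun q => s.narr 3 (vtx q) 0) nc ch el (fun d => s.rarr 6 d 0)
      (fun a => s.rarr 1 a 0) (fun a => s.rarr 4 a 0) E S)
    (C' : SubtreeCosts N' dep' (fun q => s.narr 7 (vtx' q) 0) nc' ch' el' (fun d => s.rarr 6 d 0)
      (fun a => s.rarr 2 a 0) (fun a => s.rarr 5 a 0) E' S')
    (hF : ∀ p < N, ∀ q < N', IsDist dep (fun q => s.narr 3 (vtx q) 0) nc
      (fun q => s.narr 7 (vtx' q) 0) nc' ch ch' el el' (fun d => s.rarr 6 d 0) (s.rarr 0)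
      (s.rarr 3) E E' S S' F p q) :
    F 0 0 = substEntry G H c lam h k v v' := by
  obtain ⟨φ, idx, P⟩ := I.encG.exists_presents hT
  obtain ⟨φ', idx', P'⟩ := I.encH.exists_presents hT'
  choose! m hm1 hm2 using hF
  rw [← sdted_eq P P' C C' I.vdel I.edel I.vins I.eins I.vsub I.esub hm1 hm2]
  refine sdted_congr c (fun u => I.lam_eq _ ?_) fun u => I.lam_eq _ ?_ <;>
  · rw [CompressedTree.unfold_depth]
    exact CompressedTree.depth_le _ _

/-- The two searches and the two computations of subtree costs are linear in the sizes `B` and `B'`,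
and the distances dominate with `B * B'` times the degree bound. There is no term in `n`, since
unused rows replace the clearing of tables. -/
theorem pairDist_runs (I : HoldsInput G H c lam h k s) (v : Fin n) (v' : Fin n') {ρ : ℕ}
    (hρ : s.nvar 31 = ρ) (hv : s.nvar 32 = v) (hv' : s.nvar 33 = v') (hs : Fresh s ρ) :
    Runs pairDist s (50000 * (k + 1) * (k + 1) *
        (max 1 G.numEdges * max 1 H.numEdges * max 1 (max G.graph.maxDegree H.graph.maxDegree)))
      fun s' => s'.rarr 7 = upd2 (s.rarr 7) v v' (substEntry G H c lam h k v v') ∧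
        s'.nvar 31 = ρ + 1 ∧ Fresh s' (ρ + 1) := by
  set m := max 1 G.numEdges with hm
  set m' := max 1 H.numEdges with hm'
  set Δ := max 1 (max G.graph.maxDegree H.graph.maxDegree) with hΔ
  set B := 5 * (k + 1) * m with hB
  set B' := 5 * (k + 1) * m' with hB'
  have hB1 : 1 ≤ B := Nat.succ_le_of_lt (by positivity)
  have hB1' : 1 ≤ B' := Nat.succ_le_of_lt (by positivity)
  have hΔ1 : 1 ≤ Δ := le_max_left _ _
  -- The factor 2 covers graphs without edges, where `Δ` is still one.
  have hD : H.graph.maxDegree + 1 ≤ 2 * Δ := by omega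
  set t := B * B' * (H.graph.maxDegree + 1) with ht
  set A := adjData 0 s with hA
  set A' := adjData 4 s with hA'
  -- The coefficients `2 * 130 + 2 * 100 + 500 * 2` and the additive constants stay below 1700, and
  -- the factors 5 in `B` and `B'` contribute 25.
  have htime : 1700 * (B * B' * Δ) ≤ 50000 * (k + 1) * (k + 1) * (m * m' * Δ) := by
    have e1 : 1700 * (B * B' * Δ) = 42500 * ((k + 1) * (k + 1) * (m * m' * Δ)) := by
      rw [hB, hB']
      ring
    have e2 : 50000 * (k + 1) * (k + 1) * (m * m' * Δ) =
        50000 * ((k + 1) * (k + 1) * (m * m' * Δ)) := by ring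
    omega
  have hBB : B ≤ B * B' * Δ := by
    rw [mul_assoc]
    exact Nat.le_mul_of_pos_right _ (by positivity)
  have hBB' : B' ≤ B * B' * Δ := by
    rw [mul_right_comm]
    exact Nat.le_mul_of_pos_left _ (by positivity)
  have htt : t ≤ 2 * (B * B' * Δ) :=
    (Nat.mul_le_mul_left _ hD).trans_eq (by ring)
  have he : 500 * B * B' * (H.graph.maxDegree + 1) = 500 * t := by
    rw [ht]
    ring
  refine Runs.den_seq ((130 * B + 40) + ((130 * B' + 40) + ((100 * B + 6) + ((100 * B' + 6) +
    ((500 * t + 6) + 10))))) rfl (fun f₁ => ?_)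
    (by simp only [Prog.time, NExp.cost]; omega)
  set s₁ := (Prog.nset 31 (.add (.var 31) (.const 1)) ;;
    .nset 20 (.var 31) ;; .nset 24 (.var 31) ;; .nset 10 (.var 32) ;; .nset 14 (.var 33)).den s
    with hs₁
  have e31 : s₁.nvar 31 = ρ + 1 := by simp [hs₁, Prog.den, NExp.eval, hρ]
  have e20 : s₁.nvar 20 = ρ + 1 := by simp [hs₁, Prog.den, NExp.eval, hρ]
  have e24 : s₁.nvar 24 = ρ + 1 := by simp [hs₁, Prog.den, NExp.eval, hρ]
  have e10 : s₁.nvar 10 = v := by simp [hs₁, Prog.den, NExp.eval, hv]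
  have e14 : s₁.nvar 14 = v' := by simp [hs₁, Prog.den, NExp.eval, hv']
  have e32 : s₁.nvar 32 = v := by simp [hs₁, Prog.den, hv]
  have e33 : s₁.nvar 33 = v' := by simp [hs₁, Prog.den, hv']
  have e3 : s₁.nvar 3 = h := by simp [hs₁, Prog.den, I.h_eq]
  have e4 : s₁.nvar 4 = k := by simp [hs₁, Prog.den, I.k_eq]
  have na₁ : s₁.narr = s.narr := rfl
  have ra₁ : s₁.rarr = s.rarr := rfl
  clear_value s₁
  refine Runs.seq _ _ (build_runs (g := 0) (A := A) s₁ (by rw [hA, adjData, adjData, na₁]) I.encG.inj e3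
    e4 e20 e10 (fun w => by rw [na₁]; exact (hs _ (Nat.lt_succ_self _) w).1)
    (fun w => by rw [na₁]; exact (hs _ (Nat.lt_succ_self _) w).2.2.1)
    fun N vtx dep => I.encG.sum_nodes_le) ?_ le_rfl
  rintro s₂ f₂ ⟨hT, hr⟩
  have na₂ : ∀ a, a ∉ (build 0).wna → s₂.narr a = s.narr a := fun a ha => by rw [f₂.na a ha, na₁]
  have ra₂ : s₂.rarr = s.rarr := (funext fun a => f₂.ra a List.not_mem_nil).trans ra₁
  refine Runs.seq _ _ (build_runs (g := 4) (A := A') s₂ (by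
      rw [hA', adjData, adjData, na₂ _ (by decide), na₂ _ (by decide), na₂ _ (by decide)])
    I.encH.inj ((f₂.nv 3 (by decide)).trans e3)
    ((f₂.nv 4 (by decide)).trans e4) ((f₂.nv 24 (by decide)).trans e24)
    ((f₂.nv 14 (by decide)).trans e14)
    (fun w => by
      rw [na₂ _ (by decide)]
      exact (hs _ (Nat.lt_succ_self _) w).2.1)
    (fun w => by
      rw [na₂ _ (by decide)]
      exact (hs _ (Nat.lt_succ_self _) w).2.2.2)
    fun N vtx dep => I.encH.sum_nodes_le) ?_ le_rfl
  rintro s₃ f₃ ⟨hT', hr'⟩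
  have na₃ : ∀ a < 8, s₃.narr a = s.narr a := fun a ha => by
    rw [f₃.na a ((by decide : ∀ a < 8, a ∉ (build 4).wna) a ha),
      na₂ a ((by decide : ∀ a < 8, a ∉ (build 0).wna) a ha)]
  have ra₃ : s₃.rarr = s.rarr := (funext fun a => f₃.ra a List.not_mem_nil).trans ra₂
  set N := s₂.nvar 30 with hN
  have n₃ : s₃.nvar 30 = N := f₃.nv 30 (by decide)
  have hT : IsTree A v h k N (s₃.narr 40 0) (s₃.narr 50 0) (s₃.narr 60 0) (s₃.narr 70)
      (s₃.narr 80) := by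
    rw [f₃.na 40 (by decide), f₃.na 50 (by decide), f₃.na 60 (by decide), f₃.na 70 (by decide),
      f₃.na 80 (by decide)]
    exact hT
  obtain ⟨N', n₃'⟩ : ∃ N', s₃.nvar 34 = N' := ⟨_, rfl⟩
  have hT' : IsTree A' v' h k N' (s₃.narr 44 0) (s₃.narr 54 0) (s₃.narr 64 0) (s₃.narr 74)
      (s₃.narr 84) := by
    rw [← n₃']
    exact hT'
  have hsum := hT.sum_nc_le.trans (I.encG.sum_nodes_le hT.node hT.inj)
  have hsum' := hT'.sum_nc_le.trans (I.encH.sum_nodes_le hT'.node hT'.inj)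
  have hlt : ∀ p < N, ∀ i < s₃.narr 60 0 p, p < s₃.narr 70 p i ∧ s₃.narr 70 p i < N :=
    fun p hp i hi => ⟨((hT.kids p hp).child i hi).1, ((hT.kids p hp).child i hi).2.1⟩
  have hlt' : ∀ p < N', ∀ i < s₃.narr 64 0 p, p < s₃.narr 74 p i ∧ s₃.narr 74 p i < N' :=
    fun p hp i hi => ⟨((hT'.kids p hp).child i hi).1, ((hT'.kids p hp).child i hi).2.1⟩
  refine Runs.seq _ _ (desc_runs 0 1 4 (by decide) (by decide) s₃ n₃ rfl rfl rfl rfl rfl hlt hsum)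
    ?_ le_rfl
  intro s₄ f₄ C
  have na₄ : s₄.narr = s₃.narr := funext fun a => f₄.na a List.not_mem_nil
  refine Runs.seq _ _ (desc_runs 4 2 5 (by decide) (by decide) s₄ ((f₄.nv 34 (by decide)).trans n₃')
    rfl rfl rfl rfl rfl (by rw [na₄]; exact hlt') (by rw [na₄]; exact hsum')) ?_ le_rfl
  intro s₅ f₅ C'
  have na₅ : s₅.narr = s₃.narr := (funext fun a => f₅.na a List.not_mem_nil).trans na₄
  have ra₄ : ∀ a < 7, s₄.rarr a = s.rarr a := fun a ha => by
    rw [f₄.ra a ((by decide : ∀ a < 7, a ∉ (desc 0 1 4).wra) a ha), ra₃]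
  have ra₅ : ∀ a < 7, s₅.rarr a = s.rarr a := fun a ha => by
    rw [f₅.ra a ((by decide : ∀ a < 7, a ∉ (desc 4 2 5).wra) a ha), ra₄ a ha]
  refine Runs.seq _ _ ((dists_runs s₅ (B := B) (B' := B') ((f₅.nv 30 (by decide)).trans ((f₄.nv 30 (by decide)).trans n₃))
    ((f₅.nv 34 (by decide)).trans ((f₄.nv 34 (by decide)).trans n₃')) (by rw [na₅]; exact hlt)
    (by rw [na₅]; exact hsum) (by rw [na₅]; exact hsum') hB1'
    (by
      rw [na₅]
      exact fun q hq => I.encH.nc_le_maxDegree hT' hq)).mono (by rw [he]) fun _ _ h => h) ?_ le_rfl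
  intro s₆ f₆ hF
  have hF' : s₆.rarr 16 0 0 = substEntry G H c lam h k v v' := by
    refine sdted_of_isDist I v v' hT hT' (E := s₅.rarr 20) (S := s₅.rarr 30 0) (E' := s₅.rarr 24)
      (S' := s₅.rarr 34 0) ?_ ?_ ?_
    · rw [f₅.ra 20 (by decide), f₅.ra 30 (by decide), ← na₃ 3 (by decide), ← ra₃]
      exact C
    · rw [← na₃ 7 (by decide), ← na₄, ← ra₄ 6 (by decide), ← ra₄ 2 (by decide),
        ← ra₄ 5 (by decide)]
      exact C'
    · intro p hp q hq
      rw [← na₃ 3 (by decide), ← na₃ 7 (by decide), ← na₅, ← ra₅ 6 (by decide),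
        ← ra₅ 0 (by decide), ← ra₅ 3 (by decide)]
      exact hF p hp q hq
  have n₆ : ∀ x, x ∉ (build 0 ;; build 4 ;; desc 0 1 4 ;; desc 4 2 5 ;; dists).wn →
      s₆.nvar x = s₁.nvar x := fun x hx =>
    (f₂.seq_left.trans (f₃.seq_left.trans (f₄.seq_left.trans
      (f₅.seq_left.trans f₆.seq_right).seq_right).seq_right).seq_right).nv x hx
  have e₇ : s₆.rarr 7 = s.rarr 7 := by
    rw [f₆.ra 7 (by decide), f₅.ra 7 (by decide), f₄.ra 7 (by decide), ra₃]
  refine Runs.of_den rfl (by decide) fun _ => ⟨?_, ?_, ?_⟩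
  · simp only [Prog.den, NExp.eval, RExp.eval, upd_self, n₆ 32 (by decide), n₆ 33 (by decide), e32,
      e33, hF', e₇]
  · exact (n₆ 31 (by decide)).trans e31
  · intro r' hr1 w
    have hs' := hs r' (by omega) w
    -- The searches touch `dist` and `lev` only in the row `ρ + 1`, and the other programs do not
    -- touch these arrays, so all later rows are still zero.
    have g₁ : ∀ a, a ∉ dists.wna → s₆.narr a = s₃.narr a := fun a ha => by rw [f₆.na a ha, na₅]
    obtain ⟨h1, h2⟩ := hr r' (by omega)
    obtain ⟨h3, h4⟩ := hr' r' (by omega)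
    simp only [Prog.den]
    rw [g₁ 10 (by decide), g₁ 14 (by decide), g₁ 20 (by decide), g₁ 24 (by decide),
      f₃.na 10 (by decide), f₃.na 20 (by decide)]
    simp only [Nat.zero_add, Nat.reduceAdd] at h1 h2 h3 h4
    rw [h1, h2, h3, h4, na₁, f₂.na 14 (by decide), f₂.na 24 (by decide), na₁]
    exact hs'

theorem HoldsInput.of_frame {P : Prog} {s' : State} (I : HoldsInput G H c lam h k s)
    (f : Frame P s s') (hv : ∀ x < 5, x ∉ P.wn) (ha : ∀ a < 8, a ∉ P.wna)
    (hr : ∀ a < 7, a ∉ P.wra) : HoldsInput G H c lam h k s' :=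
  I.congr (fun x hx => f.nv x (hv x hx)) (fun a h => f.na a (ha a h)) fun a h => f.ra a (hr a h)

/-- The distances of all pairs of trees. -/
def pairDists : Prog := forTo 32 0 (forTo 33 1 pairDist)

theorem pairDists_runs (I : HoldsInput G H c lam h k s) {ρ : ℕ} (hρ : s.nvar 31 = ρ)
    (hs : Fresh s ρ) {T : ℕ} (hT : 50000 * (k + 1) * (k + 1) * (max 1 G.numEdges *
      max 1 H.numEdges * max 1 (max G.graph.maxDegree H.graph.maxDegree)) ≤ T) :
    Runs pairDists s (n * (n' * (T + 8) + 14) + 6) fun s' =>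
      ∀ (v : Fin n) (v' : Fin n'), s'.rarr 7 v v' = substEntry G H c lam h k v v' := by
  -- The number of calls so far is left existential: all that matters is that the rows beyond the
  -- current counter are unused.
  refine (Runs.forTo_const (fun i s' => (∃ ρ, s'.nvar 31 = ρ ∧ Fresh s' ρ) ∧
    ∀ (v : Fin n) (v' : Fin n'), (v : ℕ) < i → s'.rarr 7 v v' = substEntry G H c lam h k v v') n
    (n' * (T + 8) + 6) I.n_eq (by decide) (by decide) (by decide)
    ⟨⟨ρ, (s.setN_nvar_of_ne 0 (by decide)).trans hρ, hs⟩, by simp⟩ ?_ le_rfl).mono le_rfl fun s' _ h v v' => h.2 v v' v.2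
  rintro i hi s₁ f₁ hx₁ ⟨⟨ρ, hρ, hs⟩, h1⟩
  have I₁ := I.of_frame f₁ (by decide) (by decide) (by decide)
  refine (Runs.forTo_const (fun j s' => (∃ ρ, s'.nvar 31 = ρ ∧ Fresh s' ρ) ∧
    (∀ (v : Fin n) (v' : Fin n'), (v : ℕ) < i →
      s'.rarr 7 v v' = substEntry G H c lam h k v v') ∧
    ∀ v' : Fin n', (v' : ℕ) < j → s'.rarr 7 i v' = substEntry G H c lam h k ⟨i, hi⟩ v') n' T
    I₁.n'_eq (by decide) (by decide) (by decide)
    ⟨⟨ρ, (s₁.setN_nvar_of_ne 0 (by decide)).trans hρ, hs⟩, h1, by simp⟩ ?_ le_rfl).mono le_rfl ?_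
  · rintro j hj s₂ f₂ hx₂ ⟨⟨ρ, hρ, hs⟩, h2, h3⟩
    have I₂ := I₁.of_frame f₂ (by decide) (by decide) (by decide)
    have e32 : s₂.nvar 32 = i := (f₂.nv 32 (by decide)).trans hx₁
    refine (pairDist_runs I₂ ⟨i, hi⟩ ⟨j, hj⟩ hρ e32 hx₂ hs).mono hT ?_
    rintro s₃ - ⟨h4, h5, h6⟩
    refine ⟨⟨ρ + 1, h5, h6⟩, fun v v' hv => ?_, fun v' hv' => ?_⟩
    · rw [State.setN_rarr, h4, upd2_of_ne _ _ _ hv.ne]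
      exact h2 v v' hv
    · rw [State.setN_rarr, h4, upd2_self]
      by_cases e : v' = ⟨j, hj⟩
      · rw [e, Function.update_self]
      · have hne : (v' : ℕ) ≠ j := fun e' => e (Fin.ext e')
        rw [Function.update_of_ne hne]
        exact h3 v' (by omega)
  · rintro s₂ - ⟨hF, h2, h3⟩
    refine ⟨hF, fun v v' hv => ?_⟩
    by_cases e : v = ⟨i, hi⟩
    · rw [e]
      exact h3 v' v'.2
    · have hne : (v : ℕ) ≠ i := fun e' => e (Fin.ext e')
      exact h2 v v' (by omega)

/-- Computation of the cost matrix. -/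
def costMatrix : Prog := pairDists ;; starCosts 0 0 1 4 8 ;; starCosts 4 1 2 5 9

theorem Encodes.sum_deg {A : AdjData} {vlab : ℕ → ℕ} (E : Encodes A vlab G) :
    ∑ v ∈ Finset.range n, (20 * A.deg v + 40) = 40 * G.numEdges + 40 * n := by
  rw [Finset.sum_range fun v => 20 * A.deg v + 40]
  simp only [E.deg]
  rw [Finset.sum_add_distrib, ← Finset.mul_sum, G.sum_degree]
  simp
  ring

/-- Every factor of the product `X` is at least one, so each of `n`, `n'`, the numbers of edges and
the constant overheads is bounded by `X` up to a constant. The deletion and insertion costs are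
linear in the graphs and disappear in the 300. -/
theorem costMatrix_runs (I : HoldsInput G H c lam h k s) {ρ : ℕ} (hρ : s.nvar 31 = ρ)
    (hs : Fresh s ρ) :
    Runs costMatrix s ((50000 * (k + 1) * (k + 1) + 300) * (max 1 n * max 1 n' *
        max 1 G.numEdges * max 1 H.numEdges * max 1 (max G.graph.maxDegree H.graph.maxDegree)))
      (HoldsCostMatrix G H c lam h k) := by
  set a := max 1 n with ha
  set a' := max 1 n' with ha'
  set m := max 1 G.numEdges with hm
  set m' := max 1 H.numEdges with hm'
  set Δ := max 1 (max G.graph.maxDegree H.graph.maxDegree) with hΔ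
  set K := 50000 * (k + 1) * (k + 1) with hK
  have ha1 : 1 ≤ a := le_max_left _ _
  have ha1' : 1 ≤ a' := le_max_left _ _
  have hm1 : 1 ≤ m := le_max_left _ _
  have hm1' : 1 ≤ m' := le_max_left _ _
  have hΔ1 : 1 ≤ Δ := le_max_left _ _
  set X := a * a' * m * m' * Δ with hX
  have h1 : a ≤ X := by
    rw [hX, mul_assoc, mul_assoc, mul_assoc]
    exact Nat.le_mul_of_pos_right _ (by positivity)
  have h2 : a' ≤ X := by
    rw [hX, mul_assoc, mul_assoc, mul_right_comm]
    exact Nat.le_mul_of_pos_left _ (by positivity)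
  have h3 : m ≤ X := by
    rw [hX, mul_assoc, mul_right_comm]
    exact Nat.le_mul_of_pos_left _ (by positivity)
  have h4 : m' ≤ X := by
    rw [hX, mul_right_comm]
    exact Nat.le_mul_of_pos_left _ (by positivity)
  have h5 : a * a' ≤ X := by
    rw [hX, mul_assoc, mul_assoc]
    exact Nat.le_mul_of_pos_right _ (by positivity)
  -- The loop overheads 8, 14 and 6 add up to 28.
  have hpairs : n * (n' * (K * (m * m' * Δ) + 8) + 14) + 6 ≤ K * X + 28 * X := by
    calc n * (n' * (K * (m * m' * Δ) + 8) + 14) + 6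
        ≤ a * (a' * (K * (m * m' * Δ) + 8) + 14) + 6 :=
          Nat.add_le_add_right (Nat.mul_le_mul (le_max_right _ _) (Nat.add_le_add_right
            (Nat.mul_le_mul_right _ (le_max_right _ _)) _)) _
      _ = K * X + 8 * (a * a') + 14 * a + 6 := by
          rw [hX]
          ring
      _ ≤ K * X + 28 * X := by omega
  refine Runs.seq (K * X + 28 * X) (172 * X) ((pairDists_runs I hρ hs le_rfl).mono hpairs
    fun _ _ h => h) ?_ (by rw [add_mul]; omega)
  intro s₁ f₁ hd
  have I₁ := I.of_frame f₁ (by decide) (by decide) (by decide)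
  refine Runs.seq (86 * X) (86 * X) ((starCosts_runs 0 0 1 4 8 (by decide) (by decide) (by decide)
    s₁ I₁.n_eq).mono ?_ fun _ _ h => h) ?_ (by omega)
  -- The time is `40 m + 40 n + 6`, hence the coefficient 86.
  · have := I₁.encG.sum_deg
    simp only [adjData] at this
    rw [this]
    omega
  intro s₂ f₂ hdel
  have I₂ := I₁.of_frame f₂ (by decide) (by decide) (by decide)
  refine (starCosts_runs 4 1 2 5 9 (by decide) (by decide) (by decide) s₂ I₂.n'_eq).mono ?_ ?_
  · have := I₂.encH.sum_deg
    simp only [adjData] at this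
    rw [this]
    omega
  intro s₃ f₃ hins
  refine ⟨fun v v' => ?_, fun v => ?_, fun v' => ?_⟩
  · rw [f₃.ra 7 (by decide), f₂.ra 7 (by decide)]
    exact hd v v'
  · rw [f₃.ra 8 (by decide), hdel v v.2, delEntry, ← I₁.vdel, ← I₁.encG.vlab]
    simp only [← I₁.edel]
    rw [← I₁.encG.sum_adj v fun a => s₁.rarr 4 a 0]
    rfl
  · rw [hins v' v'.2, insEntry, ← I₂.vins, ← I₂.encH.vlab]
    simp only [← I₂.eins]
    rw [← I₂.encH.sum_adj v' fun a => s₂.rarr 5 a 0]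
    rfl

/-- By the handshake lemma twice the number of edges is at most `n * D`. -/
theorem LabeledGraph.max_numEdges_le {D : ℕ} (hD : G.graph.maxDegree ≤ D) :
    max 1 G.numEdges ≤ max 1 n * max 1 D := by
  have h1 : 2 * G.numEdges ≤ n * D := by
    rw [← G.sum_degree]
    refine (Finset.sum_le_card_nsmul _ _ D fun v _ =>
      (G.graph.degree_le_maxDegree v).trans hD).trans_eq ?_
    simp
  have h2 : n * D ≤ max 1 n * max 1 D := Nat.mul_le_mul (le_max_right _ _) (le_max_right _ _)
  have h3 : 0 < max 1 n * max 1 D := by positivity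
  omega

theorem costMatrix_computesWithin (adjG : G.AdjLists) (adjH : H.AdjLists) :
    ComputesWithin G H c lam h k costMatrix adjG adjH
      ((50000 * (k + 1) * (k + 1) + 300) * (max 1 n * max 1 n' * max 1 G.numEdges *
        max 1 H.numEdges * max 1 (max G.graph.maxDegree H.graph.maxDegree))) :=
  costMatrix_runs (ρ := 0) (holdsInput_initState adjG adjH) rfl
    fun _ _ _ => ⟨rfl, rfl, rfl, rfl⟩

end

end CNTCost

end

/-! ### The two time bounds. -/

open CNTCost in
theorem theorem3 :
    ∃ P : Prog,
      (∀ k : ℕ, ∃ K : ℕ,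
        ∀ (L n n' : ℕ) (G : LabeledGraph n L) (H : LabeledGraph n' L)
          (adjG : G.AdjLists) (adjH : H.AdjLists)
          (c : EditCosts L) (lam : ℕ → ℝ) (_ : ∀ i, 0 ≤ lam i) (h : ℕ),
          ComputesWithin G H c lam h k P adjG adjH
            (K * (max 1 n * max 1 n' * max 1 G.numEdges * max 1 H.numEdges *
              max 1 (max G.graph.maxDegree H.graph.maxDegree)))) ∧
      (∀ k D : ℕ, ∃ K : ℕ,
        ∀ (L n n' : ℕ) (G : LabeledGraph n L) (H : LabeledGraph n' L)
          (adjG : G.AdjLists) (adjH : H.AdjLists)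
          (c : EditCosts L) (lam : ℕ → ℝ) (_ : ∀ i, 0 ≤ lam i) (h : ℕ),
          max G.graph.maxDegree H.graph.maxDegree ≤ D →
          ComputesWithin G H c lam h k P adjG adjH
            (K * (max 1 n * max 1 n') ^ 2)) := by
  refine ⟨costMatrix, fun k => ⟨_, fun L n n' G H adjG adjH c lam _ h =>
    costMatrix_computesWithin adjG adjH⟩, fun k D =>
    ⟨(50000 * (k + 1) * (k + 1) + 300) * (max 1 D * max 1 D * max 1 D),
      fun L n n' G H adjG adjH c lam _ h hD => ?_⟩⟩
  obtain ⟨t, s, hex, ht, hs⟩ := costMatrix_computesWithin (c := c) (lam := lam) (h := h) (k := k)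
    adjG adjH
  refine ⟨t, s, hex, ht.trans ?_, hs⟩
  rw [mul_assoc _ (max 1 D * max 1 D * max 1 D)]
  refine Nat.mul_le_mul_left _ ?_
  -- Replacing each number of edges by vertices times degree squares the product of the vertex
  -- numbers; the two degree factors and the bound on `Δ` give the cube of `max 1 D` in the
  -- constant.
  calc max 1 n * max 1 n' * max 1 G.numEdges * max 1 H.numEdges *
        max 1 (max G.graph.maxDegree H.graph.maxDegree)
      ≤ max 1 n * max 1 n' * (max 1 n * max 1 D) * (max 1 n' * max 1 D) * max 1 D :=
        Nat.mul_le_mul (Nat.mul_le_mul (Nat.mul_le_mul_left _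
          (LabeledGraph.max_numEdges_le ((le_max_left _ _).trans hD)))
          (LabeledGraph.max_numEdges_le ((le_max_right _ _).trans hD))) (max_le_max le_rfl hD)
    _ = max 1 D * max 1 D * max 1 D * (max 1 n * max 1 n') ^ 2 := by ring
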